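/- Let $\mathcal H$ be the upper half plane. For $k\in\mathbb Z$ and $m\in\mathbb Z_{\ge0}$, let $\widetilde{J}_{k,m}$ be the space of weak Jacobi forms of weight $k$ and index $m$ on $\mathrm{SL}(2,\mathbb Z)\ltimes\mathbb Z^2$: the holomorphic $\Phi:\mathcal H\times\mathbb C\to\mathbb C$ such that, for all $\begin{pmatrix}a&b\\c&d\end{pmatrix}\in\mathrm{SL}(2,\mathbb Z)$ and $(\lambda,\mu)\in\mathbb Z^2$, $$(c\tau+d)^{-k}e^{-2\pi i m c z^2/(c\tau+d)}\,\Phi\Big(\frac{a\tau+b}{c\tau+d},\frac{z}{c\tau+d}\Big)=\Phi(\tau,z)=e^{2\pi i m(\lambda^2\tau+2\lambda z)}\,\Phi(\tau,z+\lambda\tau+\mu),$$ and with a Fourier expansion $\Phi(\tau,z)=\sum_{n\ge0}\sum_{r\in\mathbb Z,\ r^2\le4nm+m^2}c(n,r)e^{2\pi i(n\tau+rz)}$. Let $\widetilde{J}_{\mathrm{ev},*}=\bigoplus_{k\in2\mathbb Z,\ m\ge0}\widetilde{J}_{k,m}$, an algebra that contains the algebra $\mathcal M_*$ of modular forms on $\mathrm{SL}(2,\mathbb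 Z)$ (the functions in it that do not depend on $z$). For modular forms $f,g$ of weights $k,\ell$, put $\mathrm{RC}_1(f,g)=k f\,D g-\ell\,(Df)\,g$, where $D=\frac1{2\pi i}\frac{d}{d\tau}$; extend $\mathrm{RC}_1$ bilinearly to $\mathcal M_*$. Let $E_4,E_6$ be the Eisenstein series of weights $4,6$ with constant term $1$, and $\Delta=(E_4^3-E_6^2)/1728$. For $k=4,6$ let $$E_{k,1}(\tau,z)=\frac12\sum_{(c,d)=1}\sum_{\lambda\in\mathbb Z}(c\tau+d)^{-k}\exp\Big(2\pi i\Big(\lambda^2\frac{a\tau+b}{c\tau+d}+\frac{2\lambda z-cz^2}{c\tau+d}\Big)\Big),$$ where, for each coprime pair $(c,d)\in\mathbb Z^2$, integers $a,b$ are chosen with $ad-bc=1$. Let $$A=\frac{E_6E_{4,1}-E_4E_{6,1}}{144\,\Delta},\qquad B=\frac{E_4^2E_{4,1}-E_6E_{6,1}}{144\,\Delta};$$ then $A\in\widetilde{J}_{-2,1}$ and $B\in\widetilde{J}_{0,1}$. A Poisson bracket $\{\cdot,\cdot\}$ on $\widetilde{J}_{\mathrm{ev},*}$ (a $\mathbb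 C$-bilinear skew-symmetric biderivation satisfying the Jacobi identity) is called admissible if $\{f,g\}=\mathrm{RC}_1(f,g)$ for all $f,g\in\mathcal M_*$ and $\{\widetilde{J}_{k,p},\widetilde{J}_{\ell,q}\}\subset\widetilde{J}_{k+\ell+2,\,p+q}$ for all $k,\ell\in2\mathbb Z$ and $p,q\in\mathbb Z_{\ge0}$. **Proposition.** A Poisson bracket on $\widetilde{J}_{\mathrm{ev},*}$ is admissible if and only if there are $\alpha,\beta,\gamma,\delta,\lambda,\mu,\theta,\varepsilon,\xi,\eta\in\mathbb C$, belonging to one of the families $\mathcal A,\mathcal B,\mathcal C_1,\mathcal C_2,\mathcal D,\mathcal E$ below, such that $$\{E_4,E_6\}=-2E_4^3+2E_6^2,\qquad \{A,B\}=\xi E_4A^2+\eta B^2,$$ $$\{A,E_4\}=\alpha E_6A+\gamma E_4B,\qquad \{A,E_6\}=\beta E_4^2A+\delta E_6B,$$ $$\{B,E_4\}=\lambda E_4^2A+\varepsilon E_6B,\qquad \{B,E_6\}=\mu E_4E_6A+\theta E_4^2B.$$ Moreover, for every choice of parameters in one of the families there is exactly one Poisson bracket on $\widetilde{J}_{\mathrm{ev},*}$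 with these values. The families are: - $\mathcal A$: $\gamma\ne0$ and $\varepsilon$ arbitrary, $\alpha=\varepsilon$, $\beta=\frac32\varepsilon+1$, $\delta=\gamma$, $\lambda=\frac4\gamma$, $\mu=\frac8\gamma$, $\theta=\frac32\varepsilon-1$, $\xi=\frac4\gamma\varepsilon$, $\eta=(-\frac34\varepsilon+\frac12)\gamma$; - $\mathcal B$: $\gamma,\lambda,\varepsilon$ arbitrary, $\alpha=\varepsilon+\frac23$, $\beta=\frac32\varepsilon+1$, $\delta=\frac32\gamma$, $\mu=\frac32\lambda$, $\theta=\frac32\varepsilon$, $\xi=(\frac34\varepsilon+\frac12)\lambda$, $\eta=-\frac34\varepsilon\gamma$; - $\mathcal C_1$: $\gamma\ne0$, $\alpha=4$, $\beta=6$, $\delta=-\gamma$, $\lambda=\mu=\theta=\varepsilon=\xi=\eta=0$; - $\mathcal C_2$: $\lambda\ne0$, $\mu=-2\lambda$, $\theta=6$, $\varepsilon=4$, $\alpha=\beta=\gamma=\delta=\xi=\eta=0$; - $\mathcal D$: $\varepsilon,\eta$ arbitrary, $\alpha=\varepsilon$, $\beta=\theta=\frac32\varepsilon$, $\gamma=\delta=\lambda=\mu=\xi=0$;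 - $\mathcal E$: $\varepsilon$ and $\alpha\ne\varepsilon+\frac23$ arbitrary, $\beta=\frac32\alpha$, $\theta=\frac32\varepsilon$, $\gamma=\delta=\lambda=\mu=\xi=\eta=0$. -/

import Mathlib

open UpperHalfPlane hiding I
open Complex
open scoped MatrixGroups Real

noncomputable section

/-! ### Weak Jacobi forms on the full Jacobi group -/

/-- The weight `k`, index `m` action of `γ = (a b; c d)` in `SL(2, ℤ)` on functions on `ℍ × ℂ`:
`(Φ|γ)(τ, z) = (cτ+d)^(-k) exp(-2πi m c z² / (cτ+d)) Φ((aτ+b)/(cτ+d), z/(cτ+d))`. -/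
def modularSlash (k : ℤ) (m : ℕ) (γ : SL(2, ℤ)) (Φ : ℍ × ℂ → ℂ) : ℍ × ℂ → ℂ := fun p =>
  ((γ 1 0 : ℂ) * p.1 + (γ 1 1 : ℂ)) ^ (-k) *
    cexp (-(2 * π * I * (m * (γ 1 0 : ℂ) * p.2 ^ 2 / ((γ 1 0 : ℂ) * p.1 + (γ 1 1 : ℂ))))) *
    Φ (γ • p.1, p.2 / ((γ 1 0 : ℂ) * p.1 + (γ 1 1 : ℂ)))

/-- The index `m` action of `(l, u)` in `ℤ²` on functions on `ℍ × ℂ`: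
`(Φ|(l, u))(τ, z) = exp(2πi m (l²τ + 2lz)) Φ(τ, z + lτ + u)`. -/
def ellipticSlash (m : ℕ) (l u : ℤ) (Φ : ℍ × ℂ → ℂ) : ℍ × ℂ → ℂ := fun p =>
  cexp (2 * π * I * (m * ((l : ℂ) ^ 2 * p.1 + 2 * l * p.2))) * Φ (p.1, p.2 + l * p.1 + u)

/-- `Φ : ℍ × ℂ → ℂ` is a weak Jacobi form of weight `k` and index `m` on the full Jacobi group. -/
structure IsWeakJacobiForm (k : ℤ) (m : ℕ) (Φ : ℍ × ℂ → ℂ) : Prop where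
  holomorphic : DifferentiableOn ℂ (fun w : ℂ × ℂ => Φ (ofComplex w.1, w.2)) {w | 0 < w.1.im}
  modular : ∀ γ : SL(2, ℤ), modularSlash k m γ Φ = Φ
  elliptic : ∀ l u : ℤ, ellipticSlash m l u Φ = Φ
  fourier : ∃ c : ℕ → ℤ → ℂ, (∀ (n : ℕ) (r : ℤ), 4 * (n : ℤ) * m + (m : ℤ) ^ 2 < r ^ 2 → c n r = 0) ∧
    ∀ (τ : ℍ) (z : ℂ), HasSum
      (fun i : ℕ × ℤ => c i.1 i.2 * cexp (2 * π * I * (i.1 * (τ : ℂ) + i.2 * z))) (Φ (τ, z))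

/-- The space of weak Jacobi forms of weight `k` and index `m`. -/
def weakJacobi (k : ℤ) (m : ℕ) : Submodule ℂ (ℍ × ℂ → ℂ) where
  carrier := {Φ | IsWeakJacobiForm k m Φ}
  zero_mem' := by
    refine ⟨?_, fun γ => ?_, fun l u => ?_, fun _ _ => 0, by simp, fun τ z => ?_⟩
    · simp
    · funext p; simp [modularSlash]
    · funext p; simp [ellipticSlash]
    · simp
  add_mem' := by
    rintro Φ Ψ ⟨h1, h2, h3, c, hc, h4⟩ ⟨g1, g2, g3, d, hd, g4⟩
    refine ⟨h1.add g1, fun γ => ?_, fun l u => ?_, fun n r => c n r + d n r, ?_, fun τ z => ?_⟩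
    · conv_rhs => rw [← h2 γ, ← g2 γ]
      funext p; simp [modularSlash, mul_add]
    · conv_rhs => rw [← h3 l u, ← g3 l u]
      funext p; simp [ellipticSlash, mul_add]
    · intro n r h; simp [hc n r h, hd n r h]
    · simpa [add_mul] using (h4 τ z).add (g4 τ z)
  smul_mem' := by
    rintro a Φ ⟨h1, h2, h3, c, hc, h4⟩
    refine ⟨h1.const_mul a, fun γ => ?_, fun l u => ?_, fun n r => a * c n r, ?_, fun τ z => ?_⟩
    · conv_rhs => rw [← h2 γ]
      funext p; simp [modularSlash]; ring
    · conv_rhs => rw [← h3 l u]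
      funext p; simp [ellipticSlash]; ring
    · intro n r h; simp [hc n r h]
    · simpa [mul_assoc] using (h4 τ z).mul_left a

theorem weakJacobi_index_bound {n₁ n₂ m₁ m₂ : ℕ} {r₁ r₂ : ℤ}
    (h₁ : r₁ ^ 2 ≤ 4 * (n₁ : ℤ) * m₁ + (m₁ : ℤ) ^ 2)
    (h₂ : r₂ ^ 2 ≤ 4 * (n₂ : ℤ) * m₂ + (m₂ : ℤ) ^ 2) :
    (r₁ + r₂) ^ 2 ≤ 4 * ((n₁ + n₂ : ℕ) : ℤ) * (m₁ + m₂ : ℕ) + ((m₁ + m₂ : ℕ) : ℤ) ^ 2 := by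
  push_cast
  have hn₁ : (0 : ℤ) ≤ n₁ := by positivity
  have hn₂ : (0 : ℤ) ≤ n₂ := by positivity
  have hm₁ : (0 : ℤ) ≤ m₁ := by positivity
  have hm₂ : (0 : ℤ) ≤ m₂ := by positivity
  generalize (n₁ : ℤ) = a₁ at *
  generalize (n₂ : ℤ) = a₂ at *
  generalize (m₁ : ℤ) = b₁ at *
  generalize (m₂ : ℤ) = b₂ at *
  set e₁ := 4 * a₁ + b₁ with he₁
  set e₂ := 4 * a₂ + b₂ with he₂
  have h₁' : r₁ ^ 2 ≤ b₁ * e₁ := by rw [he₁]; linarith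
  have h₂' : r₂ ^ 2 ≤ b₂ * e₂ := by rw [he₂]; linarith
  have hs : 0 ≤ b₁ * e₂ + b₂ * e₁ := by positivity
  have key : 2 * (r₁ * r₂) ≤ b₁ * e₂ + b₂ * e₁ := by
    refine le_of_sq_le_sq ?_ hs
    have h3 : r₁ ^ 2 * r₂ ^ 2 ≤ (b₁ * e₁) * (b₂ * e₂) :=
      mul_le_mul h₁' h₂' (sq_nonneg _) (by positivity)
    nlinarith [sq_nonneg (b₁ * e₂ - b₂ * e₁)]
  have : 4 * (a₁ + a₂) * (b₁ + b₂) + (b₁ + b₂) ^ 2 =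
      b₁ * e₁ + b₂ * e₂ + (b₁ * e₂ + b₂ * e₁) := by rw [he₁, he₂]; ring
  rw [this]
  linarith [add_sq r₁ r₂]

/-- The coefficients of the product of two double series indexed by `ℕ × ℤ`. -/
def fourierMul (c d : ℕ → ℤ → ℂ) (n : ℕ) (r : ℤ) : ℂ :=
  ∑' x : (fun x : (ℕ × ℤ) × (ℕ × ℤ) => (x.1.1 + x.2.1, x.1.2 + x.2.2)) ⁻¹' {(n, r)},
    c x.1.1.1 x.1.1.2 * d x.1.2.1 x.1.2.2

/-- The Cauchy product of two double series of the form `∑ c(n, r) e(n, r)`, with `e` multiplicative. -/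
theorem hasSum_fourier_mul {c d e : ℕ → ℤ → ℂ} {a b : ℂ}
    (he : ∀ n₁ n₂ r₁ r₂, e (n₁ + n₂) (r₁ + r₂) = e n₁ r₁ * e n₂ r₂)
    (h : HasSum (fun i : ℕ × ℤ => c i.1 i.2 * e i.1 i.2) a)
    (g : HasSum (fun i : ℕ × ℤ => d i.1 i.2 * e i.1 i.2) b) :
    HasSum (fun i : ℕ × ℤ => fourierMul c d i.1 i.2 * e i.1 i.2) (a * b) := by
  have hs := h.mul g (summable_mul_of_summable_norm (f := fun i : ℕ × ℤ => c i.1 i.2 * e i.1 i.2)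
    (g := fun i : ℕ × ℤ => d i.1 i.2 * e i.1 i.2) h.summable.norm g.summable.norm)
  have hs' := hs.tsum_fiberwise
    (fun x : (ℕ × ℤ) × (ℕ × ℤ) => (x.1.1 + x.2.1, x.1.2 + x.2.2))
  refine (congrArg (fun F => HasSum F (a * b)) (funext fun i => ?_)).mpr hs'
  rw [fourierMul, ← tsum_mul_right]
  refine tsum_congr fun x => ?_
  obtain ⟨⟨⟨n₁, r₁⟩, ⟨n₂, r₂⟩⟩, hx⟩ := x
  obtain ⟨n, r⟩ := i
  simp only [Set.mem_preimage, Set.mem_singleton_iff, Prod.mk.injEq] at hx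
  obtain ⟨rfl, rfl⟩ := hx
  simp only [he]
  ring

theorem weakJacobi_mul {k₁ k₂ : ℤ} {m₁ m₂ : ℕ} {Φ Ψ : ℍ × ℂ → ℂ}
    (hΦ : Φ ∈ weakJacobi k₁ m₁) (hΨ : Ψ ∈ weakJacobi k₂ m₂) :
    Φ * Ψ ∈ weakJacobi (k₁ + k₂) (m₁ + m₂) := by
  obtain ⟨h1, h2, h3, c, hc, h4⟩ : IsWeakJacobiForm k₁ m₁ Φ := hΦ
  obtain ⟨g1, g2, g3, d, hd, g4⟩ : IsWeakJacobiForm k₂ m₂ Ψ := hΨ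
  refine ⟨h1.mul g1, fun γ => ?_, fun l u => ?_, ?_⟩
  · conv_rhs => rw [← h2 γ, ← g2 γ]
    funext p
    have hne : (γ 1 0 : ℂ) * p.1 + (γ 1 1 : ℂ) ≠ 0 := by
      simpa [denom] using denom_ne_zero γ p.1
    simp only [modularSlash, Pi.mul_apply, neg_add, zpow_add₀ hne, Nat.cast_add, add_mul, add_div,
      mul_add, Complex.exp_add]
    ring
  · conv_rhs => rw [← h3 l u, ← g3 l u]
    funext p
    simp only [ellipticSlash, Pi.mul_apply, Nat.cast_add, add_mul, mul_add, Complex.exp_add]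
    ring
  · refine ⟨fourierMul c d, ?_, fun τ z => ?_⟩
    · intro n r h
      refine (tsum_congr fun x => ?_).trans tsum_zero
      obtain ⟨⟨⟨n₁, r₁⟩, ⟨n₂, r₂⟩⟩, hx⟩ := x
      simp only [Set.mem_preimage, Set.mem_singleton_iff, Prod.mk.injEq] at hx
      obtain ⟨rfl, rfl⟩ := hx
      by_cases hc' : 4 * (n₁ : ℤ) * m₁ + (m₁ : ℤ) ^ 2 < r₁ ^ 2
      · simp [hc _ _ hc']
      by_cases hd' : 4 * (n₂ : ℤ) * m₂ + (m₂ : ℤ) ^ 2 < r₂ ^ 2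
      · simp [hd _ _ hd']
      exact absurd (weakJacobi_index_bound (not_lt.mp hc') (not_lt.mp hd')) (not_le.mpr h)
    · refine hasSum_fourier_mul (c := c) (d := d)
        (e := fun n r => cexp (2 * π * I * (n * (τ : ℂ) + r * z))) (fun n₁ n₂ r₁ r₂ => ?_)
        (h4 τ z) (g4 τ z)
      rw [← Complex.exp_add]
      congr 1
      push_cast
      ring

theorem const_mem_weakJacobi (a : ℂ) : (fun _ => a) ∈ weakJacobi 0 0 := by
  refine ⟨differentiableOn_const a, fun γ => ?_, fun l u => ?_,
    fun n r => if n = 0 ∧ r = 0 then a else 0, ?_, fun τ z => ?_⟩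
  · funext p; simp [modularSlash]
  · funext p; simp [ellipticSlash]
  · rintro n r h
    refine if_neg ?_
    rintro ⟨rfl, rfl⟩
    simp at h
  · convert hasSum_single (f := fun i : ℕ × ℤ => (if i.1 = 0 ∧ i.2 = 0 then a else 0) *
      cexp (2 * π * I * (i.1 * (τ : ℂ) + i.2 * z))) (0, 0) ?_ using 1
    · simp
    · rintro ⟨n, r⟩ h
      rw [if_neg, zero_mul]
      rintro ⟨rfl, rfl⟩
      exact h rfl

/-- The algebra of weak Jacobi forms of even weight: the sum, inside the algebra of functions on
`ℍ × ℂ`, of the spaces of weak Jacobi forms of weight `k ∈ 2ℤ` and index `m ∈ ℤ_{≥ 0}`. -/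
def evenWeakJacobi : Subalgebra ℂ (ℍ × ℂ → ℂ) where
  carrier := (⨆ i : {k : ℤ // Even k} × ℕ, weakJacobi i.1 i.2 : Submodule ℂ (ℍ × ℂ → ℂ))
  add_mem' := fun h g => Submodule.add_mem _ h g
  algebraMap_mem' := fun a => Submodule.mem_iSup_of_mem (⟨0, Even.zero⟩, 0) (const_mem_weakJacobi a)
  mul_mem' := by
    intro Φ Ψ hΦ hΨ
    refine Submodule.iSup_induction _ (motive := fun Φ => Φ * Ψ ∈ _) hΦ (fun i Φ hΦ => ?_) ?_ ?_
    · refine Submodule.iSup_induction _ (motive := fun Ψ => Φ * Ψ ∈ _) hΨ (fun j Ψ hΨ => ?_) ?_ ?_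
      · exact Submodule.mem_iSup_of_mem (⟨i.1 + j.1, i.1.2.add j.1.2⟩, i.2 + j.2)
          (weakJacobi_mul hΦ hΨ)
      · rw [mul_zero]; exact Submodule.zero_mem _
      · intro x y hx hy; rw [mul_add]; exact Submodule.add_mem _ hx hy
    · rw [zero_mul]; exact Submodule.zero_mem _
    · intro x y hx hy; rw [add_mul]; exact Submodule.add_mem _ hx hy

theorem weakJacobi_le_evenWeakJacobi {k : ℤ} (hk : Even k) {m : ℕ} {Φ : ℍ × ℂ → ℂ}
    (h : Φ ∈ weakJacobi k m) : Φ ∈ evenWeakJacobi :=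
  Submodule.mem_iSup_of_mem (p := fun i : {k : ℤ // Even k} × ℕ => weakJacobi i.1 i.2)
    (⟨k, hk⟩, m) h

/-! ### Modular forms as weak Jacobi forms of index zero -/

/-- A modular form, viewed as a function on `ℍ × ℂ` that does not depend on the second variable. -/
def modularLift {k : ℤ} (f : ModularForm 𝒮ℒ k) : ℍ × ℂ → ℂ := fun p => f p.1

theorem modularLift_mem_weakJacobi {k : ℤ} (f : ModularForm 𝒮ℒ k) :
    modularLift f ∈ weakJacobi k 0 := by
  refine ⟨?_, fun γ => ?_, fun l u => ?_,
    fun n r => if r = 0 then (qExpansion 1 f).coeff n else 0, ?_, fun τ z => ?_⟩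
  · have h := UpperHalfPlane.mdifferentiable_iff.mp (ModularFormClass.holo f)
    exact h.comp differentiableOn_fst fun w hw => hw
  · funext p
    have hne : (γ 1 0 : ℂ) * p.1 + (γ 1 1 : ℂ) ≠ 0 := by
      simpa [denom] using denom_ne_zero γ p.1
    have h := SlashInvariantForm.slash_action_eqn'' f
      (γ := Matrix.SpecialLinearGroup.mapGL ℝ γ) (MonoidHom.mem_range.mpr ⟨γ, rfl⟩) p.1
    have h' : f (γ • p.1) = ((γ 1 0 : ℂ) * p.1 + (γ 1 1 : ℂ)) ^ k * f p.1 := by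
      have e : γ • p.1 = Matrix.SpecialLinearGroup.mapGL ℝ γ • p.1 := rfl
      rw [e, h]
      simp [denom]
    simp only [modularSlash, modularLift, h']
    rw [← mul_assoc, mul_right_comm _ _ (_ ^ k), ← zpow_add₀ hne]
    simp
  · funext p; simp [ellipticSlash, modularLift]
  · intro n r h
    refine if_neg ?_
    rintro rfl
    simp at h
  · have hs := ModularForm.hasSum_qExpansion f one_pos one_mem_strictPeriods_SL τ
    have hinj : Function.Injective fun n : ℕ => ((n, 0) : ℕ × ℤ) := fun a b h => by simpa using h
    refine (hinj.hasSum_iff ?_).mp ?_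
    · rintro ⟨n, r⟩ hr
      have : r ≠ 0 := by rintro rfl; exact hr ⟨n, rfl⟩
      simp [this]
    · change HasSum _ (f τ)
      convert hs using 2 with n
      simp [Function.Periodic.qParam, ← Complex.exp_nat_mul]
      ring_nf
      simp

/-- A modular form of even weight, as an element of the algebra of weak Jacobi forms. -/
def modularToJacobi {k : ℤ} (hk : Even k) (f : ModularForm 𝒮ℒ k) : evenWeakJacobi :=
  ⟨modularLift f, weakJacobi_le_evenWeakJacobi hk (modularLift_mem_weakJacobi f)⟩

/-- The first Rankin-Cohen bracket `RC₁(f, g) = k f D(g) - l D(f) g` of modular forms `f`, `g` of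
weights `k`, `l`, where `D = (2πi)⁻¹ d/dτ`. -/
def rankinCohenOne {k l : ℤ} (f : ModularForm 𝒮ℒ k) (g : ModularForm 𝒮ℒ l) : ℍ → ℂ := fun τ =>
  k * f τ * Derivative.normalizedDerivOfComplex g τ -
    l * Derivative.normalizedDerivOfComplex f τ * g τ

/-! ### The generators -/

/-- The Jacobi-Eisenstein series of weight `k` and index `m`:
`(1/2) ∑_{(c,d)=1} ∑_{l ∈ ℤ} (cτ+d)^(-k) exp(2πi m (l² (aτ+b)/(cτ+d) + 2lz/(cτ+d) - cz²/(cτ+d)))`,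
where, for each coprime pair `(c, d)`, integers `a`, `b` with `ad - bc = 1` are chosen
(here `a` and `-b` are the Bézout coefficients of `d` and `c`; the summand of `l` does not depend
on this choice, since another one adds an integer to `(aτ+b)/(cτ+d)`). -/
def jacobiEisenstein (k : ℤ) (m : ℕ) : ℍ × ℂ → ℂ := fun p =>
  1 / 2 * ∑' v : {v : ℤ × ℤ // IsCoprime v.1 v.2}, ∑' l : ℤ,
    ((v.1.1 : ℂ) * p.1 + v.1.2) ^ (-k) *
      cexp (2 * π * I * m *
        ((l : ℂ) ^ 2 * (((Int.gcdB v.1.1 v.1.2 : ℂ) * p.1 - Int.gcdA v.1.1 v.1.2) /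
            ((v.1.1 : ℂ) * p.1 + v.1.2))
          + 2 * l * p.2 / ((v.1.1 : ℂ) * p.1 + v.1.2)
          - v.1.1 * p.2 ^ 2 / ((v.1.1 : ℂ) * p.1 + v.1.2)))

/-- `Φ_{10,1} = (E₆ E_{4,1} - E₄ E_{6,1}) / 144`. -/
def jacobiPhi10 : ℍ × ℂ → ℂ := fun p =>
  1 / 144 * (ModularForm.E₆ p.1 * jacobiEisenstein 4 1 p - ModularForm.E₄ p.1 * jacobiEisenstein 6 1 p)

/-- `Φ_{12,1} = (E₄² E_{4,1} - E₆ E_{6,1}) / 144`. -/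
def jacobiPhi12 : ℍ × ℂ → ℂ := fun p =>
  1 / 144 * (ModularForm.E₄ p.1 ^ 2 * jacobiEisenstein 4 1 p -
    ModularForm.E₆ p.1 * jacobiEisenstein 6 1 p)

/-- `Δ = (E₄³ - E₆²) / 1728`. -/
def modularDelta (τ : ℍ) : ℂ := 1 / 1728 * (ModularForm.E₄ τ ^ 3 - ModularForm.E₆ τ ^ 2)

/-- The generator `A = Φ_{10,1} / Δ`. -/
def jacobiA : ℍ × ℂ → ℂ := fun p => jacobiPhi10 p / modularDelta p.1

/-- The generator `B = Φ_{12,1} / Δ`. -/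
def jacobiB : ℍ × ℂ → ℂ := fun p => jacobiPhi12 p / modularDelta p.1

/-- `E₄` as an element of the algebra of weak Jacobi forms. -/
def genE4 : evenWeakJacobi := modularToJacobi (k := 4) (by decide) ModularForm.E₄

/-- `E₆` as an element of the algebra of weak Jacobi forms. -/
def genE6 : evenWeakJacobi := modularToJacobi (k := 6) (by decide) ModularForm.E₆

/-! ### Admissible Poisson brackets -/

/-- A bilinear map on a commutative `ℂ`-algebra is a Poisson bracket: a Lie bracket that is a
derivation in each argument. -/
structure IsPoissonBracket {R : Type*} [CommRing R] [Algebra ℂ R] (P : R →ₗ[ℂ] R →ₗ[ℂ] R) :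
    Prop where
  skew : ∀ f g, P f g = -P g f
  leibniz : ∀ f g h, P f (g * h) = P f g * h + g * P f h
  jacobi : ∀ f g h, P f (P g h) + P g (P h f) + P h (P f g) = 0

/-- Admissible Poisson brackets on the algebra of weak Jacobi forms of even weight: they extend the
first Rankin-Cohen bracket of modular forms, raise the weight by `2` and add the indices. -/
structure IsAdmissible (P : evenWeakJacobi →ₗ[ℂ] evenWeakJacobi →ₗ[ℂ] evenWeakJacobi) : Prop where
  poisson : IsPoissonBracket P
  extends_rankinCohen : ∀ (k l : ℤ) (hk : Even k) (hl : Even l)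
    (f : ModularForm 𝒮ℒ k) (g : ModularForm 𝒮ℒ l),
    (P (modularToJacobi hk f) (modularToJacobi hl g) : ℍ × ℂ → ℂ) =
      fun p => rankinCohenOne f g p.1
  homogeneous : ∀ (k l : ℤ) (p q : ℕ), Even k → Even l → ∀ f g : evenWeakJacobi,
    (f : ℍ × ℂ → ℂ) ∈ weakJacobi k p → (g : ℍ × ℂ → ℂ) ∈ weakJacobi l q →
      (P f g : ℍ × ℂ → ℂ) ∈ weakJacobi (k + l + 2) (p + q)

/-- The ten complex parameters of a bracket. -/
structure BracketParams where
  (α β γ δ lam μ θ ε ξ η : ℂ)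

/-- The bracket `P` takes on `E₄`, `E₆`, `A`, `B` the values prescribed by the parameters. -/
structure HasGeneratorValues (P : evenWeakJacobi →ₗ[ℂ] evenWeakJacobi →ₗ[ℂ] evenWeakJacobi)
    (A B : evenWeakJacobi) (t : BracketParams) : Prop where
  e4_e6 : P genE4 genE6 = (-2 : ℂ) • genE4 ^ 3 + (2 : ℂ) • genE6 ^ 2
  a_e4 : P A genE4 = t.α • (genE6 * A) + t.γ • (genE4 * B)
  a_e6 : P A genE6 = t.β • (genE4 ^ 2 * A) + t.δ • (genE6 * B)
  b_e4 : P B genE4 = t.lam • (genE4 ^ 2 * A) + t.ε • (genE6 * B)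
  b_e6 : P B genE6 = t.μ • (genE4 * genE6 * A) + t.θ • (genE4 ^ 2 * B)
  a_b : P A B = t.ξ • (genE4 * A ^ 2) + t.η • B ^ 2

namespace BracketParams

/-- Family `𝒜`. -/
def FamilyA (t : BracketParams) : Prop :=
  t.γ ≠ 0 ∧ t.α = t.ε ∧ t.β = 3 / 2 * t.ε + 1 ∧ t.δ = t.γ ∧ t.lam = 4 / t.γ ∧ t.μ = 8 / t.γ ∧
    t.θ = 3 / 2 * t.ε - 1 ∧ t.ξ = 4 / t.γ * t.ε ∧ t.η = (-(3 / 4) * t.ε + 1 / 2) * t.γ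

/-- Family `ℬ`. -/
def FamilyB (t : BracketParams) : Prop :=
  t.α = t.ε + 2 / 3 ∧ t.β = 3 / 2 * t.ε + 1 ∧ t.δ = 3 / 2 * t.γ ∧ t.μ = 3 / 2 * t.lam ∧
    t.θ = 3 / 2 * t.ε ∧ t.ξ = (3 / 4 * t.ε + 1 / 2) * t.lam ∧ t.η = -(3 / 4) * t.ε * t.γ

/-- Family `𝒞₁`. -/
def FamilyC₁ (t : BracketParams) : Prop :=
  t.γ ≠ 0 ∧ t.α = 4 ∧ t.β = 6 ∧ t.δ = -t.γ ∧ t.lam = 0 ∧ t.μ = 0 ∧ t.θ = 0 ∧ t.ε = 0 ∧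
    t.ξ = 0 ∧ t.η = 0

/-- Family `𝒞₂`. -/
def FamilyC₂ (t : BracketParams) : Prop :=
  t.lam ≠ 0 ∧ t.α = 0 ∧ t.β = 0 ∧ t.γ = 0 ∧ t.δ = 0 ∧ t.μ = -2 * t.lam ∧ t.θ = 6 ∧ t.ε = 4 ∧
    t.ξ = 0 ∧ t.η = 0

/-- Family `𝒟`. -/
def FamilyD (t : BracketParams) : Prop :=
  t.α = t.ε ∧ t.β = 3 / 2 * t.ε ∧ t.γ = 0 ∧ t.δ = 0 ∧ t.lam = 0 ∧ t.μ = 0 ∧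
    t.θ = 3 / 2 * t.ε ∧ t.ξ = 0

/-- Family `ℰ`. -/
def FamilyE (t : BracketParams) : Prop :=
  t.α ≠ t.ε + 2 / 3 ∧ t.β = 3 / 2 * t.α ∧ t.γ = 0 ∧ t.δ = 0 ∧ t.lam = 0 ∧ t.μ = 0 ∧
    t.θ = 3 / 2 * t.ε ∧ t.ξ = 0 ∧ t.η = 0

/-- The parameters belong to one of the six families. -/
def InTable (t : BracketParams) : Prop :=
  t.FamilyA ∨ t.FamilyB ∨ t.FamilyC₁ ∨ t.FamilyC₂ ∨ t.FamilyD ∨ t.FamilyE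

end BracketParams

end

/-! ### Modular forms of level one: uniqueness in low weight, Ramanujan's formulas, generation by
`E₄` and `E₆`. -/

open scoped Manifold Topology ModularForm
open Filter

/-! The algebra of weak Jacobi forms of even weight is the polynomial ring on `E₄`, `E₆`, `A`, `B`
(`aeval_jacobiGen_bijective`). A skew biderivation on it is therefore a free choice of the six
brackets of generators, and the Jacobi identity is a finite system of polynomial equations.

Construction of `A` and `B`. The series `E_{k,1}` is a sum over coprime pairs of translates of one
theta series. The theta series costs a factor `|cτ+d|^(3/2)`, so the sum converges because `k - 3/2
> 2`. A modular form of weight below 12 is determined by its limit at the cusp. This gives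
`E_{4,1}(τ,0) = E₄` and `E_{6,1}(τ,0) = E₆`, and it expresses the coefficients of `z²` through the
derivatives of `E₄` and `E₆`. With Ramanujan's formulas one finds `A = (2πi)² z² + …` and `B = 12 +
…` near `z = 0`. Dividing by `Δ` creates no pole at the cusp: the numerators vanish there, and the
theta decomposition turns this into a Fourier expansion of the required shape
(`mem_weakJacobi_of_tendsto`).

Generation. If a form of weight `k` and index `m` vanishes to order `n` at `z = 0`, its leading
Taylor coefficient is a modular form of weight `k + n`, hence a polynomial in `E₄` and `E₆`. For `n
= 2i ≤ 2m` it is cancelled by a multiple of `A^i B^(m-i)`; odd orders do not occur. The process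
stops after order `2m`. Indeed, for fixed `τ` an even theta function of degree `m` has only `m + 1`
free Fourier coefficients, so the `m + 1` products `A^i B^(m-i)` span all of them, and such a
combination is determined by its Taylor coefficients up to `2m`.

Independence. The elliptic and modular transformations allow the arguments of a polynomial relation
to be rescaled by infinitely many, hence by all, factors. Together with the infinitely many values
of `A/B` and of `E₄³/E₆²`, the relation then holds at all points with nonzero coordinates
(`eq_zero_of_eval_generators`).

Brackets. Weight and index leave exactly two monomials for each bracket involving `A` or `B`, whence
the ten parameters; `{E₄, E₆}` is the Rankin-Cohen bracket. The Jacobi identity on the four triples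
of generators is the system `IsConsistent`, whose solutions are the six families: apart from linear
substitutions, it forces quadratic equations on `α - ε` and `β - θ`. Conversely, a biderivation with
the prescribed generator values is homogeneous and restricts to the Rankin-Cohen bracket, because
both properties pass from generators to products and sums. -/

/-- `f` transforms like a modular form of weight `k` under `SL(2, ℤ)`. -/
def IsModularInvariant (k : ℤ) (f : ℍ → ℂ) : Prop :=
  ∀ (γ : SL(2, ℤ)) (τ : ℍ), f (γ • τ) = ((γ 1 0 : ℂ) * τ + (γ 1 1 : ℂ)) ^ k * f τ

theorem modular_denom_ne_zero (γ : SL(2, ℤ)) (τ : ℍ) : (γ 1 0 : ℂ) * τ + (γ 1 1 : ℂ) ≠ 0 := by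
  simpa [denom] using denom_ne_zero γ τ

theorem modular_denom_eq (γ : SL(2, ℤ)) (τ : ℍ) :
    denom (γ : GL (Fin 2) ℝ) τ = (γ 1 0 : ℂ) * τ + (γ 1 1 : ℂ) := by
  simp [denom]

theorem isModularInvariant_iff_slash {k : ℤ} {f : ℍ → ℂ} :
    IsModularInvariant k f ↔ ∀ γ : SL(2, ℤ), f ∣[k] γ = f := by
  refine forall_congr' fun γ => ⟨fun h => funext fun τ => ?_, fun h τ => ?_⟩
  · have hne := modular_denom_ne_zero γ τ
    rw [ModularForm.SL_slash_apply, h τ, mul_right_comm, modular_denom_eq, ← zpow_add₀ hne,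
      add_neg_cancel, zpow_zero, one_mul]
  · have hne := modular_denom_ne_zero γ τ
    have h' := congrFun h τ
    rw [ModularForm.SL_slash_apply] at h'
    rw [← h', mul_left_comm, modular_denom_eq, ← zpow_add₀ hne, add_neg_cancel, zpow_zero, mul_one]

theorem ModularForm.isModularInvariant {k : ℤ} (f : ModularForm 𝒮ℒ k) : IsModularInvariant k f :=
  isModularInvariant_iff_slash.mpr fun γ =>
    SlashInvariantFormClass.slash_action_eq f _ (MonoidHom.mem_range.mpr ⟨γ, rfl⟩)

/-- The level one modular form with the given underlying function. -/
def modularFormOfInvariant {k : ℤ} {f : ℍ → ℂ} (h : IsModularInvariant k f) (hol : MDiff f)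
    (hb : IsBoundedAtImInfty f) : ModularForm 𝒮ℒ k where
  toFun := f
  slash_action_eq' := by
    rintro _ ⟨γ, rfl⟩
    exact isModularInvariant_iff_slash.mp h γ
  holo' := hol
  bdd_at_cusps' := by
    intro c hc
    rw [OnePoint.isBoundedAt_iff_forall_SL2Z hc]
    intro γ _
    rw [isModularInvariant_iff_slash.mp h γ]
    exact hb

/-- The form is an analytic function of `q` near `q = 0`, and `q` tends to `0` at the cusp. -/
theorem ModularForm.tendsto_atImInfty {k : ℤ} (f : ModularForm 𝒮ℒ k) :
    Tendsto f atImInfty (𝓝 ((qExpansion 1 f).coeff 0)) := by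
  have hper := SlashInvariantFormClass.periodic_comp_ofComplex f one_mem_strictPeriods_SL
  have ha := analyticAt_cuspFunction_zero one_pos hper f.holo' (ModularFormClass.bdd_at_infty f)
  rw [qExpansion_coeff_zero one_pos ha hper, ← cuspFunction_apply_zero one_pos ha hper]
  have : (cuspFunction 1 f ∘ fun τ : ℍ ↦ Function.Periodic.qParam 1 τ) = f := by
    funext τ
    simpa using eq_cuspFunction τ one_ne_zero hper
  simpa [this] using ha.continuousAt.tendsto.comp (qParam_tendsto_atImInfty one_pos)

/-- Such a function is a cusp form, and there are no nonzero cusp forms of weight below 12. This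
uniqueness principle gives Ramanujan's formulas and the low-order Taylor coefficients of the
Jacobi-Eisenstein series. -/
theorem IsModularInvariant.eq_zero {k : ℤ} (hk : k < 12) {f : ℍ → ℂ} (h : IsModularInvariant k f)
    (hol : MDiff f) (hz : IsZeroAtImInfty f) : f = 0 := by
  let F := modularFormOfInvariant h hol hz.isBoundedAtImInfty
  have hF : (qExpansion 1 F).coeff 0 = 0 :=
    tendsto_nhds_unique (ModularForm.tendsto_atImInfty F) hz
  have := rank_zero_iff_forall_zero.mp (CuspForm.rank_eq_zero_of_weight_lt_twelve hk)
    (ModularForm.toCuspForm F hF)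
  funext τ
  exact DFunLike.congr_fun this τ

/-- Two forms of the same weight `k < 12` with the same limit at the cusp are equal. -/
theorem IsModularInvariant.eq_of_tendsto {k : ℤ} (hk : k < 12) {f g : ℍ → ℂ}
    (hf : IsModularInvariant k f) (hg : IsModularInvariant k g) (holf : MDiff f) (holg : MDiff g)
    {a : ℂ} (hfa : Tendsto f atImInfty (𝓝 a)) (hga : Tendsto g atImInfty (𝓝 a)) : f = g := by
  refine sub_eq_zero.mp (IsModularInvariant.eq_zero hk (f := f - g) (fun γ τ => ?_) (holf.sub holg) ?_)
  · rw [Pi.sub_apply, hf γ τ, hg γ τ, ← mul_sub, Pi.sub_apply]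
  · have := hfa.sub hga
    rwa [sub_self] at this

theorem tendsto_E₄ : Tendsto ModularForm.E₄ atImInfty (𝓝 1) := by
  simpa only [EisensteinSeries.E_qExpansion_coeff_zero _ (⟨2, rfl⟩ : Even 4)] using
    ModularForm.tendsto_atImInfty ModularForm.E₄

theorem tendsto_E₆ : Tendsto ModularForm.E₆ atImInfty (𝓝 1) := by
  simpa only [EisensteinSeries.E_qExpansion_coeff_zero _ (⟨3, rfl⟩ : Even 6)] using
    ModularForm.tendsto_atImInfty ModularForm.E₆

/-- For `Im τ ≥ 1` one has `|q(τ)| ≤ |q(i)|`, so the series at `i` dominates and the limit may be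
taken term by term. -/
theorem tendsto_of_hasSum_qExpansion {f : ℍ → ℂ} {c : ℕ → ℂ}
    (h : ∀ τ : ℍ, HasSum (fun m => c m • Function.Periodic.qParam 1 τ ^ m) (f τ)) :
    Tendsto f atImInfty (𝓝 (c 0)) := by
  have hs := (h UpperHalfPlane.I).summable.norm
  have := tendsto_tsum_of_dominated_convergence (𝓕 := atImInfty)
    (f := fun (τ : ℍ) m => c m • Function.Periodic.qParam 1 τ ^ m)
    (g := fun m => if m = 0 then c 0 else 0) hs ?_ ?_
  · rw [tsum_ite_eq] at this
    simpa only [(h _).tsum_eq] using this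
  · intro m
    have hq := (qParam_tendsto_atImInfty one_pos).pow m
    have := hq.const_mul (c m)
    by_cases hm : m = 0
    · subst hm; simp
    · simpa [hm] using this
  · refine (atImInfty_mem _).mpr ⟨1, fun τ hτ m => ?_⟩
    simp only [norm_smul, norm_pow]
    gcongr
    rw [Function.Periodic.norm_qParam, Function.Periodic.norm_qParam]
    refine Real.exp_le_exp.mpr ?_
    have : 1 ≤ τ.im := hτ
    simp
    nlinarith [Real.pi_pos]

theorem tendsto_E2 : Tendsto EisensteinSeries.E2 atImInfty (𝓝 1) :=
  tendsto_of_hasSum_qExpansion (c := fun m => if m = 0 then 1 else -24 * (ArithmeticFunction.sigma 1 m : ℂ))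
    fun τ => by
      simpa only [Function.Periodic.qParam, ofReal_one, div_one] using
        EisensteinSeries.hasSum_qExpansion_E2 (z := τ)

/-- The derivative of a holomorphic function with a limit at the cusp vanishes at the cusp. -/
theorem tendsto_normalizedDeriv {f : ℍ → ℂ} (hf : MDiff f) {a : ℂ}
    (h : Tendsto f atImInfty (𝓝 a)) :
    Tendsto (Derivative.normalizedDerivOfComplex f) atImInfty (𝓝 0) := by
  have h2 : Tendsto (fun τ : ℍ => deriv (f ∘ ofComplex) τ) atImInfty (𝓝 0) := by
    rw [Metric.tendsto_nhds] at h ⊢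
    intro ε hε
    obtain ⟨A, hA⟩ := (atImInfty_mem _).mp (h (ε / 2) (half_pos hε))
    -- The closed unit disc around `τ` then stays in the upper half plane above height `A`, so
    -- Cauchy's estimate bounds the derivative by the supremum of `|f - a|` on its boundary.
    refine (atImInfty_mem _).mpr ⟨max A 0 + 2, fun τ hτ => ?_⟩
    have him : ∀ w ∈ Metric.closedBall (τ : ℂ) 1, max A 0 < w.im := by
      intro w hw
      have h3 : |(w - τ).im| ≤ 1 := (abs_im_le_norm _).trans (by simpa [dist_eq_norm] using hw)
      have := (abs_le.mp h3).1
      simp at this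
      linarith
    have hd : ∀ w ∈ Metric.closedBall (τ : ℂ) 1, DifferentiableAt ℂ (fun w => (f ∘ ofComplex) w - a) w :=
      fun w hw => (((UpperHalfPlane.mdifferentiable_iff.mp hf) w ((le_max_right _ _).trans_lt (him w hw))).differentiableAt
        (isOpen_upperHalfPlaneSet.mem_nhds ((le_max_right _ _).trans_lt (him w hw)))).sub_const a
    have := norm_deriv_le_of_forall_mem_sphere_norm_le (f := fun w => (f ∘ ofComplex) w - a)
      (c := (τ : ℂ)) (R := 1) (C := ε / 2) one_pos ?_ ?_
    · simp only [deriv_sub_const] at this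
      simp only [dist_zero_right, Set.mem_ofPred_eq]
      linarith
    · exact DifferentiableOn.diffContOnCl fun w hw => (hd w (by rwa [closure_ball _ one_ne_zero] at hw)).differentiableWithinAt
    · intro w hw
      have hw' := him w (Metric.sphere_subset_closedBall hw)
      have hpos : 0 < w.im := (le_max_right _ _).trans_lt hw'
      have := hA ⟨w, hpos⟩ ((le_max_left _ _).trans hw'.le)
      simp only [Function.comp, ofComplex_apply_of_im_pos hpos, ← dist_eq_norm]
      exact this.le
  have := h2.const_mul ((2 * π * I : ℂ)⁻¹)
  rwa [mul_zero] at this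

open Derivative in
theorem isModularInvariant_serreDerivative {k : ℤ} {f : ℍ → ℂ} (hf : IsModularInvariant k f)
    (hol : MDiff f) : IsModularInvariant (k + 2) (serreDerivative k f) :=
  isModularInvariant_iff_slash.mpr fun γ =>
    serreDerivative_slash_invariant hol (isModularInvariant_iff_slash.mp hf γ)

open Derivative in
theorem tendsto_serreDerivative {k : ℂ} {f : ℍ → ℂ} (hol : MDiff f) {a : ℂ}
    (h : Tendsto f atImInfty (𝓝 a)) :
    Tendsto (serreDerivative k f) atImInfty (𝓝 (-(k / 12 * a))) := by
  have := (tendsto_normalizedDeriv hol h).sub ((tendsto_E2.const_mul (k * 12⁻¹)).mul h)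
  have e : -(k / 12 * a) = 0 - k * 12⁻¹ * 1 * a := by ring
  rw [e]
  exact this

theorem ModularForm.mdifferentiable {k : ℤ} (f : ModularForm 𝒮ℒ k) : MDiff (f : ℍ → ℂ) := f.holo'

theorem isModularInvariant_E₄_sq : IsModularInvariant 8 (fun τ => ModularForm.E₄ τ ^ 2) := by
  intro γ τ
  beta_reduce
  rw [ModularForm.isModularInvariant ModularForm.E₄ γ τ, mul_pow, ← zpow_natCast, ← zpow_mul]
  norm_num

theorem mdifferentiable_E₄_sq : MDiff (fun τ => ModularForm.E₄ τ ^ 2) := by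
  simp only [pow_two]
  exact (ModularForm.mdifferentiable ModularForm.E₄).mul (ModularForm.mdifferentiable ModularForm.E₄)

open Derivative in
/-- Ramanujan's formula for the derivative of `E₄`. -/
theorem normalizedDeriv_E₄ (τ : ℍ) : normalizedDerivOfComplex ModularForm.E₄ τ =
    (EisensteinSeries.E2 τ * ModularForm.E₄ τ - ModularForm.E₆ τ) / 3 := by
  -- The Serre derivative of `E₄` has weight 6 and limit `-4/12` at the cusp, which identifies it
  -- with `-E₆/3`.
  have h := IsModularInvariant.eq_of_tendsto (k := 6) (by norm_num)
    (f := serreDerivative (4 : ℤ) ModularForm.E₄) (g := fun τ => -(1 / 3) * ModularForm.E₆ τ)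
    (isModularInvariant_serreDerivative (ModularForm.isModularInvariant _) ModularForm.E₄.mdifferentiable)
    (fun γ τ => by beta_reduce; rw [ModularForm.isModularInvariant ModularForm.E₆ γ τ]; ring)
    (serreDerivative_mdifferentiable _ ModularForm.E₄.mdifferentiable)
    (mdifferentiable_const.mul ModularForm.E₆.mdifferentiable)
    (tendsto_serreDerivative ModularForm.E₄.mdifferentiable tendsto_E₄)
    (by convert tendsto_E₆.const_mul (-(1 / 3) : ℂ) using 2; norm_num)
  have := congrFun h τ
  simp only [serreDerivative_apply] at this
  push_cast at this
  linear_combination this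

open Derivative in
/-- Ramanujan's formula for the derivative of `E₆`. -/
theorem normalizedDeriv_E₆ (τ : ℍ) : normalizedDerivOfComplex ModularForm.E₆ τ =
    (EisensteinSeries.E2 τ * ModularForm.E₆ τ - ModularForm.E₄ τ ^ 2) / 2 := by
  have h := IsModularInvariant.eq_of_tendsto (k := 8) (by norm_num)
    (f := serreDerivative (6 : ℤ) ModularForm.E₆) (g := fun τ => -(1 / 2) * ModularForm.E₄ τ ^ 2)
    (isModularInvariant_serreDerivative (ModularForm.isModularInvariant _) ModularForm.E₆.mdifferentiable)
    (fun γ τ => by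
      have := isModularInvariant_E₄_sq γ τ
      beta_reduce at this ⊢
      rw [this]; ring)
    (serreDerivative_mdifferentiable _ ModularForm.E₆.mdifferentiable)
    (mdifferentiable_const.mul mdifferentiable_E₄_sq)
    (tendsto_serreDerivative ModularForm.E₆.mdifferentiable tendsto_E₆)
    (by convert (tendsto_E₄.pow 2).const_mul (-(1 / 2) : ℂ) using 2; norm_num)
  have := congrFun h τ
  simp only [serreDerivative_apply] at this
  push_cast at this
  linear_combination this

/-- The terms with `E2` in Ramanujan's formulas cancel. The value is a multiple of `Δ`; it is used
for the bracket of `E₄` and `E₆` and for the leading coefficient of `A`. -/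
theorem rankinCohenOne_E₄_E₆ (τ : ℍ) : rankinCohenOne ModularForm.E₄ ModularForm.E₆ τ =
    -2 * ModularForm.E₄ τ ^ 3 + 2 * ModularForm.E₆ τ ^ 2 := by
  simp only [rankinCohenOne, normalizedDeriv_E₄, normalizedDeriv_E₆]
  push_cast
  ring

/-- The span of the monomials `E₄ ^ a * E₆ ^ b` of weight `k`. -/
def eisensteinSpan (k : ℤ) : Submodule ℂ (ℍ → ℂ) :=
  Submodule.span ℂ {g | ∃ a b : ℕ, (4 * a + 6 * b : ℤ) = k ∧
    g = (ModularForm.E₄ : ℍ → ℂ) ^ a * (ModularForm.E₆ : ℍ → ℂ) ^ b}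

theorem E₄_cube_mul_mem {k : ℤ} {g : ℍ → ℂ} (hg : g ∈ eisensteinSpan (k - 12)) :
    (ModularForm.E₄ : ℍ → ℂ) ^ 3 * g ∈ eisensteinSpan k := by
  refine Submodule.span_induction (fun g hg => ?_) ?_ (fun x y _ _ hx hy => ?_) (fun c x _ hx => ?_) hg
  · obtain ⟨a, b, h, rfl⟩ := hg
    exact Submodule.subset_span ⟨a + 3, b, by push_cast; linarith, by ring⟩
  · rw [mul_zero]; exact Submodule.zero_mem _
  · rw [mul_add]; exact Submodule.add_mem _ hx hy
  · rw [mul_smul_comm]; exact Submodule.smul_mem _ _ hx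

theorem E₆_sq_mul_mem {k : ℤ} {g : ℍ → ℂ} (hg : g ∈ eisensteinSpan (k - 12)) :
    (ModularForm.E₆ : ℍ → ℂ) ^ 2 * g ∈ eisensteinSpan k := by
  refine Submodule.span_induction (fun g hg => ?_) ?_ (fun x y _ _ hx hy => ?_) (fun c x _ hx => ?_) hg
  · obtain ⟨a, b, h, rfl⟩ := hg
    exact Submodule.subset_span ⟨a, b + 2, by push_cast; linarith, by ring⟩
  · rw [mul_zero]; exact Submodule.zero_mem _
  · rw [mul_add]; exact Submodule.add_mem _ hx hy
  · rw [mul_smul_comm]; exact Submodule.smul_mem _ _ hx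

theorem exists_four_six_eq {k : ℤ} (hk : Even k) (h : 4 ≤ k) : ∃ a b : ℕ, (4 * a + 6 * b : ℤ) = k := by
  obtain ⟨n, rfl⟩ := hk
  obtain ⟨m, hm⟩ := Int.even_or_odd' n
  rcases hm with hm | hm
  · exact ⟨m.toNat, 0, by omega⟩
  · exact ⟨(m - 1).toNat, 1, by omega⟩

theorem isModularInvariant_monomial (a b : ℕ) : IsModularInvariant (4 * a + 6 * b)
    ((ModularForm.E₄ : ℍ → ℂ) ^ a * (ModularForm.E₆ : ℍ → ℂ) ^ b) := by
  intro γ τ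
  have hne := modular_denom_ne_zero γ τ
  have h1 := ModularForm.isModularInvariant ModularForm.E₄ γ τ
  have h2 := ModularForm.isModularInvariant ModularForm.E₆ γ τ
  rw [Pi.mul_apply, Pi.mul_apply, Pi.pow_apply, Pi.pow_apply, Pi.pow_apply, Pi.pow_apply, h1, h2,
    zpow_add₀ hne, zpow_mul, zpow_mul, mul_pow, mul_pow, zpow_natCast, zpow_natCast]
  ring

theorem tendsto_monomial (a b : ℕ) : Tendsto
    ((ModularForm.E₄ : ℍ → ℂ) ^ a * (ModularForm.E₆ : ℍ → ℂ) ^ b) atImInfty (𝓝 1) := by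
  have := (tendsto_E₄.pow a).mul (tendsto_E₆.pow b)
  rwa [one_pow, one_pow, mul_one] at this

theorem mdifferentiable_monomial (a b : ℕ) : MDiff
    ((ModularForm.E₄ : ℍ → ℂ) ^ a * (ModularForm.E₆ : ℍ → ℂ) ^ b) :=
  (ModularForm.E₄.mdifferentiable.pow a).mul (ModularForm.E₆.mdifferentiable.pow b)

/-- Modular forms of level one are polynomials in `E₄` and `E₆`. -/
theorem ModularForm.mem_eisensteinSpan {k : ℤ} (f : ModularForm 𝒮ℒ k) :
    (f : ℍ → ℂ) ∈ eisensteinSpan k := by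
  -- Induction on a bound for the weight, because the reduction lowers the weight by 12.
  suffices ∀ (n : ℕ) (k : ℤ), k < n → ∀ f : ModularForm 𝒮ℒ k, (f : ℍ → ℂ) ∈ eisensteinSpan k from
    this (k.toNat + 1) k (by omega) f
  clear f k
  intro n
  induction n with
  | zero =>
    intro k hk f
    rw [ModularFormClass.levelOne_neg_weight_eq_zero (by simpa using hk) f]
    exact Submodule.zero_mem _
  | succ n ih =>
    intro k hk f
    rcases lt_or_ge k 0 with h0 | h0
    · rw [ModularFormClass.levelOne_neg_weight_eq_zero h0 f]
      exact Submodule.zero_mem _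
    rcases Int.even_or_odd k with hev | hodd
    · rcases lt_or_ge k 4 with h4 | h4
      · obtain rfl | rfl : k = 0 ∨ k = 2 := by
          obtain ⟨m, rfl⟩ := hev
          omega
        · obtain ⟨c, hc⟩ := ModularFormClass.levelOne_weight_zero_const f
          have : (f : ℍ → ℂ) = c • ((ModularForm.E₄ : ℍ → ℂ) ^ 0 * (ModularForm.E₆ : ℍ → ℂ) ^ 0) := by
            rw [hc]; funext τ; simp
          rw [this]
          exact Submodule.smul_mem _ _ (Submodule.subset_span ⟨0, 0, by norm_num, rfl⟩)
        · rw [rank_zero_iff_forall_zero.mp ModularForm.levelOne_weight_two_rank_zero f]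
          exact Submodule.zero_mem _
      · obtain ⟨a, b, rfl⟩ := exists_four_six_eq hev h4
        set M := (ModularForm.E₄ : ℍ → ℂ) ^ a * (ModularForm.E₆ : ℍ → ℂ) ^ b with hM
        let G := modularFormOfInvariant (isModularInvariant_monomial a b)
          (mdifferentiable_monomial a b) ((tendsto_monomial a b).isBigO_one ℝ)
        let c := (qExpansion 1 f).coeff 0
        have hF : (qExpansion 1 (f - c • G)).coeff 0 = 0 := by
          have h1 := ModularForm.tendsto_atImInfty (f - c • G)
          have h2 := (ModularForm.tendsto_atImInfty f).sub ((tendsto_monomial a b).const_mul c)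
          rw [mul_one, sub_self] at h2
          exact tendsto_nhds_unique h1 h2
        -- After subtraction of a monomial with the same constant term a cusp form remains. It is
        -- `Δ` times a form of weight lower by 12, and `Δ` itself is `(E₄³ - E₆²)/1728`.
        let H := CuspForm.discriminantEquiv (ModularForm.toCuspForm (f - c • G) hF)
        have hH : (f : ℍ → ℂ) = c • M + ((1 / 1728 : ℂ) • ((ModularForm.E₄ : ℍ → ℂ) ^ 3 * H) -
            (1 / 1728 : ℂ) • ((ModularForm.E₆ : ℍ → ℂ) ^ 2 * H)) := by
          funext τ
          have h3 := discriminant_mul_discriminantEquiv_apply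
            (ModularForm.toCuspForm (f - c • G) hF) τ
          have h4 := ModularForm.discriminant_eq_E₄_cube_sub_E₆_sq τ
          have h5 : (ModularForm.toCuspForm (f - c • G) hF) τ = f τ - c * M τ := rfl
          rw [h5] at h3
          simp only [Pi.add_apply, Pi.sub_apply, Pi.smul_apply, Pi.mul_apply, Pi.pow_apply, smul_eq_mul]
          rw [h4] at h3
          linear_combination -h3
        rw [hH]
        have hHm := ih _ (by push_cast at hk ⊢; omega) H
        exact Submodule.add_mem _ (Submodule.smul_mem _ _ (Submodule.subset_span ⟨a, b, rfl, rfl⟩))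
          (Submodule.sub_mem _ (Submodule.smul_mem _ _ (E₄_cube_mul_mem hHm))
            (Submodule.smul_mem _ _ (E₆_sq_mul_mem hHm)))
    · rw [ModularForm.levelOne_odd_weight_eq_zero hodd f]
      exact Submodule.zero_mem _

/-! ### Holomorphy of series and of integrals depending on parameters. -/

/-- Cauchy's estimate on the complex line through `y` in the direction `v`: the disc of parameters
of radius `R / ‖v‖` stays in the ball of radius `2R` around `x`. -/
theorem norm_fderiv_le_of_forall_mem_ball {E : Type*} [NormedAddCommGroup E] [NormedSpace ℂ E]
    {F : E → ℂ} {x y : E} {R u : ℝ} (hR : 0 < R) (hy : y ∈ Metric.ball x R)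
    (hF : DifferentiableOn ℂ F (Metric.ball x (2 * R)))
    (hu : ∀ z ∈ Metric.ball x (2 * R), ‖F z‖ ≤ u) : ‖fderiv ℂ F y‖ ≤ u / R := by
  have hu0 : 0 ≤ u := (norm_nonneg _).trans (hu x (Metric.mem_ball_self (by positivity)))
  refine ContinuousLinearMap.opNorm_le_bound _ (by positivity) fun v => ?_
  rcases eq_or_ne v 0 with rfl | hv
  · simp
  have hv' : 0 < ‖v‖ := norm_pos_iff.mpr hv
  have hmem : ∀ t ∈ Metric.closedBall (0 : ℂ) (R / ‖v‖), y + t • v ∈ Metric.ball x (2 * R) := by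
    intro t ht
    rw [mem_closedBall_zero_iff, le_div_iff₀ hv'] at ht
    rw [Metric.mem_ball, dist_eq_norm] at hy ⊢
    calc ‖y + t • v - x‖ = ‖(y - x) + t • v‖ := by congr 1; abel
      _ ≤ ‖y - x‖ + ‖t • v‖ := norm_add_le _ _
      _ < R + R := by rw [norm_smul]; linarith
      _ = 2 * R := by ring
  have hd : ∀ t ∈ Metric.closedBall (0 : ℂ) (R / ‖v‖),
      HasDerivAt (fun t : ℂ => F (y + t • v)) (fderiv ℂ F (y + t • v) v) t := by
    intro t ht
    have h1 := ((hF _ (hmem t ht)).differentiableAt (Metric.isOpen_ball.mem_nhds (hmem t ht))).hasFDerivAt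
    have h2 : HasDerivAt (fun t : ℂ => y + t • v) v t := by
      simpa using ((hasDerivAt_id t).smul_const v).const_add y
    exact h1.comp_hasDerivAt t h2
  have h0 := hd 0 (Metric.mem_closedBall_self (by positivity))
  have := norm_deriv_le_of_forall_mem_sphere_norm_le (f := fun t : ℂ => F (y + t • v)) (c := 0)
    (R := R / ‖v‖) (C := u) (by positivity) ?_ fun t ht => hu _ (hmem t (Metric.sphere_subset_closedBall ht))
  · rw [h0.deriv] at this
    simp only [zero_smul, add_zero] at this
    refine this.trans (le_of_eq ?_)
    field_simp
  · refine DifferentiableOn.diffContOnCl fun t ht => ?_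
    rw [closure_ball _ (by positivity)] at ht
    exact (hd t ht).differentiableAt.differentiableWithinAt

/-- A locally normally convergent series of holomorphic functions of several variables is
holomorphic. -/
theorem differentiableOn_tsum_of_locally_summable {ι E : Type*} [NormedAddCommGroup E]
    [NormedSpace ℂ E] {F : ι → E → ℂ} {U : Set E} (hU : IsOpen U)
    (hF : ∀ i, DifferentiableOn ℂ (F i) U)
    (hs : ∀ x ∈ U, ∃ V ∈ 𝓝 x, ∃ u : ι → ℝ, Summable u ∧ ∀ i, ∀ y ∈ V, ‖F i y‖ ≤ u i) :
    DifferentiableOn ℂ (fun x => ∑' i, F i x) U := by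
  intro x hx
  obtain ⟨V, hV, u, hu, hb⟩ := hs x hx
  obtain ⟨r, hr, hrV⟩ := Metric.mem_nhds_iff.mp (inter_mem hV (hU.mem_nhds hx))
  have h2 : 2 * (r / 2) = r := by ring
  have hd : ∀ i, DifferentiableOn ℂ (F i) (Metric.ball x r) := fun i =>
    (hF i).mono fun y hy => (hrV hy).2
  have hsub : Metric.ball x (r / 2) ⊆ Metric.ball x r := Metric.ball_subset_ball (by linarith)
  have hx0 : x ∈ Metric.ball x (r / 2) := Metric.mem_ball_self (by positivity)
  have := hasFDerivAt_tsum_of_isPreconnected (𝕜 := ℂ) (f := F) (f' := fun i y => fderiv ℂ (F i) y)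
    (u := fun i => u i / (r / 2)) (s := Metric.ball x (r / 2)) (x₀ := x) (x := x)
    (hu.div_const _) Metric.isOpen_ball (convex_ball x _).isPreconnected
    (fun i y hy => ((hd i y (hsub hy)).differentiableAt
      (Metric.isOpen_ball.mem_nhds (hsub hy))).hasFDerivAt)
    (fun i y hy => norm_fderiv_le_of_forall_mem_ball (by positivity) hy (by rw [h2]; exact hd i)
      fun z hz => hb i z (hrV (by rwa [h2] at hz)).1) hx0
    (Summable.of_norm_bounded hu fun i => hb i x (mem_of_mem_nhds hV)) hx0
  exact this.differentiableAt.differentiableWithinAt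

/-- An integral of a function that depends holomorphically on a parameter is holomorphic. -/
theorem differentiableOn_intervalIntegral {G : ℂ → ℝ → ℂ} {U : Set ℂ} (hU : IsOpen U) {a b : ℝ}
    (hc : ContinuousOn (Function.uncurry G) (U ×ˢ Set.uIcc a b))
    (hd : ∀ t ∈ Set.uIcc a b, DifferentiableOn ℂ (fun τ => G τ t) U) :
    DifferentiableOn ℂ (fun τ => ∫ t in a..b, G τ t) U := by
  intro τ hτ
  obtain ⟨r, hr, hrU⟩ := Metric.nhds_basis_closedBall.mem_iff.mp (hU.mem_nhds hτ)
  have hK : IsCompact (Metric.closedBall τ r ×ˢ Set.uIcc a b) :=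
    (isCompact_closedBall τ r).prod isCompact_uIcc
  obtain ⟨M, hM⟩ := hK.exists_bound_of_continuousOn
    (hc.mono (Set.prod_mono hrU Set.Subset.rfl))
  have h2 : 2 * (r / 2) = r := by ring
  have hball : Metric.ball τ r ⊆ U := Metric.ball_subset_closedBall.trans hrU
  have hcont : ∀ w ∈ U, ContinuousOn (G w) (Set.uIcc a b) := fun w hw =>
    hc.comp (f := fun t => (w, t)) (by fun_prop) fun t ht => ⟨hw, ht⟩
  have hder : ∀ t ∈ Set.uIcc a b, ∀ w ∈ Metric.ball τ (r / 2),
      HasDerivAt (fun w => G w t) (deriv (fun w => G w t) w) w := by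
    intro t ht w hw
    have hwU : w ∈ U := hball (Metric.ball_subset_ball (by linarith) hw)
    exact ((hd t ht w hwU).differentiableAt (hU.mem_nhds hwU)).hasDerivAt
  have key := intervalIntegral.hasDerivAt_integral_of_dominated_loc_of_deriv_le
    (μ := MeasureTheory.volume) (a := a) (b := b) (F := G)
    (F' := fun w t => deriv (fun w => G w t) w) (x₀ := τ) (s := Metric.ball τ (r / 2))
    (bound := fun _ => M / (r / 2)) (Metric.ball_mem_nhds _ (by positivity))
    ?_ (hcont τ hτ).intervalIntegrable ?_ ?_ intervalIntegrable_const ?_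
  · exact key.2.differentiableAt.differentiableWithinAt
  · filter_upwards [hU.mem_nhds hτ] with w hw
    exact ((hcont w hw).mono Set.uIoc_subset_uIcc).aestronglyMeasurable measurableSet_uIoc
  -- Measurability of the derivative in `t`: it is the pointwise limit of the difference quotients
  -- with step `1/(n+N+1)`, where the shift by `N` keeps all the points in `U`.
  · have hseq : ∀ᶠ n : ℕ in atTop, τ + 1 / ((n : ℂ) + 1) ∈ U := by
      have : Tendsto (fun n : ℕ => τ + 1 / ((n : ℂ) + 1)) atTop (𝓝 (τ + 0)) :=
        tendsto_const_nhds.add tendsto_one_div_add_atTop_nhds_zero_nat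
      rw [add_zero] at this
      exact this.eventually (hU.mem_nhds hτ)
    obtain ⟨N, hN⟩ := eventually_atTop.mp hseq
    refine aestronglyMeasurable_of_tendsto_ae atTop
      (f := fun (n : ℕ) t => (1 / ((n + N : ℕ) + 1 : ℂ))⁻¹ • (G (τ + 1 / ((n + N : ℕ) + 1 : ℂ)) t - G τ t))
      (fun n => ?_) ?_
    · refine ContinuousOn.aestronglyMeasurable ?_ measurableSet_uIoc
      exact (((hcont _ (hN (n + N) (Nat.le_add_left N n))).sub (hcont τ hτ)).const_smul
        ((1 / ((n + N : ℕ) + 1 : ℂ))⁻¹)).mono Set.uIoc_subset_uIcc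
    · refine (MeasureTheory.ae_restrict_mem measurableSet_uIoc).mono fun t ht => ?_
      have h := (hder t (Set.uIoc_subset_uIcc ht) τ (Metric.mem_ball_self (by positivity))).tendsto_slope_zero
      refine h.comp ?_
      refine tendsto_nhdsWithin_iff.mpr ⟨?_, Eventually.of_forall fun n => ?_⟩
      · exact (tendsto_add_atTop_iff_nat (f := fun n : ℕ => 1 / ((n : ℂ) + 1)) N).mpr
          tendsto_one_div_add_atTop_nhds_zero_nat
      · have : ((n + N : ℕ) + 1 : ℂ) ≠ 0 := by exact_mod_cast Nat.succ_ne_zero (n + N)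
        exact one_div_ne_zero this
  · refine Eventually.of_forall fun t ht w hw => ?_
    have htI := Set.uIoc_subset_uIcc ht
    rw [← norm_deriv_eq_norm_fderiv.symm]
    refine norm_fderiv_le_of_forall_mem_ball (by positivity) hw ?_ fun z hz => ?_
    · rw [h2]; exact (hd t htI).mono hball
    · rw [h2] at hz; exact hM (z, t) ⟨Metric.ball_subset_closedBall hz, htI⟩
  · exact Eventually.of_forall fun t ht w hw => hder t (Set.uIoc_subset_uIcc ht) w hw

/-! ### Entire periodic functions -/

/-- With a primitive `P` of `f`, the integral is `P(1+w) - P(w)`, whose derivative in `w` is `f(1+w)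
- f(w) = 0`. Complex shifts `w` are allowed, which is what theta functions need. -/
theorem integral_periodic_shift {f : ℂ → ℂ} (hf : Differentiable ℂ f) (hp : ∀ z, f (z + 1) = f z)
    (w : ℂ) : ∫ x in (0 : ℝ)..1, f (x + w) = ∫ x in (0 : ℝ)..1, f x := by
  obtain ⟨P, hP⟩ := hf.isExactOn_univ
  have hP' : ∀ z, HasDerivAt P (f z) z := fun z => hP z trivial
  have hI : ∀ w, ∫ x in (0 : ℝ)..1, f (x + w) = P (1 + w) - P w := by
    intro w
    have h := intervalIntegral.integral_eq_sub_of_hasDerivAt (a := (0 : ℝ)) (b := 1)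
      (f := fun x : ℝ => P (x + w)) (f' := fun x : ℝ => f (x + w)) (fun x _ => ?_) ?_
    · simpa using h
    · have h1 : HasDerivAt (fun x : ℂ => P (x + w)) (f (x + w)) (x : ℂ) := by
        simpa using (hP' (x + w)).comp_add_const (x : ℂ) w
      exact h1.comp_ofReal
    · exact Continuous.intervalIntegrable (by have := hf.continuous; fun_prop) _ _
  have hconst : ∀ w, P (1 + w) - P w = P (1 + 0) - P 0 := by
    have hd : ∀ w, HasDerivAt (fun w => P (1 + w) - P w) 0 w := by
      intro w
      have := ((hP' (1 + w)).comp_const_add 1 w).sub (hP' w)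
      rwa [add_comm 1 w, hp, sub_self] at this
    intro w
    exact is_const_of_deriv_eq_zero (fun w => (hd w).differentiableAt) (fun w => (hd w).deriv) w 0
  have h0 := hI 0
  simp only [add_zero] at h0
  rw [hI, hconst, h0, add_zero]

/-- The Fourier coefficient of index `r` of a function of period `1`. -/
noncomputable def fourierInt (f : ℂ → ℂ) (r : ℤ) : ℂ := ∫ x in (0 : ℝ)..1, f x * cexp (-(2 * π * I * (r * x)))

theorem cexp_int_period (r : ℤ) (z : ℂ) :
    cexp (-(2 * π * I * (r * (z + 1)))) = cexp (-(2 * π * I * (r * z))) := by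
  rw [← Complex.exp_periodic.int_mul (-r) (-(2 * π * I * (r * z)))]
  congr 1
  push_cast
  ring

theorem fourierInt_shift {f : ℂ → ℂ} (hf : Differentiable ℂ f) (hp : ∀ z, f (z + 1) = f z)
    (w : ℂ) (r : ℤ) :
    fourierInt (fun z => f (z + w)) r = cexp (2 * π * I * (r * w)) * fourierInt f r := by
  have := integral_periodic_shift (f := fun z => f z * cexp (-(2 * π * I * (r * z))))
    (by fun_prop) (fun z => by rw [hp, cexp_int_period]) w
  rw [fourierInt, fourierInt, ← this, ← intervalIntegral.integral_const_mul]
  congr 1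
  funext x
  have : cexp (-(2 * π * I * (r * x))) =
      cexp (2 * π * I * (r * w)) * cexp (-(2 * π * I * (r * (x + w)))) := by
    rw [← Complex.exp_add]
    congr 1
    ring
  rw [this]
  ring

/-- The Fourier series on the real circle has summable (zero) coefficients, so it converges
pointwise and `f 0 = 0`. Translates of `f` by any complex `w` also have zero coefficients, which
gives `f w = 0`. -/
theorem eq_zero_of_fourierInt_eq_zero {f : ℂ → ℂ} (hf : Differentiable ℂ f)
    (hp : ∀ z, f (z + 1) = f z) (h : ∀ r, fourierInt f r = 0) : f = 0 := by
  have key : ∀ f : ℂ → ℂ, Differentiable ℂ f → (∀ z, f (z + 1) = f z) →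
      (∀ r, fourierInt f r = 0) → f 0 = 0 := by
    clear h hp hf f
    intro f hf hp h
    have hper : Function.Periodic (fun x : ℝ => f x) 1 := fun x => by
      have := hp x
      push_cast
      exact this
    have : Fact ((0 : ℝ) < 1) := ⟨one_pos⟩
    let g : C(AddCircle (1 : ℝ), ℂ) := ⟨hper.lift, continuous_coinduced_dom.mpr
      (hf.continuous.comp continuous_ofReal)⟩
    have hg : ∀ r, fourierCoeff g r = 0 := by
      intro r
      rw [fourierCoeff_eq_intervalIntegral g r 0, ← h r, fourierInt]
      simp only [one_div, inv_one, one_smul, zero_add]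
      congr 1
      funext x
      rw [fourier_coe_apply, smul_eq_mul, mul_comm]
      congr 1
      congr 1
      push_cast
      ring
    have hs := has_pointwise_sum_fourier_series_of_summable (f := g)
      ((funext hg : fourierCoeff g = 0) ▸ summable_zero) 0
    simp only [hg, zero_smul] at hs
    have h0 : g 0 = 0 := hs.unique hasSum_zero
    have : g ((0 : ℝ) : AddCircle (1 : ℝ)) = f (0 : ℝ) := rfl
    simpa [h0] using this.symm
  funext w
  have hw : Differentiable ℂ fun z => f (z + w) := by fun_prop
  have := key (fun z => f (z + w)) hw (fun z => by rw [← hp (z + w), add_right_comm])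
    (fun r => by rw [fourierInt_shift hf hp, h, mul_zero])
  simpa using this

/-- An even theta function of degree `m ≥ 1` is determined by its Fourier coefficients of index
`0, …, m`. -/
theorem eq_zero_of_theta {f : ℂ → ℂ} {m : ℕ} (hm : 1 ≤ m) {τ : ℂ} (hf : Differentiable ℂ f)
    (hp : ∀ z, f (z + 1) = f z) (hτ : ∀ z, cexp (2 * π * I * (m * (τ + 2 * z))) * f (z + τ) = f z)
    (hev : ∀ z, f (-z) = f z) (h : ∀ r : ℕ, r ≤ m → fourierInt f r = 0) : f = 0 := by
  -- The quasi-period `τ` links the coefficients of index `r` and `r - 2m` by a nonzero factor;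
  -- evenness links `r` and `-r`.
  have hshift : ∀ r : ℤ, fourierInt f r = 0 ↔ fourierInt f (r - 2 * m) = 0 := by
    intro r
    have h1 : fourierInt f r = cexp (2 * π * I * (m * τ)) *
        (cexp (2 * π * I * ((r - 2 * m : ℤ) * τ)) * fourierInt f (r - 2 * m)) := by
      rw [← fourierInt_shift hf hp, fourierInt, fourierInt, ← intervalIntegral.integral_const_mul]
      congr 1
      funext x
      conv_lhs => rw [← hτ x]
      have e : cexp (2 * π * I * (m * (τ + 2 * x))) * cexp (-(2 * π * I * (r * x))) =
          cexp (2 * π * I * (m * τ)) * cexp (-(2 * π * I * ((r - 2 * m : ℤ) * x))) := by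
        rw [← Complex.exp_add, ← Complex.exp_add]
        congr 1
        push_cast
        ring
      linear_combination f (x + τ) * e
    rw [h1]
    simp [Complex.exp_ne_zero]
  have hneg : ∀ r : ℤ, fourierInt f (-r) = fourierInt f r := by
    intro r
    have h1 := intervalIntegral.integral_comp_neg (a := (0 : ℝ)) (b := 1)
      (fun x : ℝ => f x * cexp (-(2 * π * I * (r * x))))
    have h2 := integral_periodic_shift (f := fun z => f z * cexp (-(2 * π * I * (r * z))))
      (by fun_prop) (fun z => by rw [hp, cexp_int_period]) (-1)
    have h3 := intervalIntegral.integral_comp_add_right (a := (0 : ℝ)) (b := 1)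
      (fun x : ℝ => f x * cexp (-(2 * π * I * (r * x)))) (-1)
    have h4 : fourierInt f (-r) = ∫ x in (0 : ℝ)..1, f (-x : ℝ) * cexp (-(2 * π * I * (r * (-x : ℝ)))) := by
      rw [fourierInt]
      congr 1
      funext x
      push_cast
      rw [hev]
      ring_nf
    rw [h4, h1, fourierInt, ← h2]
    push_cast at h3
    rw [h3]
    norm_num
  have hmul : ∀ (n : ℤ) (r : ℤ), fourierInt f (r + 2 * m * n) = 0 ↔ fourierInt f r = 0 := by
    intro n r
    induction n using Int.induction_on with
    | zero => simp
    | succ n ih => rw [← ih, hshift]; ring_nf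
    | pred n ih => rw [← ih, hshift (r + 2 * m * (-n))]; ring_nf
  refine eq_zero_of_fourierInt_eq_zero hf hp fun r => ?_
  -- Modulo `2m` the index is some `s` in `[0, 2m)`, and either `s` or `2m - s` lies in `[0, m]`.
  have hr := Int.emod_add_mul_ediv r (2 * m)
  have h0 := Int.emod_nonneg r (b := 2 * m) (by omega)
  have h1 := Int.emod_lt_of_pos r (b := 2 * m) (by omega)
  rw [← hr, hmul]
  generalize r % (2 * m) = s at *
  rcases le_total s m with h2 | h2
  · obtain ⟨n, rfl⟩ := Int.eq_ofNat_of_zero_le h0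
    exact h n (by omega)
  · rw [hshift, ← hneg]
    obtain ⟨n, hn⟩ := Int.eq_ofNat_of_zero_le (a := -(s - 2 * m)) (by omega)
    rw [hn]
    exact h n (by omega)

/-! ### The theta series and its translates -/

theorem coe_modular_smul (γ : SL(2, ℤ)) (τ : ℍ) : ((γ • τ : ℍ) : ℂ) =
    ((γ 0 0 : ℂ) * τ + γ 0 1) / ((γ 1 0 : ℂ) * τ + γ 1 1) := by
  rw [UpperHalfPlane.coe_specialLinearGroup_apply]
  simp

theorem modular_det (γ : SL(2, ℤ)) : (γ 0 0 : ℂ) * γ 1 1 - γ 0 1 * γ 1 0 = 1 := by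
  have := γ.det_coe
  rw [Matrix.det_fin_two] at this
  exact_mod_cast this

/-- Both automorphy factors are cocycles. For `cτ+d` this is the chain rule for Möbius maps; for the
exponent it is the identity `e3` below, which uses `det γ' = 1`. -/
theorem modularSlash_mul (k : ℤ) (m : ℕ) (γ γ' : SL(2, ℤ)) (Φ : ℍ × ℂ → ℂ) :
    modularSlash k m (γ * γ') Φ = modularSlash k m γ' (modularSlash k m γ Φ) := by
  funext p
  obtain ⟨τ, z⟩ := p
  have hj' := modular_denom_ne_zero γ' τ
  have hj'' := modular_denom_ne_zero γ (γ' • τ)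
  have h10 : ((γ * γ') 1 0 : ℤ) = γ 1 0 * γ' 0 0 + γ 1 1 * γ' 1 0 := by
    simp [Matrix.mul_apply, Fin.sum_univ_two]
  have h11 : ((γ * γ') 1 1 : ℤ) = γ 1 0 * γ' 0 1 + γ 1 1 * γ' 1 1 := by
    simp [Matrix.mul_apply, Fin.sum_univ_two]
  have hj : (((γ * γ') 1 0 : ℤ) : ℂ) * τ + ((γ * γ') 1 1 : ℤ) =
      ((γ 1 0 : ℂ) * (γ' • τ : ℍ) + γ 1 1) * ((γ' 1 0 : ℂ) * τ + γ' 1 1) := by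
    rw [h10, h11, coe_modular_smul]
    push_cast
    field_simp
    ring
  have hdet := modular_det γ'
  simp only [modularSlash]
  rw [mul_smul, hj, mul_zpow]
  have e1 : z / ((γ' 1 0 : ℂ) * τ + γ' 1 1) / ((γ 1 0 : ℂ) * (γ' • τ : ℍ) + γ 1 1) =
      z / (((γ 1 0 : ℂ) * (γ' • τ : ℍ) + γ 1 1) * ((γ' 1 0 : ℂ) * τ + γ' 1 1)) := by
    rw [div_div, mul_comm]
  have e2 : -(2 * π * I * (m * (((γ * γ') 1 0 : ℤ) : ℂ) * z ^ 2 /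
      (((γ 1 0 : ℂ) * (γ' • τ : ℍ) + γ 1 1) * ((γ' 1 0 : ℂ) * τ + γ' 1 1)))) =
      -(2 * π * I * (m * (γ' 1 0 : ℂ) * z ^ 2 / ((γ' 1 0 : ℂ) * τ + γ' 1 1))) +
      -(2 * π * I * (m * (γ 1 0 : ℂ) * (z / ((γ' 1 0 : ℂ) * τ + γ' 1 1)) ^ 2 /
        ((γ 1 0 : ℂ) * (γ' • τ : ℍ) + γ 1 1))) := by
    rw [← neg_add, ← mul_add]
    congr 2
    have e3 : (((γ * γ') 1 0 : ℤ) : ℂ) * ((γ' 1 0 : ℂ) * τ + γ' 1 1) = γ 1 0 +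
        γ' 1 0 * (((γ 1 0 : ℂ) * (γ' • τ : ℍ) + γ 1 1) * ((γ' 1 0 : ℂ) * τ + γ' 1 1)) := by
      rw [← hj, h10, h11]
      push_cast
      linear_combination (γ 1 0 : ℂ) * hdet
    generalize (γ 1 0 : ℂ) * (γ' • τ : ℍ) + γ 1 1 = J at *
    generalize (γ' 1 0 : ℂ) * τ + γ' 1 1 = J' at *
    field_simp
    linear_combination (m : ℂ) * z ^ 2 * e3
  rw [e2, Complex.exp_add, e1]
  ring

/-- The theta series `∑ q^(l²) ζ^(2l)`. -/
noncomputable def indexOneTheta : ℍ × ℂ → ℂ := fun p => jacobiTheta₂ (2 * p.2) (2 * p.1)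

theorem indexOneTheta_two_im_pos (τ : ℍ) : 0 < (2 * (τ : ℂ)).im := by
  simpa using τ.im_pos

theorem ellipticSlash_indexOneTheta (l u : ℤ) : ellipticSlash 1 l u indexOneTheta = indexOneTheta := by
  funext ⟨τ, z⟩
  simp only [ellipticSlash, indexOneTheta, jacobiTheta₂, ← tsum_mul_left]
  rw [← (Equiv.addRight l).tsum_eq (fun n => jacobiTheta₂_term n (2 * z) (2 * τ))]
  refine tsum_congr fun n => ?_
  simp only [jacobiTheta₂_term, Equiv.coe_addRight, ← Complex.exp_add]
  refine Complex.exp_eq_exp_iff_exists_int.mpr ⟨2 * n * u, ?_⟩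
  push_cast
  ring

theorem indexOneTheta_add_int (τ τ' : ℍ) (n : ℤ) (h : (τ' : ℂ) = τ + n) (z : ℂ) :
    indexOneTheta (τ', z) = indexOneTheta (τ, z) := by
  simp only [indexOneTheta, jacobiTheta₂, h]
  refine tsum_congr fun l => ?_
  simp only [jacobiTheta₂_term]
  refine Complex.exp_eq_exp_iff_exists_int.mpr ⟨l ^ 2 * n, ?_⟩
  push_cast
  ring

theorem indexOneTheta_neg (τ : ℍ) (z : ℂ) : indexOneTheta (τ, -z) = indexOneTheta (τ, z) := by
  simp only [indexOneTheta, mul_neg, jacobiTheta₂_neg_left]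

/-- Two matrices with the same bottom row differ on the left by an integral translation of `τ`,
under which the theta series is invariant. Hence the choice of `a`, `b` in the Eisenstein series is
immaterial. -/
theorem modularSlash_indexOneTheta_congr (k : ℤ) {γ γ' : SL(2, ℤ)} (h0 : γ 1 0 = γ' 1 0)
    (h1 : γ 1 1 = γ' 1 1) : modularSlash k 1 γ indexOneTheta = modularSlash k 1 γ' indexOneTheta := by
  funext ⟨τ, z⟩
  simp only [modularSlash, h0, h1]
  congr 1
  -- If `γ = T^n γ'`, then `n = b a' - a b'`.
  refine indexOneTheta_add_int _ _ (γ' 1 0 * 0 + (γ 0 1 * γ' 0 0 - γ 0 0 * γ' 0 1)) ?_ _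
  have hj := modular_denom_ne_zero γ' τ
  have d1 := modular_det γ
  have d2 := modular_det γ'
  rw [h0, h1] at d1
  rw [coe_modular_smul, coe_modular_smul, h0, h1, div_add' _ _ _ hj]
  congr 1
  push_cast
  linear_combination ((γ 0 0 : ℂ) * τ + γ 0 1) * (-d2) + ((γ' 0 0 : ℂ) * τ + γ' 0 1) * d1

/-- The commutation rule of the Jacobi group: moving `(l, u)` past `γ` replaces it by the row vector
`(l, u) γ⁻¹`. -/
theorem ellipticSlash_modularSlash (k : ℤ) (m : ℕ) (γ : SL(2, ℤ)) (l u : ℤ) (Φ : ℍ × ℂ → ℂ) :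
    ellipticSlash m l u (modularSlash k m γ Φ) = modularSlash k m γ
      (ellipticSlash m (l * γ 1 1 - u * γ 1 0) (-(l * γ 0 1) + u * γ 0 0) Φ) := by
  funext ⟨τ, z⟩
  have hj := modular_denom_ne_zero γ τ
  have hdet := modular_det γ
  simp only [ellipticSlash, modularSlash]
  have e1 : (z + l * τ + u) / ((γ 1 0 : ℂ) * τ + γ 1 1) = z / ((γ 1 0 : ℂ) * τ + γ 1 1) +
      (l * γ 1 1 - u * γ 1 0 : ℤ) * (γ • τ : ℍ) + (-(l * γ 0 1) + u * γ 0 0 : ℤ) := by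
    rw [coe_modular_smul]
    push_cast
    generalize hJ : (γ 1 0 : ℂ) * τ + γ 1 1 = J at *
    field_simp
    linear_combination (-(l * τ + u) : ℂ) * hdet + (-(l * γ 0 1) + u * γ 0 0 : ℂ) * hJ
  have e2 : cexp (2 * π * I * (m * ((l : ℂ) ^ 2 * τ + 2 * l * z))) *
      cexp (-(2 * π * I * (m * (γ 1 0 : ℂ) * (z + l * τ + u) ^ 2 / ((γ 1 0 : ℂ) * τ + γ 1 1)))) =
      cexp (-(2 * π * I * (m * (γ 1 0 : ℂ) * z ^ 2 / ((γ 1 0 : ℂ) * τ + γ 1 1)))) *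
      cexp (2 * π * I * (m * (((l * γ 1 1 - u * γ 1 0 : ℤ) : ℂ) ^ 2 * (γ • τ : ℍ) +
        2 * (l * γ 1 1 - u * γ 1 0 : ℤ) * (z / ((γ 1 0 : ℂ) * τ + γ 1 1))))) := by
    rw [← Complex.exp_add, ← Complex.exp_add]
    -- The exponents agree only up to `2πi` times this integer, found by expanding both quadratic
    -- forms; integrality of `l`, `u` and of the index is essential.
    refine Complex.exp_eq_exp_iff_exists_int.mpr
      ⟨m * (2 * γ 0 1 * γ 1 0 * l * u - γ 0 1 * γ 1 1 * l ^ 2 - γ 0 0 * γ 1 0 * u ^ 2), ?_⟩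
    have e3 : (l : ℂ) ^ 2 * τ + 2 * l * z -
        γ 1 0 * (z + l * τ + u) ^ 2 / ((γ 1 0 : ℂ) * τ + (γ 1 1 : ℂ)) =
        -(γ 1 0 * z ^ 2 / ((γ 1 0 : ℂ) * τ + (γ 1 1 : ℂ))) +
        ((l * γ 1 1 - u * γ 1 0) ^ 2 * (γ • τ : ℍ) +
          2 * (l * γ 1 1 - u * γ 1 0) * (z / ((γ 1 0 : ℂ) * τ + (γ 1 1 : ℂ)))) +
        (2 * γ 0 1 * γ 1 0 * l * u - γ 0 1 * γ 1 1 * l ^ 2 - γ 0 0 * γ 1 0 * u ^ 2) := by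
      rw [coe_modular_smul]
      generalize (γ 0 0 : ℂ) = a at *
      generalize (γ 0 1 : ℂ) = b at *
      generalize (γ 1 0 : ℂ) = c at *
      generalize (γ 1 1 : ℂ) = d at *
      generalize hJ : c * (τ : ℂ) + d = J at *
      field_simp
      linear_combination -((l : ℂ) ^ 2 * τ + 2 * l * z - (2 * b * c * l * u - b * d * l ^ 2 -
        a * c * u ^ 2)) * hJ - (τ * (l ^ 2 * d - 2 * c * l * u) - c * u ^ 2 : ℂ) * hdet
    push_cast
    linear_combination (2 * π * I * m : ℂ) * e3
  rw [e1]
  linear_combination (((γ 1 0 : ℂ) * τ + (γ 1 1 : ℂ)) ^ (-k) * Φ (γ • τ,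
    z / ((γ 1 0 : ℂ) * τ + (γ 1 1 : ℂ)) + (l * γ 1 1 - u * γ 1 0 : ℤ) * (γ • τ : ℍ) +
      (-(l * γ 0 1) + u * γ 0 0 : ℤ))) * e2

/-- A matrix in `SL(2, ℤ)` with the given coprime bottom row. -/
def bottomRowMatrix (v : {v : ℤ × ℤ // IsCoprime v.1 v.2}) : SL(2, ℤ) :=
  ⟨!![Int.gcdB v.1.1 v.1.2, -Int.gcdA v.1.1 v.1.2; v.1.1, v.1.2], by
    have h := Int.gcd_eq_gcd_ab v.1.1 v.1.2
    rw [Int.isCoprime_iff_gcd_eq_one.mp v.2] at h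
    rw [Matrix.det_fin_two_of]
    push_cast at h
    linear_combination -h⟩

theorem bottomRowMatrix_one_zero (v : {v : ℤ × ℤ // IsCoprime v.1 v.2}) :
    bottomRowMatrix v 1 0 = v.1.1 := rfl

theorem bottomRowMatrix_one_one (v : {v : ℤ × ℤ // IsCoprime v.1 v.2}) :
    bottomRowMatrix v 1 1 = v.1.2 := rfl

/-- The inner sum over `l` is a translate of the theta series, so the Eisenstein series is an
average over bottom rows and its invariance reduces to that of the theta series. -/
theorem jacobiEisenstein_eq (k : ℤ) (p : ℍ × ℂ) : jacobiEisenstein k 1 p =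
    1 / 2 * ∑' v, modularSlash k 1 (bottomRowMatrix v) indexOneTheta p := by
  obtain ⟨τ, z⟩ := p
  rw [jacobiEisenstein]
  congr 1
  refine tsum_congr fun v => ?_
  simp only [modularSlash, indexOneTheta, jacobiTheta₂, ← tsum_mul_left]
  refine tsum_congr fun l => ?_
  rw [mul_assoc ((_ : ℂ) ^ (-k)), jacobiTheta₂_term, ← Complex.exp_add, coe_modular_smul, bottomRowMatrix_one_zero,
    bottomRowMatrix_one_one]
  congr 2
  have : (((bottomRowMatrix v 0 0 : ℤ) : ℂ) * τ + (bottomRowMatrix v 0 1 : ℤ)) =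
      (Int.gcdB v.1.1 v.1.2 : ℂ) * τ - Int.gcdA v.1.1 v.1.2 := by
    simp [bottomRowMatrix, sub_eq_add_neg]
  rw [this]
  push_cast
  ring

/-- Right multiplication by an element of `SL(2, ℤ)` on coprime pairs. -/
def coprimePairMul (γ : SL(2, ℤ)) (v : {v : ℤ × ℤ // IsCoprime v.1 v.2}) :
    {v : ℤ × ℤ // IsCoprime v.1 v.2} :=
  ⟨((bottomRowMatrix v * γ) 1 0, (bottomRowMatrix v * γ) 1 1), by
    refine ⟨-(bottomRowMatrix v * γ) 0 1, (bottomRowMatrix v * γ) 0 0, ?_⟩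
    have := (bottomRowMatrix v * γ).det_coe
    rw [Matrix.det_fin_two] at this
    linear_combination this⟩

theorem coprimePairMul_val (γ : SL(2, ℤ)) (v : {v : ℤ × ℤ // IsCoprime v.1 v.2}) :
    (coprimePairMul γ v).1 = (v.1.1 * γ 0 0 + v.1.2 * γ 1 0, v.1.1 * γ 0 1 + v.1.2 * γ 1 1) := by
  simp [coprimePairMul, Matrix.mul_apply, Fin.sum_univ_two, bottomRowMatrix_one_zero,
    bottomRowMatrix_one_one]

/-- Right multiplication by an element of `SL(2, ℤ)` as a permutation of the coprime pairs. -/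
def coprimePairEquiv (γ : SL(2, ℤ)) :
    {v : ℤ × ℤ // IsCoprime v.1 v.2} ≃ {v : ℤ × ℤ // IsCoprime v.1 v.2} where
  toFun := coprimePairMul γ
  invFun := coprimePairMul γ⁻¹
  left_inv v := by
    have := γ.det_coe
    rw [Matrix.det_fin_two] at this
    apply Subtype.ext
    rw [coprimePairMul_val, coprimePairMul_val]
    simp only [Matrix.SpecialLinearGroup.SL2_inv_expl, Matrix.cons_val', Matrix.cons_val_zero,
      Matrix.cons_val_one, Matrix.cons_val_fin_one]
    ext
    · simp; linear_combination v.1.1 * this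
    · simp; linear_combination v.1.2 * this
  right_inv v := by
    have := γ.det_coe
    rw [Matrix.det_fin_two] at this
    apply Subtype.ext
    rw [coprimePairMul_val, coprimePairMul_val]
    simp only [Matrix.SpecialLinearGroup.SL2_inv_expl, Matrix.cons_val', Matrix.cons_val_zero,
      Matrix.cons_val_one, Matrix.cons_val_fin_one]
    ext
    · simp; linear_combination v.1.1 * this
    · simp; linear_combination v.1.2 * this

/-- Acting by `γ` permutes the bottom rows by right multiplication, and each summand depends only on
its bottom row. -/
theorem modularSlash_jacobiEisenstein (k : ℤ) (γ : SL(2, ℤ)) :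
    modularSlash k 1 γ (jacobiEisenstein k 1) = jacobiEisenstein k 1 := by
  funext p
  have h : modularSlash k 1 γ (jacobiEisenstein k 1) p =
      1 / 2 * ∑' v, modularSlash k 1 γ (modularSlash k 1 (bottomRowMatrix v) indexOneTheta) p := by
    simp only [modularSlash.eq_def k 1 γ, jacobiEisenstein_eq, tsum_mul_left]
    ring
  rw [h, jacobiEisenstein_eq, ← (coprimePairEquiv γ).tsum_eq
    (fun v => modularSlash k 1 (bottomRowMatrix v) indexOneTheta p)]
  congr 1
  refine tsum_congr fun v => ?_
  rw [← modularSlash_mul]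
  refine congrFun (modularSlash_indexOneTheta_congr k ?_ ?_) p
  · rw [bottomRowMatrix_one_zero]; rfl
  · rw [bottomRowMatrix_one_one]; rfl

/-- Each summand is already invariant: `(l, u)` passes through the matrix to another integral
vector, which fixes the theta series. -/
theorem ellipticSlash_jacobiEisenstein (k : ℤ) (l u : ℤ) :
    ellipticSlash 1 l u (jacobiEisenstein k 1) = jacobiEisenstein k 1 := by
  funext p
  have h : ellipticSlash 1 l u (jacobiEisenstein k 1) p =
      1 / 2 * ∑' v, ellipticSlash 1 l u (modularSlash k 1 (bottomRowMatrix v) indexOneTheta) p := by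
    simp only [ellipticSlash, jacobiEisenstein_eq, tsum_mul_left]
    ring
  rw [h, jacobiEisenstein_eq]
  congr 1
  refine tsum_congr fun v => ?_
  rw [ellipticSlash_modularSlash, ellipticSlash_indexOneTheta]

/-! ### Convergence and holomorphy of the Jacobi-Eisenstein series. -/

/-- Uses `exp(-x) ≤ x^(-3/4)` with `x = y l²`. The exponent `3/4` is a compromise: `|l|^(-3/2)` is
summable over `l`, and the loss `y^(-3/4)` becomes only `|cτ+d|^(3/2)` after a modular
transformation. -/
theorem exp_neg_mul_int_add_le {y : ℝ} (hy : 0 < y) {δ : ℝ} (hδ : |δ| ≤ 1 / 2) (l : ℤ) :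
    Real.exp (-(2 * π * y * (l + δ) ^ 2)) ≤
      (if l = 0 then 1 else 0) + y ^ (-(3 / 4) : ℝ) * |(l : ℝ)| ^ (-(3 / 2) : ℝ) := by
  split_ifs with hl
  · have : Real.exp (-(2 * π * y * (l + δ) ^ 2)) ≤ 1 := Real.exp_le_one_iff.mpr (by
      rw [neg_nonpos]; positivity)
    have h2 : 0 ≤ y ^ (-(3 / 4) : ℝ) * |(l : ℝ)| ^ (-(3 / 2) : ℝ) := by positivity
    linarith
  · have hl1 : 1 ≤ |(l : ℝ)| := by exact_mod_cast Int.one_le_abs hl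
    have h1 : (|(l : ℝ)| / 2) ^ 2 ≤ (l + δ) ^ 2 := by
      rw [← sq_abs ((l : ℝ) + δ)]
      have : |(l : ℝ)| - |δ| ≤ |(l : ℝ) + δ| := by
        have := abs_sub_abs_le_abs_sub (l : ℝ) (-δ)
        rwa [abs_neg, sub_neg_eq_add] at this
      gcongr
      linarith
    set x := y * |(l : ℝ)| ^ 2 with hx
    have hx0 : 0 < x := by positivity
    have h2 : Real.exp (-(2 * π * y * (l + δ) ^ 2)) ≤ Real.exp (-x) := by
      refine Real.exp_le_exp.mpr (neg_le_neg ?_)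
      have h3 : x ≤ 2 * π * (y * (|(l : ℝ)| / 2) ^ 2) := by
        have := Real.pi_gt_three
        nlinarith
      calc x ≤ 2 * π * (y * (|(l : ℝ)| / 2) ^ 2) := h3
        _ ≤ 2 * π * (y * (l + δ) ^ 2) := by gcongr
        _ = _ := by ring
    have h4 : Real.exp (-x) ≤ x ^ (-(3 / 4) : ℝ) := by
      rw [Real.exp_neg, Real.rpow_neg hx0.le]
      gcongr
      rcases le_total x 1 with h | h
      · exact (Real.rpow_le_one hx0.le h (by norm_num)).trans (Real.one_le_exp hx0.le)
      · calc x ^ (3 / 4 : ℝ) ≤ x ^ (1 : ℝ) := Real.rpow_le_rpow_of_exponent_le h (by norm_num)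
          _ = x := Real.rpow_one x
          _ ≤ Real.exp x := by linarith [Real.add_one_le_exp x]
    have h5 : x ^ (-(3 / 4) : ℝ) = y ^ (-(3 / 4) : ℝ) * |(l : ℝ)| ^ (-(3 / 2) : ℝ) := by
      rw [hx, Real.mul_rpow hy.le (by positivity), ← Real.rpow_natCast, ← Real.rpow_mul (by positivity)]
      norm_num
    rw [zero_add, ← h5]
    exact h2.trans h4

/-- Completing the square splits off `exp(2π Im(z)²/Im τ)`. Shifting the summation by the integer
nearest to `Im z / Im τ` leaves a Gaussian series centred within `1/2` of the origin. -/
theorem exists_norm_indexOneTheta_le : ∃ C : ℝ, 0 < C ∧ ∀ (τ : ℍ) (z : ℂ),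
    ‖indexOneTheta (τ, z)‖ ≤ C * (1 + τ.im ^ (-(3 / 4) : ℝ)) * Real.exp (2 * π * z.im ^ 2 / τ.im) := by
  have hS := Real.summable_abs_int_rpow (b := 3 / 2) (by norm_num)
  set S := ∑' l : ℤ, |(l : ℝ)| ^ (-(3 / 2) : ℝ) with hSdef
  have hS0 : 0 ≤ S := tsum_nonneg fun l => by positivity
  refine ⟨1 + S, by positivity, fun τ z => ?_⟩
  have hy := τ.im_pos
  set s := z.im / τ.im with hs
  set y := τ.im with hydef
  have hterm : ∀ n : ℤ, ‖jacobiTheta₂_term (n - round s) (2 * z) (2 * τ)‖ =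
      Real.exp (-(2 * π * y * (n + (s - round s)) ^ 2)) * Real.exp (2 * π * z.im ^ 2 / y) := by
    intro n
    rw [norm_jacobiTheta₂_term, ← Real.exp_add]
    congr 1
    have h1 : (2 * (τ : ℂ)).im = 2 * y := by simp [hydef]
    have h2 : (2 * z).im = 2 * (s * y) := by rw [hs]; field_simp; simp
    have h3 : z.im = s * y := by rw [hs]; field_simp
    rw [h1, h2, h3]
    push_cast
    field_simp
    ring
  have hsum : HasSum (fun l : ℤ => ((if l = 0 then (1 : ℝ) else 0) +
      y ^ (-(3 / 4) : ℝ) * |(l : ℝ)| ^ (-(3 / 2) : ℝ)) * Real.exp (2 * π * z.im ^ 2 / y))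
      ((1 + y ^ (-(3 / 4) : ℝ) * S) * Real.exp (2 * π * z.im ^ 2 / y)) := by
    refine HasSum.mul_right _ (HasSum.add ?_ (hS.hasSum.mul_left _))
    simpa using hasSum_ite_eq (0 : ℤ) (1 : ℝ)
  have hle : ‖indexOneTheta (τ, z)‖ ≤ (1 + y ^ (-(3 / 4) : ℝ) * S) * Real.exp (2 * π * z.im ^ 2 / y) := by
    rw [indexOneTheta, jacobiTheta₂, ← (Equiv.subRight (round s)).tsum_eq]
    refine tsum_of_norm_bounded hsum fun n => ?_
    rw [Equiv.subRight_apply, hterm]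
    gcongr
    exact exp_neg_mul_int_add_le hy (abs_sub_round s) n
  refine hle.trans ?_
  gcongr
  have : 0 ≤ y ^ (-(3 / 4) : ℝ) := by positivity
  nlinarith

theorem modular_smul_im (γ : SL(2, ℤ)) (τ : ℍ) :
    (γ • τ).im = τ.im / ‖(γ 1 0 : ℂ) * τ + γ 1 1‖ ^ 2 := by
  rw [ModularGroup.im_smul_eq_div_normSq, modular_denom_eq, Complex.normSq_eq_norm_sq]

/-- The function `exp(-2π Im(z)²/Im τ)` is the invariant weight for the norm of index one functions:
the exponential automorphy factor is exactly compensated. -/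
theorem exp_quadratic_identity (γ : SL(2, ℤ)) (τ : ℍ) (z : ℂ) :
    ‖cexp (-(2 * π * I * ((1 : ℕ) * (γ 1 0 : ℂ) * z ^ 2 / ((γ 1 0 : ℂ) * τ + γ 1 1))))‖ *
      Real.exp (2 * π * (z / ((γ 1 0 : ℂ) * τ + γ 1 1)).im ^ 2 / (γ • τ).im) =
      Real.exp (2 * π * z.im ^ 2 / τ.im) := by
  have hj := modular_denom_ne_zero γ τ
  have hN := Complex.normSq_pos.mpr hj
  have hy := τ.im_pos
  have him : (γ • τ).im = τ.im / Complex.normSq ((γ 1 0 : ℂ) * τ + γ 1 1) := by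
    rw [modular_smul_im, Complex.normSq_eq_norm_sq]
  have h1 : ((γ 1 0 : ℂ) * τ + γ 1 1).re = γ 1 0 * τ.re + γ 1 1 := by simp
  have h2 : ((γ 1 0 : ℂ) * τ + γ 1 1).im = γ 1 0 * τ.im := by simp
  have h3 : Complex.normSq ((γ 1 0 : ℂ) * τ + γ 1 1) =
      (γ 1 0 * τ.re + γ 1 1) ^ 2 + (γ 1 0 * τ.im) ^ 2 := by
    rw [Complex.normSq_apply, h1, h2]; ring
  have h4 : (-(2 * π * I * ((1 : ℕ) * (γ 1 0 : ℂ) * z ^ 2 / ((γ 1 0 : ℂ) * τ + γ 1 1)))).re =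
      2 * π * ((γ 1 0 : ℂ) * z ^ 2 / ((γ 1 0 : ℂ) * τ + γ 1 1)).im := by
    simp [mul_assoc]
  have h5 : ((γ 1 0 : ℂ) * z ^ 2).re = γ 1 0 * (z.re ^ 2 - z.im ^ 2) := by simp [pow_two]
  have h6 : ((γ 1 0 : ℂ) * z ^ 2).im = γ 1 0 * (2 * z.re * z.im) := by simp [pow_two]; left; ring
  rw [Complex.norm_exp, ← Real.exp_add, h4, him, Complex.div_im, Complex.div_im, h1, h2, h5, h6]
  congr 1
  set N := Complex.normSq ((γ 1 0 : ℂ) * τ + γ 1 1)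
  field_simp
  rw [h3]
  ring

/-- The theta bound at `γτ`, with `Im(γτ) = Im τ / |cτ+d|²` and the quadratic exponential carried
back to `(τ, z)` by its invariance. -/
theorem exists_norm_modularSlash_theta_le : ∃ C : ℝ, 0 < C ∧ ∀ (k : ℤ) (γ : SL(2, ℤ)) (τ : ℍ) (z : ℂ),
    ‖modularSlash k 1 γ indexOneTheta (τ, z)‖ ≤ C * Real.exp (2 * π * z.im ^ 2 / τ.im) *
      (‖(γ 1 0 : ℂ) * τ + γ 1 1‖ ^ (-k : ℝ) +
        τ.im ^ (-(3 / 4) : ℝ) * ‖(γ 1 0 : ℂ) * τ + γ 1 1‖ ^ (-(k - 3 / 2) : ℝ)) := by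
  obtain ⟨C, hC, h⟩ := exists_norm_indexOneTheta_le
  refine ⟨C, hC, fun k γ τ z => ?_⟩
  have hj := norm_pos_iff.mpr (modular_denom_ne_zero γ τ)
  have h1 := h (γ • τ) (z / ((γ 1 0 : ℂ) * τ + γ 1 1))
  have h2 := exp_quadratic_identity γ τ z
  have h3 : (γ • τ).im ^ (-(3 / 4) : ℝ) =
      τ.im ^ (-(3 / 4) : ℝ) * ‖(γ 1 0 : ℂ) * τ + γ 1 1‖ ^ (3 / 2 : ℝ) := by
    rw [modular_smul_im, Real.div_rpow τ.im_pos.le (by positivity), ← Real.rpow_natCast,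
      ← Real.rpow_mul hj.le, div_eq_mul_inv, ← Real.rpow_neg hj.le]
    norm_num
  have h4 : ‖(γ 1 0 : ℂ) * τ + γ 1 1‖ ^ (-(k - 3 / 2) : ℝ) =
      ‖(γ 1 0 : ℂ) * τ + γ 1 1‖ ^ (-k : ℝ) * ‖(γ 1 0 : ℂ) * τ + γ 1 1‖ ^ (3 / 2 : ℝ) := by
    rw [← Real.rpow_add hj]; congr 1; ring
  have h5 : ‖((γ 1 0 : ℂ) * τ + γ 1 1) ^ (-k)‖ = ‖(γ 1 0 : ℂ) * τ + γ 1 1‖ ^ (-k : ℝ) := by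
    rw [norm_zpow, ← Real.rpow_intCast]; push_cast; rfl
  simp only [modularSlash, norm_mul]
  rw [h5, h4, ← h2]
  rw [h3] at h1
  calc _ ≤ _ := mul_le_mul_of_nonneg_left h1 (by positivity)
    _ = _ := by ring

/-- On a vertical strip `|cτ+d|` is bounded below by a multiple of the norm of `(c, d)`. Both
exponents `k` and `k - 3/2` exceed 2, the threshold for summing over the lattice. -/
theorem exists_summable_bound_modularSlash_theta {k : ℤ} (hk : 4 ≤ k) (A D : ℝ) {B : ℝ} (hB : 0 < B) :
    ∃ u : {v : ℤ × ℤ // IsCoprime v.1 v.2} → ℝ, Summable u ∧ ∀ v, ∀ τ ∈ verticalStrip A B,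
      ∀ z : ℂ, |z.im| ≤ D → ‖modularSlash k 1 (bottomRowMatrix v) indexOneTheta (τ, z)‖ ≤ u v := by
  obtain ⟨C, hC, h⟩ := exists_norm_modularSlash_theta_le
  set r := EisensteinSeries.r ⟨⟨A, B⟩, hB⟩
  have hk' : (4 : ℝ) ≤ k := by exact_mod_cast hk
  have hinj : Function.Injective fun v : {v : ℤ × ℤ // IsCoprime v.1 v.2} => ![v.1.1, v.1.2] := by
    intro v w hvw
    have h0 := congrFun hvw 0
    have h1 := congrFun hvw 1
    exact Subtype.ext (Prod.ext h0 h1)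
  refine ⟨fun v => C * Real.exp (2 * π * D ^ 2 / B) * (r ^ (-k : ℝ) * ‖![v.1.1, v.1.2]‖ ^ (-k : ℝ) +
    B ^ (-(3 / 4) : ℝ) * (r ^ (-(k - 3 / 2) : ℝ) * ‖![v.1.1, v.1.2]‖ ^ (-(k - 3 / 2) : ℝ))), ?_, ?_⟩
  · refine Summable.mul_left _ (Summable.add (Summable.mul_left _ ?_)
      (Summable.mul_left _ (Summable.mul_left _ ?_)))
    · exact (EisensteinSeries.summable_one_div_norm_rpow (k := k) (by linarith)).comp_injective hinj
    · exact (EisensteinSeries.summable_one_div_norm_rpow (k := k - 3 / 2) (by linarith)).comp_injective hinj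
  · intro v τ hτ z hz
    refine (h k (bottomRowMatrix v) τ z).trans ?_
    rw [bottomRowMatrix_one_zero, bottomRowMatrix_one_one]
    have hBτ : B ≤ τ.im := hτ.2
    have hD : z.im ^ 2 ≤ D ^ 2 := sq_le_sq.mpr (hz.trans (le_abs_self D))
    have b1 := EisensteinSeries.summand_bound_of_mem_verticalStrip (k := k) (by linarith)
      ![v.1.1, v.1.2] hB hτ
    have b2 := EisensteinSeries.summand_bound_of_mem_verticalStrip (k := k - 3 / 2) (by linarith)
      ![v.1.1, v.1.2] hB hτ
    simp only [Matrix.cons_val_zero, Matrix.cons_val_one] at b1 b2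
    have b3 : τ.im ^ (-(3 / 4) : ℝ) ≤ B ^ (-(3 / 4) : ℝ) :=
      Real.rpow_le_rpow_of_nonpos hB hBτ (by norm_num)
    have b4 : 2 * π * z.im ^ 2 / τ.im ≤ 2 * π * D ^ 2 / B :=
      div_le_div₀ (by positivity) (by gcongr) hB hBτ
    refine mul_le_mul (mul_le_mul_of_nonneg_left (Real.exp_le_exp.mpr b4) hC.le)
      (add_le_add ?_ (mul_le_mul b3 ?_ (by positivity) (by positivity))) (by positivity) (by positivity)
    · exact b1
    · exact b2

theorem differentiableOn_indexOneTheta :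
    DifferentiableOn ℂ (fun w : ℂ × ℂ => indexOneTheta (ofComplex w.1, w.2)) {w | 0 < w.1.im} := by
  intro w hw
  have h := (hasFDerivAt_jacobiTheta₂ (2 * w.2) (τ := 2 * w.1) (by simpa using hw)).differentiableAt
  have h2 : DifferentiableAt ℂ (fun w : ℂ × ℂ => (2 * w.2, 2 * w.1)) w := by fun_prop
  refine (DifferentiableAt.comp w h h2).differentiableWithinAt.congr ?_ ?_
  · intro v hv
    simp only [indexOneTheta, ofComplex_apply_of_im_pos hv, Function.comp]
  · simp only [indexOneTheta, ofComplex_apply_of_im_pos hw, Function.comp]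

theorem isOpen_upper_prod : IsOpen {w : ℂ × ℂ | 0 < w.1.im} :=
  isOpen_lt continuous_const (by fun_prop)

/-- The action of the modular group preserves holomorphy. -/
theorem differentiableOn_modularSlash (k : ℤ) (m : ℕ) (γ : SL(2, ℤ)) {Φ : ℍ × ℂ → ℂ}
    (h : DifferentiableOn ℂ (fun w : ℂ × ℂ => Φ (ofComplex w.1, w.2)) {w | 0 < w.1.im}) :
    DifferentiableOn ℂ (fun w : ℂ × ℂ => modularSlash k m γ Φ (ofComplex w.1, w.2))
      {w | 0 < w.1.im} := by
  have hj : ∀ w ∈ {w : ℂ × ℂ | 0 < w.1.im}, (γ 1 0 : ℂ) * w.1 + γ 1 1 ≠ 0 := fun w hw =>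
    modular_denom_ne_zero γ ⟨w.1, hw⟩
  have hsm : ∀ w : ℂ × ℂ, ∀ hw : 0 < w.1.im, ((γ • (⟨w.1, hw⟩ : ℍ) : ℍ) : ℂ) =
      ((γ 0 0 : ℂ) * w.1 + γ 0 1) / ((γ 1 0 : ℂ) * w.1 + γ 1 1) := fun w hw =>
    coe_modular_smul γ ⟨w.1, hw⟩
  have hmap : DifferentiableOn ℂ (fun w : ℂ × ℂ =>
      (((γ 0 0 : ℂ) * w.1 + γ 0 1) / ((γ 1 0 : ℂ) * w.1 + γ 1 1), w.2 / ((γ 1 0 : ℂ) * w.1 + γ 1 1)))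
      {w | 0 < w.1.im} := by
    simp only [div_eq_mul_inv]
    have hinv : DifferentiableOn ℂ (fun w : ℂ × ℂ => ((γ 1 0 : ℂ) * w.1 + γ 1 1)⁻¹) {w | 0 < w.1.im} :=
      DifferentiableOn.fun_inv (by fun_prop) hj
    exact DifferentiableOn.prodMk (DifferentiableOn.mul (by fun_prop) hinv)
      (DifferentiableOn.mul (by fun_prop) hinv)
  have hmaps : Set.MapsTo (fun w : ℂ × ℂ =>
      (((γ 0 0 : ℂ) * w.1 + γ 0 1) / ((γ 1 0 : ℂ) * w.1 + γ 1 1), w.2 / ((γ 1 0 : ℂ) * w.1 + γ 1 1)))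
      {w | 0 < w.1.im} {w | 0 < w.1.im} := by
    intro w hw
    have := (γ • (⟨w.1, hw⟩ : ℍ)).im_pos
    rw [← coe_im, hsm w hw] at this
    exact this
  have hcomp := h.comp hmap hmaps
  have hden : DifferentiableOn ℂ (fun w : ℂ × ℂ => (γ 1 0 : ℂ) * w.1 + γ 1 1) {w | 0 < w.1.im} := by
    fun_prop
  have hexp : DifferentiableOn ℂ (fun w : ℂ × ℂ =>
      cexp (-(2 * π * I * (m * (γ 1 0 : ℂ) * w.2 ^ 2 / ((γ 1 0 : ℂ) * w.1 + γ 1 1))))) {w | 0 < w.1.im} := by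
    refine DifferentiableOn.cexp (DifferentiableOn.neg (DifferentiableOn.const_mul ?_ _))
    simp only [div_eq_mul_inv]
    exact DifferentiableOn.mul (by fun_prop) (DifferentiableOn.fun_inv hden hj)
  have hpow : DifferentiableOn ℂ (fun w : ℂ × ℂ => ((γ 1 0 : ℂ) * w.1 + γ 1 1) ^ (-k)) {w | 0 < w.1.im} :=
    fun w hw => (hden w hw).zpow (Or.inl (hj w hw))
  refine ((hpow.mul hexp).mul hcomp).congr fun w hw => ?_
  have h1 : ofComplex w.1 = ⟨w.1, hw⟩ := ofComplex_apply_of_im_pos hw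
  have h2 : ofComplex (((γ 0 0 : ℂ) * w.1 + γ 0 1) / ((γ 1 0 : ℂ) * w.1 + γ 1 1)) =
      γ • (⟨w.1, hw⟩ : ℍ) := by
    rw [← hsm w hw, ofComplex_apply]
  simp only [modularSlash, Pi.mul_apply, Function.comp, h1, h2]

theorem differentiableOn_jacobiEisenstein {k : ℤ} (hk : 4 ≤ k) :
    DifferentiableOn ℂ (fun w : ℂ × ℂ => jacobiEisenstein k 1 (ofComplex w.1, w.2))
      {w | 0 < w.1.im} := by
  simp only [jacobiEisenstein_eq]
  refine DifferentiableOn.const_mul ?_ _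
  refine differentiableOn_tsum_of_locally_summable isOpen_upper_prod
    (fun v => differentiableOn_modularSlash k 1 _ differentiableOn_indexOneTheta) fun x hx => ?_
  obtain ⟨u, hu, hb⟩ := exists_summable_bound_modularSlash_theta hk (|x.1.re| + 1) (|x.2.im| + 1)
    (half_pos hx)
  refine ⟨{w | x.1.im / 2 < w.1.im ∧ |w.1.re| < |x.1.re| + 1 ∧ |w.2.im| < |x.2.im| + 1}, ?_, u, hu, ?_⟩
  · refine IsOpen.mem_nhds ?_ ⟨half_lt_self hx, by simp, by simp⟩
    have h1 : IsOpen {w : ℂ × ℂ | x.1.im / 2 < w.1.im} := isOpen_lt (by fun_prop) (by fun_prop)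
    have h2 : IsOpen {w : ℂ × ℂ | |w.1.re| < |x.1.re| + 1} := isOpen_lt (by fun_prop) (by fun_prop)
    have h3 : IsOpen {w : ℂ × ℂ | |w.2.im| < |x.2.im| + 1} := isOpen_lt (by fun_prop) (by fun_prop)
    exact h1.inter (h2.inter h3)
  · rintro v w ⟨h1, h2, h3⟩
    have hw : 0 < w.1.im := (half_pos hx).trans h1
    rw [ofComplex_apply_of_im_pos hw]
    exact hb v ⟨w.1, hw⟩ ⟨h2.le, h1.le⟩ w.2 h3.le

/-! ### Behaviour of the Jacobi-Eisenstein series at the cusp. -/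

/-- The filter of approach to the cusp `i∞` with `Im z` bounded by `D`. -/
def cuspFilter (D : ℝ) : Filter (ℍ × ℂ) :=
  comap (fun p : ℍ × ℂ => p.1.im) atTop ⊓ 𝓟 {p | |p.2.im| ≤ D}

theorem tendsto_im_cuspFilter (D : ℝ) : Tendsto (fun p : ℍ × ℂ => p.1.im) (cuspFilter D) atTop :=
  tendsto_comap.mono_left inf_le_left

theorem eventually_abs_im_le_cuspFilter (D : ℝ) : ∀ᶠ p in cuspFilter D, |p.2.im| ≤ D :=
  mem_inf_of_right (mem_principal_self _)

/-- Every term with `l ≠ 0` tends to `0`, and the terms are dominated by their bound at `Im τ = 1`,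
so only the term `1` of `l = 0` survives. -/
theorem tendsto_indexOneTheta_cuspFilter (D : ℝ) :
    Tendsto indexOneTheta (cuspFilter D) (𝓝 1) := by
  have h1 : (1 : ℂ) = ∑' n : ℤ, if n = 0 then 1 else 0 := by simp
  have hsum : Summable fun n : ℤ => Real.exp (-π * (1 * n ^ 2 - 2 * (2 * D) * |n|)) := by
    simpa using summable_pow_mul_jacobiTheta₂_term_bound (2 * D) one_pos 0
  have him := tendsto_im_cuspFilter D
  have hb : ∀ᶠ p in cuspFilter D, ∀ n : ℤ, ∀ T : ℝ, 0 < T → T ≤ 2 * p.1.im →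
      ‖jacobiTheta₂_term n (2 * p.2) (2 * p.1)‖ ≤ Real.exp (-π * (T * n ^ 2 - 2 * (2 * D) * |n|)) := by
    filter_upwards [eventually_abs_im_le_cuspFilter D] with p hp n T hT hTp
    refine norm_jacobiTheta₂_term_le hT ?_ (by simpa using hTp) n
    simpa [abs_mul] using hp
  rw [h1]
  refine tendsto_tsum_of_dominated_convergence hsum (fun n => ?_) ?_
  · split_ifs with hn
    · subst hn
      simpa [jacobiTheta₂_term] using tendsto_const_nhds
    · refine squeeze_zero_norm' (a := fun p : ℍ × ℂ =>
        Real.exp (-π * (2 * p.1.im * n ^ 2 - 2 * (2 * D) * |n|))) ?_ ?_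
      · filter_upwards [hb] with p hp
        exact hp n _ (mul_pos two_pos p.1.im_pos) le_rfl
      · refine Real.tendsto_exp_atBot.comp ?_
        have hn2 : (0 : ℝ) < (n : ℝ) ^ 2 := by positivity
        refine Tendsto.const_mul_atTop_of_neg (by linarith [Real.pi_pos]) ?_
        refine tendsto_atTop_add_const_right _ _ ?_
        exact (him.const_mul_atTop two_pos).atTop_mul_const hn2
  · filter_upwards [hb, him.eventually_ge_atTop 1] with p hp h1 n
    exact hp n 1 one_pos (by linarith)

theorem modularSlash_indexOneTheta_of_zero {k : ℤ} (hk : Even k)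
    (v : {v : ℤ × ℤ // IsCoprime v.1 v.2}) (hv : v.1.1 = 0) :
    modularSlash k 1 (bottomRowMatrix v) indexOneTheta = indexOneTheta := by
  have hu : v.1.2 = 1 ∨ v.1.2 = -1 := by
    have := v.2
    rw [hv, isCoprime_zero_left] at this
    exact Int.isUnit_iff.mp this
  funext p
  rcases hu with hu | hu
  · rw [modularSlash_indexOneTheta_congr k (γ' := 1) (by simp [bottomRowMatrix_one_zero, hv])
      (by simp [bottomRowMatrix_one_one, hu])]
    simp [modularSlash]
  · rw [modularSlash_indexOneTheta_congr k (γ' := -1) (by simp [bottomRowMatrix_one_zero, hv])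
      (by simp [bottomRowMatrix_one_one, hu])]
    have h1 : ((-1 : SL(2, ℤ)) • p.1) = p.1 := by
      ext1
      rw [coe_modular_smul]
      simp
    simp only [modularSlash]
    rw [h1]
    simp [div_neg, indexOneTheta_neg, hk.neg.neg_one_zpow]

/-- For `c ≠ 0` one has `|cτ+d| ≥ Im τ`, and both powers of it in the bound are negative. -/
theorem tendsto_modularSlash_indexOneTheta {k : ℤ} (hk : 4 ≤ k) (D : ℝ)
    (v : {v : ℤ × ℤ // IsCoprime v.1 v.2}) (hv : v.1.1 ≠ 0) :
    Tendsto (modularSlash k 1 (bottomRowMatrix v) indexOneTheta) (cuspFilter D) (𝓝 0) := by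
  obtain ⟨C, hC, h⟩ := exists_norm_modularSlash_theta_le
  have him := tendsto_im_cuspFilter D
  have hk' : (4 : ℝ) ≤ k := by exact_mod_cast hk
  have hp1 := (tendsto_rpow_neg_atTop (y := (k : ℝ)) (by linarith)).comp him
  have hp2 := (tendsto_rpow_neg_atTop (y := (k - 3 / 2 : ℝ)) (by linarith)).comp him
  have hlim : Tendsto (fun p : ℍ × ℂ => C * Real.exp (2 * π * D ^ 2) *
      (p.1.im ^ (-k : ℝ) + 1 * p.1.im ^ (-(k - 3 / 2) : ℝ))) (cuspFilter D) (𝓝 0) := by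
    simpa using (hp1.add (hp2.const_mul 1)).const_mul (C * Real.exp (2 * π * D ^ 2))
  refine squeeze_zero_norm' ?_ hlim
  filter_upwards [him.eventually_ge_atTop 1, eventually_abs_im_le_cuspFilter D] with p h1 hD
  refine (h k (bottomRowMatrix v) p.1 p.2).trans ?_
  rw [bottomRowMatrix_one_zero, bottomRowMatrix_one_one]
  have hj : p.1.im ≤ ‖(v.1.1 : ℂ) * p.1 + v.1.2‖ := by
    refine le_trans ?_ (Complex.abs_im_le_norm _)
    have : (1 : ℝ) ≤ |(v.1.1 : ℝ)| := by exact_mod_cast Int.one_le_abs hv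
    simp only [add_im, mul_im, intCast_re, intCast_im, coe_im, zero_mul, add_zero, abs_mul,
      abs_of_pos p.1.im_pos]
    nlinarith [p.1.im_pos]
  have hy := p.1.im_pos
  have hD2 : p.2.im ^ 2 ≤ D ^ 2 := sq_le_sq.mpr (hD.trans (le_abs_self D))
  have b4 : 2 * π * p.2.im ^ 2 / p.1.im ≤ 2 * π * D ^ 2 := by
    rw [div_le_iff₀ hy]
    have : 0 ≤ 2 * π * D ^ 2 := by positivity
    have : 2 * π * p.2.im ^ 2 ≤ 2 * π * D ^ 2 := by gcongr
    nlinarith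
  have b3 : p.1.im ^ (-(3 / 4) : ℝ) ≤ 1 := Real.rpow_le_one_of_one_le_of_nonpos h1 (by norm_num)
  refine mul_le_mul (mul_le_mul_of_nonneg_left (Real.exp_le_exp.mpr b4) hC.le)
    (add_le_add ?_ (mul_le_mul b3 ?_ (by positivity) one_pos.le)) (by positivity) (by positivity)
  · exact Real.rpow_le_rpow_of_nonpos hy hj (by linarith)
  · exact Real.rpow_le_rpow_of_nonpos hy hj (by linarith)

/-- Only the pairs `(0, 1)` and `(0, -1)` contribute; this is what the factor `1/2` in the
Eisenstein series normalizes. -/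
theorem tsum_coprime_ite_zero :
    ∑' v : {v : ℤ × ℤ // IsCoprime v.1 v.2}, (if v.1.1 = 0 then (1 : ℂ) else 0) = 2 := by
  classical
  have h1 : IsCoprime (0 : ℤ) 1 := isCoprime_one_right
  have h2 : IsCoprime (0 : ℤ) (-1) := isCoprime_one_right.neg_right
  rw [tsum_eq_sum (s := {⟨(0, 1), h1⟩, ⟨(0, -1), h2⟩})]
  · rw [Finset.sum_pair (by simp)]
    norm_num
  · rintro ⟨⟨c, d⟩, hcd⟩ hv
    refine if_neg ?_
    rintro h
    simp only at h
    subst h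
    rcases Int.isUnit_iff.mp (isCoprime_zero_left.mp hcd) with rfl | rfl <;> simp at hv

theorem jacobiEisenstein_add_int {k : ℤ} (τ : ℍ) (n : ℤ) (z : ℂ) :
    jacobiEisenstein k 1 (ModularGroup.T ^ n • τ, z) = jacobiEisenstein k 1 (τ, z) := by
  have h := congrFun (modularSlash_jacobiEisenstein k (ModularGroup.T ^ n)) (τ, z)
  rw [← h, modularSlash]
  simp [ModularGroup.coe_T_zpow, -map_zpow]

/-- The Jacobi-Eisenstein series tends to `1` at the cusp, locally uniformly in `Im z`. -/
theorem tendsto_jacobiEisenstein_cuspFilter {k : ℤ} (hk : 4 ≤ k) (he : Even k) (D : ℝ) :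
    Tendsto (jacobiEisenstein k 1) (cuspFilter D) (𝓝 1) := by
  obtain ⟨u, hu, hb⟩ := exists_summable_bound_modularSlash_theta hk 1 D one_pos
  have him := tendsto_im_cuspFilter D
  have hstrip : Tendsto (jacobiEisenstein k 1) (cuspFilter D ⊓ 𝓟 {p | |p.1.re| ≤ 1}) (𝓝 1) := by
    have h1 : (1 : ℂ) = 1 / 2 * ∑' v : {v : ℤ × ℤ // IsCoprime v.1 v.2},
        (if v.1.1 = 0 then (1 : ℂ) else 0) := by rw [tsum_coprime_ite_zero]; norm_num
    rw [h1, funext (jacobiEisenstein_eq k)]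
    refine Tendsto.const_mul _ (tendsto_tsum_of_dominated_convergence hu (fun v => ?_) ?_)
    · split_ifs with hv
      · have := tendsto_indexOneTheta_cuspFilter D
        rw [← modularSlash_indexOneTheta_of_zero he v hv] at this
        exact this.mono_left inf_le_left
      · exact (tendsto_modularSlash_indexOneTheta hk D v hv).mono_left inf_le_left
    · filter_upwards [mem_inf_of_left (him.eventually_ge_atTop 1),
        mem_inf_of_left (eventually_abs_im_le_cuspFilter D),
        mem_inf_of_right (mem_principal_self _)] with p h1 h2 h3 v
      exact hb v p.1 ⟨h3, h1⟩ p.2 h2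
  rw [tendsto_def] at hstrip ⊢
  intro s hs
  have h := hstrip s hs
  rw [mem_inf_principal, cuspFilter, mem_inf_principal] at h
  rw [cuspFilter, mem_inf_principal]
  obtain ⟨t, ht, hts⟩ := mem_comap.mp h
  refine mem_comap.mpr ⟨t, ht, fun p hp hD => ?_⟩
  -- The dominating series is uniform only on a vertical strip. The translation `T ^ n` brings the
  -- real part into `[0, 1)` and changes neither the imaginary part nor the value.
  set n : ℤ := -⌊p.1.re⌋
  have hp' : (ModularGroup.T ^ n • p.1, p.2) ∈ (fun p : ℍ × ℂ => p.1.im) ⁻¹' t := by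
    rw [Set.mem_preimage] at hp ⊢
    rwa [ModularGroup.im_T_zpow_smul]
  have := hts hp' hD ?_
  · rw [Set.mem_preimage, jacobiEisenstein_add_int] at this
    exact this
  · rw [Set.mem_ofPred_eq, ModularGroup.re_T_zpow_smul, abs_le]
    have h1 := Int.floor_le p.1.re
    have h2 := Int.lt_floor_add_one p.1.re
    simp only [n]
    push_cast
    constructor <;> linarith

/-! ### Taylor coefficients in `z` of functions covariant under the Jacobi group. -/

/-- The `n`-th Taylor coefficient at `0` of an entire function, as an average over the unit circle. -/
noncomputable def taylorCoeff (n : ℕ) (f : ℂ → ℂ) : ℂ := Real.circleAverage (fun z => z⁻¹ ^ n * f z) 0 1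

theorem continuousOn_inv_pow_mul {f : ℂ → ℂ} (hf : Continuous f) (n : ℕ) :
    ContinuousOn (fun z => z⁻¹ ^ n * f z) (Metric.sphere 0 |1|) := by
  refine ContinuousOn.mul (ContinuousOn.pow (continuousOn_inv₀.mono ?_) n) hf.continuousOn
  intro z hz h0
  rw [Set.mem_singleton_iff] at h0
  simp [h0] at hz

theorem taylorCoeff_add {f g : ℂ → ℂ} (hf : Continuous f) (hg : Continuous g) (n : ℕ) :
    taylorCoeff n (fun z => f z + g z) = taylorCoeff n f + taylorCoeff n g := by
  simp only [taylorCoeff, mul_add]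
  exact Real.circleAverage_fun_add (continuousOn_inv_pow_mul hf n).circleIntegrable'
    (continuousOn_inv_pow_mul hg n).circleIntegrable'

theorem taylorCoeff_const_mul (a : ℂ) (f : ℂ → ℂ) (n : ℕ) :
    taylorCoeff n (fun z => a * f z) = a * taylorCoeff n f := by
  have := Real.circleAverage_fun_smul (a := a) (f := fun z => z⁻¹ ^ n * f z) (c := 0) (R := 1)
  simp only [smul_eq_mul] at this
  simp only [taylorCoeff, ← this]
  congr 1
  funext z
  ring

/-- On the unit circle `z⁻¹ ^ n` cancels `z ^ n`, and the average of an entire function over the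
circle is its value at the centre. -/
theorem taylorCoeff_pow_mul {g : ℂ → ℂ} (hg : Differentiable ℂ g) (n : ℕ) :
    taylorCoeff n (fun z => z ^ n * g z) = g 0 := by
  have h1 : taylorCoeff n (fun z => z ^ n * g z) = Real.circleAverage g 0 1 := by
    refine Real.circleAverage_congr_sphere fun z hz => ?_
    have hz0 : z ≠ 0 := by rintro rfl; simp at hz
    rw [← mul_assoc, ← mul_pow, inv_mul_cancel₀ hz0, one_pow, one_mul]
  rw [h1]
  exact DiffContOnCl.circleAverage hg.diffContOnCl

theorem taylorCoeff_const (a : ℂ) (n : ℕ) : taylorCoeff n (fun _ => a) = if n = 0 then a else 0 := by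
  have h1 := Real.circleAverage_zero_one_congr_inv (f := fun z : ℂ => z ^ n * a)
  have h2 : Real.circleAverage (fun z : ℂ => z ^ n * a) 0 1 = 0 ^ n * a :=
    DiffContOnCl.circleAverage (Differentiable.diffContOnCl (by fun_prop))
  rw [taylorCoeff, h1, h2]
  split_ifs with h <;> simp [h]

theorem norm_taylorCoeff_le {f : ℂ → ℂ} {C : ℝ} (n : ℕ) (h : ∀ z, ‖z‖ = 1 → ‖f z‖ ≤ C) :
    ‖taylorCoeff n f‖ ≤ C := by
  rw [taylorCoeff, Real.circleAverage_def, norm_smul]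
  have hb := intervalIntegral.norm_integral_le_of_norm_le_const (a := 0) (b := 2 * π) (C := C)
    (f := fun θ => (fun z => z⁻¹ ^ n * f z) (circleMap 0 1 θ)) fun θ _ => by
      have h1 : ‖circleMap 0 1 θ‖ = 1 := by simp
      beta_reduce
      rw [norm_mul, norm_pow, norm_inv, h1]
      simpa using h _ h1
  rw [sub_zero, abs_of_pos Real.two_pi_pos] at hb
  calc _ ≤ ‖(2 * π)⁻¹‖ * (C * (2 * π)) := by gcongr
    _ = C := by
      rw [Real.norm_of_nonneg (by positivity)]
      field_simp

/-- An entire function whose first `n` Taylor coefficients vanish is divisible by `z ^ n`. -/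
theorem exists_eq_pow_mul {f : ℂ → ℂ} (hf : Differentiable ℂ f) :
    ∀ n : ℕ, (∀ i < n, taylorCoeff i f = 0) → ∃ g : ℂ → ℂ, Differentiable ℂ g ∧ f = fun z => z ^ n * g z
  | 0, _ => ⟨f, hf, by simp⟩
  | n + 1, h => by
    obtain ⟨g, hg, rfl⟩ := exists_eq_pow_mul hf n fun i hi => h i (hi.trans n.lt_succ_self)
    have h0 := h n n.lt_succ_self
    rw [taylorCoeff_pow_mul hg] at h0
    -- Since `g 0 = 0`, one more factor `z` splits off; the quotient is entire by the removable
    -- singularity theorem.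
    refine ⟨dslope g 0, ?_, funext fun z => ?_⟩
    · rw [← differentiableOn_univ] at hg ⊢
      exact (Complex.differentiableOn_dslope univ_mem).mpr hg
    · have := sub_smul_dslope g 0 z
      rw [sub_zero, h0, sub_zero, smul_eq_mul] at this
      rw [pow_succ, mul_assoc, this]

/-- The functions with the holomorphy and transformation behaviour of a Jacobi form of weight `k`
and index `m`, without growth condition at the cusp. -/
structure IsJacobiCovariant (k : ℤ) (m : ℕ) (Φ : ℍ × ℂ → ℂ) : Prop where
  holomorphic : DifferentiableOn ℂ (fun w : ℂ × ℂ => Φ (ofComplex w.1, w.2)) {w | 0 < w.1.im}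
  modular : ∀ γ : SL(2, ℤ), modularSlash k m γ Φ = Φ
  elliptic : ∀ l u : ℤ, ellipticSlash m l u Φ = Φ

theorem IsWeakJacobiForm.isJacobiCovariant {k : ℤ} {m : ℕ} {Φ : ℍ × ℂ → ℂ}
    (h : IsWeakJacobiForm k m Φ) : IsJacobiCovariant k m Φ :=
  ⟨h.holomorphic, h.modular, h.elliptic⟩

theorem isJacobiCovariant_jacobiEisenstein {k : ℤ} (hk : 4 ≤ k) :
    IsJacobiCovariant k 1 (jacobiEisenstein k 1) :=
  ⟨differentiableOn_jacobiEisenstein hk, modularSlash_jacobiEisenstein k, ellipticSlash_jacobiEisenstein k⟩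

namespace IsJacobiCovariant

variable {k : ℤ} {m : ℕ} {Φ : ℍ × ℂ → ℂ} (h : IsJacobiCovariant k m Φ)
include h

theorem differentiable (τ : ℍ) : Differentiable ℂ fun z => Φ (τ, z) := by
  intro z
  have h1 := (h.holomorphic.differentiableAt (x := ((τ : ℂ), z)) (isOpen_upper_prod.mem_nhds τ.im_pos))
  have h2 : DifferentiableAt ℂ (fun z : ℂ => ((τ : ℂ), z)) z := by fun_prop
  have := DifferentiableAt.comp z h1 h2
  simpa [Function.comp_def] using this

theorem modular_apply (γ : SL(2, ℤ)) (τ : ℍ) (z : ℂ) :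
    ((γ 1 0 : ℂ) * τ + (γ 1 1 : ℂ)) ^ (-k) *
      cexp (-(2 * π * I * (m * (γ 1 0 : ℂ) * z ^ 2 / ((γ 1 0 : ℂ) * τ + (γ 1 1 : ℂ))))) *
      Φ (γ • τ, z / ((γ 1 0 : ℂ) * τ + (γ 1 1 : ℂ))) = Φ (τ, z) :=
  congrFun (h.modular γ) (τ, z)

theorem even (hk : Even k) (τ : ℍ) (z : ℂ) : Φ (τ, -z) = Φ (τ, z) := by
  have h1 : ((-1 : SL(2, ℤ)) • τ) = τ := by
    ext1
    rw [coe_modular_smul]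
    simp
  have := h.modular_apply (-1) τ z
  rw [h1] at this
  simpa [div_neg, hk.neg.neg_one_zpow] using this

theorem mdifferentiable_taylorCoeff (n : ℕ) : MDiff fun τ => taylorCoeff n fun z => Φ (τ, z) := by
  rw [UpperHalfPlane.mdifferentiable_iff]
  have hne : ∀ t, circleMap 0 1 t ≠ 0 := fun t => circleMap_ne_center one_ne_zero
  have key := differentiableOn_intervalIntegral (U := {w : ℂ | 0 < w.im}) (a := 0) (b := 2 * π)
    (G := fun w t => (circleMap 0 1 t)⁻¹ ^ n * Φ (ofComplex w, circleMap 0 1 t))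
    (isOpen_lt continuous_const continuous_im) ?_ ?_
  · exact (key.const_smul ((2 * π)⁻¹ : ℝ)).congr fun w hw => rfl
  · refine ContinuousOn.mul (Continuous.continuousOn ?_) ?_
    · exact ((continuous_circleMap 0 1).comp continuous_snd).inv₀ (fun p => hne p.2) |>.pow n
    · exact h.holomorphic.continuousOn.comp (f := fun p : ℂ × ℝ => (p.1, circleMap 0 1 p.2))
        (by fun_prop) fun p hp => hp.1
  · intro t _
    refine DifferentiableOn.const_mul ?_ _
    exact h.holomorphic.comp (f := fun w : ℂ => (w, circleMap 0 1 t)) (by fun_prop) fun w hw => hw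

/-- The leading Taylor coefficient transforms like a modular form. -/
theorem isModularInvariant_taylorCoeff (n : ℕ) (h0 : ∀ τ, ∀ i < n, taylorCoeff i (fun z => Φ (τ, z)) = 0) :
    IsModularInvariant (k + n) fun τ => taylorCoeff n fun z => Φ (τ, z) := by
  intro γ τ
  have hJ := modular_denom_ne_zero γ τ
  have hmod := h.modular_apply γ τ
  obtain ⟨g, hg, hg'⟩ := exists_eq_pow_mul (h.differentiable τ) n (h0 τ)
  obtain ⟨g₁, hg₁, hg₁'⟩ := exists_eq_pow_mul (h.differentiable (γ • τ)) n (h0 (γ • τ))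
  beta_reduce
  rw [hg', hg₁', taylorCoeff_pow_mul hg, taylorCoeff_pow_mul hg₁]
  generalize hjj : (γ 1 0 : ℂ) * τ + γ 1 1 = J at *
  -- The modular relation divided by `z ^ n`. It holds for `z ≠ 0`, extends to `0` by continuity,
  -- and is then evaluated there, where the exponential factor is `1`.
  have e : ∀ z, g z = J ^ (-k) * cexp (-(2 * π * I * (m * (γ 1 0 : ℂ) * z ^ 2 / J))) *
      (J ^ (-(n : ℤ)) * g₁ (z / J)) := by
    have hc1 : Continuous g := hg.continuous
    have hc2 : Continuous g₁ := hg₁.continuous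
    refine congrFun (Continuous.ext_on (dense_compl_singleton (0 : ℂ)) hc1 (by fun_prop) ?_)
    intro z hz
    have hz0 : z ≠ 0 := hz
    have := hmod z
    rw [congrFun hg' z, congrFun hg₁' (z / J)] at this
    refine mul_left_cancel₀ (pow_ne_zero n hz0) ?_
    rw [← this, div_pow, zpow_neg J n, zpow_natCast]
    ring
  have e0 := e 0
  simp only [ne_eq, OfNat.ofNat_ne_zero, not_false_eq_true, zero_pow, mul_zero, zero_div, neg_zero,
    Complex.exp_zero, mul_one] at e0
  rw [e0, zpow_add₀ hJ, zpow_neg, zpow_neg]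
  field_simp

/-- Evenness in `z` kills the linear Taylor coefficient. -/
theorem exists_eq_add_sq_mul (hk : Even k) (τ : ℍ) : ∃ g : ℂ → ℂ, Differentiable ℂ g ∧
    g 0 = taylorCoeff 2 (fun z => Φ (τ, z)) ∧ ∀ z, Φ (τ, z) = Φ (τ, 0) + z ^ 2 * g z := by
  set f : ℂ → ℂ := fun z => Φ (τ, z) - Φ (τ, 0) with hf
  have hd : Differentiable ℂ f := (h.differentiable τ).sub_const _
  have hz : ∀ g : ℂ → ℂ, Differentiable ℂ g → taylorCoeff 0 g = g 0 := fun g hg => by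
    simpa using taylorCoeff_pow_mul hg 0
  obtain ⟨g₁, hg₁, hg₁'⟩ := exists_eq_pow_mul hd 1 (by
    intro i hi
    obtain rfl : i = 0 := by omega
    rw [hz f hd, hf]; simp)
  have hodd : ∀ z, z * (g₁ (-z) + g₁ z) = 0 := fun z => by
    have a1 := congrFun hg₁' z
    have a2 := congrFun hg₁' (-z)
    simp only [hf, h.even hk τ z] at a1 a2
    linear_combination a2 - a1
  have h10 : g₁ 0 = 0 := by
    have hc : Continuous g₁ := hg₁.continuous
    have := congrFun (Continuous.ext_on (dense_compl_singleton (0 : ℂ)) (f := fun z => g₁ (-z) + g₁ z)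
      (g := fun _ => 0) (by fun_prop) (by fun_prop) fun z hz => by
        rcases mul_eq_zero.mp (hodd z) with h | h
        · exact absurd h hz
        · exact h) 0
    simp only [neg_zero] at this
    linear_combination this / 2
  obtain ⟨g, hg, hg'⟩ := exists_eq_pow_mul hd 2 (by
    intro i hi
    obtain rfl | rfl : i = 0 ∨ i = 1 := by omega
    · rw [hz f hd, hf]; simp
    · rw [hg₁', taylorCoeff_pow_mul hg₁, h10])
  refine ⟨g, hg, ?_, fun z => ?_⟩
  · have e1 : (fun z => Φ (τ, z)) = fun z => Φ (τ, 0) + f z := by funext z; simp [hf]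
    rw [e1, taylorCoeff_add continuous_const hd.continuous, taylorCoeff_const, hg', taylorCoeff_pow_mul hg]
    simp
  · have := congrFun hg' z
    simp only [hf] at this
    linear_combination this

theorem isModularInvariant_zero : IsModularInvariant k fun τ => Φ (τ, 0) := by
  intro γ τ
  have hJ := modular_denom_ne_zero γ τ
  have := h.modular_apply γ τ 0
  simp only [ne_eq, OfNat.ofNat_ne_zero, not_false_eq_true, zero_pow, mul_zero, zero_div, neg_zero,
    Complex.exp_zero, mul_one] at this
  change Φ (γ • τ, 0) = _ ^ k * Φ (τ, 0)
  rw [← this, ← mul_assoc, ← zpow_add₀ hJ, add_neg_cancel, zpow_zero, one_mul]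

theorem taylorCoeff_zero (τ : ℍ) : taylorCoeff 0 (fun z => Φ (τ, z)) = Φ (τ, 0) := by
  simpa using taylorCoeff_pow_mul (h.differentiable τ) 0

theorem mdifferentiable_zero : MDiff fun τ => Φ (τ, 0) := by
  simpa only [h.taylorCoeff_zero] using h.mdifferentiable_taylorCoeff 0

/-- The transformation behaviour of the second Taylor coefficient. -/
theorem taylorCoeff_two_smul (hk : Even k) (γ : SL(2, ℤ)) (τ : ℍ) :
    taylorCoeff 2 (fun z => Φ (γ • τ, z)) = ((γ 1 0 : ℂ) * τ + (γ 1 1 : ℂ)) ^ (k + 2) *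
      taylorCoeff 2 (fun z => Φ (τ, z)) + 2 * π * I * m * γ 1 0 *
        ((γ 1 0 : ℂ) * τ + (γ 1 1 : ℂ)) ^ (k + 1) * Φ (τ, 0) := by
  have hJ := modular_denom_ne_zero γ τ
  have hmod := h.modular_apply γ τ
  have h0 := h.isModularInvariant_zero γ τ
  beta_reduce at h0
  obtain ⟨g, hg, hg0, hg'⟩ := h.exists_eq_add_sq_mul hk τ
  obtain ⟨g₁, hg₁, hg₁0, hg₁'⟩ := h.exists_eq_add_sq_mul hk (γ • τ)
  rw [← hg0, ← hg₁0]
  generalize hjj : (γ 1 0 : ℂ) * τ + γ 1 1 = J at *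
  -- The exponential factor is `exp(q z²) = 1 + q z² + …`, so its second term mixes `Φ(τ, 0)` into
  -- the coefficient of `z²`. The entire function `(exp w - 1)/w` is `dslope cexp 0`.
  set q : ℂ := -(2 * π * I * (m * (γ 1 0 : ℂ) / J)) with hq
  have hds : Differentiable ℂ (dslope cexp 0) := by
    rw [← differentiableOn_univ]
    exact (Complex.differentiableOn_dslope univ_mem).mpr differentiable_exp.differentiableOn
  have e : ∀ z, g z = Φ (τ, 0) * (q * dslope cexp 0 (q * z ^ 2)) +
      J ^ (-k) * cexp (q * z ^ 2) * (J ^ (-2 : ℤ) * g₁ (z / J)) := by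
    have hc1 : Continuous g := hg.continuous
    have hc2 : Continuous g₁ := hg₁.continuous
    have hc3 := hds.continuous
    refine congrFun (Continuous.ext_on (dense_compl_singleton (0 : ℂ)) hc1 (by fun_prop) ?_)
    intro z hz
    have hz0 : z ≠ 0 := hz
    have h1 := hmod z
    have h2 : -(2 * π * I * (m * (γ 1 0 : ℂ) * z ^ 2 / J)) = q * z ^ 2 := by rw [hq]; ring
    rw [h2, hg' z, hg₁' (z / J), h0] at h1
    have h3 := sub_smul_dslope cexp 0 (q * z ^ 2)
    rw [sub_zero, smul_eq_mul, Complex.exp_zero] at h3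
    have h4 : J ^ (-k) * J ^ k = 1 := by rw [← zpow_add₀ hJ, neg_add_cancel, zpow_zero]
    refine mul_left_cancel₀ (pow_ne_zero 2 hz0) ?_
    have h5 : J ^ (-2 : ℤ) = (J ^ 2)⁻¹ := by rw [zpow_neg]; rfl
    rw [h5]
    rw [div_pow] at h1
    linear_combination -h1 - Φ (τ, 0) * h3 + Φ (τ, 0) * cexp (q * z ^ 2) * h4
  have e0 := e 0
  have h6 : dslope cexp 0 0 = 1 := by rw [dslope_same]; simp
  simp only [ne_eq, OfNat.ofNat_ne_zero, not_false_eq_true, zero_pow, mul_zero, zero_div, h6,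
    Complex.exp_zero, mul_one] at e0
  have h7 : J ^ (k + 2) * (J ^ (-k) * J ^ (-2 : ℤ)) = 1 := by
    rw [← zpow_add₀ hJ, ← zpow_add₀ hJ, show k + 2 + (-k + -2) = 0 by ring, zpow_zero]
  have h8 : J ^ (k + 2) = J ^ (k + 1) * J := by rw [← zpow_add_one₀ hJ]; ring_nf
  have h9 : q * J = -(2 * π * I * (m * (γ 1 0 : ℂ))) := by rw [hq]; field_simp
  rw [e0]
  linear_combination -g₁ 0 * h7 - Φ (τ, 0) * q * h8 - Φ (τ, 0) * J ^ (k + 1) * h9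

omit h in
-- The unit circle lies in `|Im z| ≤ 1`, where the convergence to `a` is uniform; the constant `a`
-- has only its zeroth coefficient.
theorem tendsto_taylorCoeff {a : ℂ} (hc : ∀ τ, Continuous fun z => Φ (τ, z))
    (hlim : Tendsto Φ (cuspFilter 1) (𝓝 a)) (n : ℕ) :
    Tendsto (fun τ => taylorCoeff n fun z => Φ (τ, z)) atImInfty (𝓝 (if n = 0 then a else 0)) := by
  rw [Metric.tendsto_nhds] at hlim ⊢
  intro ε hε
  have := hlim (ε / 2) (half_pos hε)
  rw [cuspFilter, eventually_inf_principal, eventually_comap] at this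
  have h2 : ∀ᶠ τ in atImInfty, ∀ p : ℍ × ℂ, p.1.im = τ.im → p ∈ {p : ℍ × ℂ | |p.2.im| ≤ 1} →
      dist (Φ p) a < ε / 2 := tendsto_comap.eventually this
  filter_upwards [h2] with τ hτ
  rw [dist_eq_norm, ← taylorCoeff_const]
  have e : taylorCoeff n (fun z => Φ (τ, z)) - taylorCoeff n (fun _ => a) =
      taylorCoeff n (fun z => Φ (τ, z) + (-1) * a) := by
    rw [taylorCoeff_add (hc τ) continuous_const, taylorCoeff_const_mul]
    ring
  rw [e]
  refine (norm_taylorCoeff_le n fun z hz => ?_).trans_lt (half_lt_self hε)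
  have := hτ (τ, z) rfl ((abs_im_le_norm z).trans hz.le)
  rw [dist_eq_norm] at this
  rw [neg_one_mul, ← sub_eq_add_neg]
  exact this.le

end IsJacobiCovariant

namespace IsModularInvariant

theorem inv {k : ℤ} {f : ℍ → ℂ} (hf : IsModularInvariant k f) :
    IsModularInvariant (-k) fun τ => (f τ)⁻¹ := by
  intro γ τ
  change (f (γ • τ))⁻¹ = _ * (f τ)⁻¹
  rw [hf γ τ, mul_inv, zpow_neg]

theorem sub {k : ℤ} {f g : ℍ → ℂ} (hf : IsModularInvariant k f) (hg : IsModularInvariant k g) :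
    IsModularInvariant k fun τ => f τ - g τ := by
  intro γ τ
  change f (γ • τ) - g (γ • τ) = _ * (f τ - g τ)
  rw [hf γ τ, hg γ τ]
  ring

theorem const_mul {k : ℤ} {f : ℍ → ℂ} (a : ℂ) (hf : IsModularInvariant k f) :
    IsModularInvariant k fun τ => a * f τ := by
  intro γ τ
  change a * f (γ • τ) = _ * (a * f τ)
  rw [hf γ τ]
  ring

open Derivative in
theorem normalizedDeriv_smul {k : ℤ} {f : ℍ → ℂ} (hf : IsModularInvariant k f) (hol : MDiff f)
    (γ : SL(2, ℤ)) (τ : ℍ) : normalizedDerivOfComplex f (γ • τ) =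
      ((γ 1 0 : ℂ) * τ + (γ 1 1 : ℂ)) ^ (k + 2) * normalizedDerivOfComplex f τ +
        k * (2 * π * I)⁻¹ * γ 1 0 * ((γ 1 0 : ℂ) * τ + (γ 1 1 : ℂ)) ^ (k + 1) * f τ := by
  have hJ := modular_denom_ne_zero γ τ
  have h := congrFun (normalizedDerivOfComplex_SL_slash (k := k) hol (γ := γ)) τ
  rw [isModularInvariant_iff_slash.mp hf γ, Pi.sub_apply, ModularForm.SL_slash_apply,
    modular_denom_eq] at h
  generalize hjj : (γ 1 0 : ℂ) * τ + γ 1 1 = J at *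
  have h2 : J ^ (k + 2) * J ^ (-(k + 2)) = 1 := by rw [← zpow_add₀ hJ, add_neg_cancel, zpow_zero]
  have h3 : J ^ (k + 2) = J ^ (k + 1) * J := by rw [← zpow_add_one₀ hJ]; ring_nf
  have h4 : J * ((γ 1 0 : ℂ) / J) = γ 1 0 := mul_div_cancel₀ _ hJ
  rw [h, mul_sub]
  linear_combination -normalizedDerivOfComplex f (γ • τ) * h2 +
    k * (2 * π * I)⁻¹ * ((γ 1 0 : ℂ) / J) * f τ * h3 + k * (2 * π * I)⁻¹ * f τ * J ^ (k + 1) * h4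

end IsModularInvariant

theorem differentiableOn_comp_fst {f : ℍ → ℂ} (hf : MDiff f) :
    DifferentiableOn ℂ (fun w : ℂ × ℂ => f (ofComplex w.1)) {w | 0 < w.1.im} :=
  (UpperHalfPlane.mdifferentiable_iff.mp hf).comp differentiableOn_fst fun _ hw => hw

namespace IsJacobiCovariant

theorem mul_modular {k l : ℤ} {m : ℕ} {Φ : ℍ × ℂ → ℂ} {f : ℍ → ℂ} (hf : IsModularInvariant l f)
    (hol : MDiff f) (h : IsJacobiCovariant k m Φ) :
    IsJacobiCovariant (l + k) m fun p => f p.1 * Φ p := by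
  refine ⟨(differentiableOn_comp_fst hol).mul h.holomorphic, fun γ => ?_, fun a u => ?_⟩
  · funext p
    have hJ := modular_denom_ne_zero γ p.1
    have e := h.modular_apply γ p.1 p.2
    have e2 : ((γ 1 0 : ℂ) * p.1 + (γ 1 1 : ℂ)) ^ (-(l + k)) * ((γ 1 0 : ℂ) * p.1 + (γ 1 1 : ℂ)) ^ l =
        ((γ 1 0 : ℂ) * p.1 + (γ 1 1 : ℂ)) ^ (-k) := by rw [← zpow_add₀ hJ]; ring_nf
    rw [← e2] at e
    simp only [modularSlash]
    rw [hf γ p.1]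
    linear_combination f p.1 * e
  · funext p
    have e := congrFun (h.elliptic a u) p
    simp only [ellipticSlash] at e ⊢
    linear_combination f p.1 * e

theorem sub {k : ℤ} {m : ℕ} {Φ Ψ : ℍ × ℂ → ℂ} (h : IsJacobiCovariant k m Φ)
    (h' : IsJacobiCovariant k m Ψ) : IsJacobiCovariant k m fun p => Φ p - Ψ p := by
  refine ⟨h.holomorphic.sub h'.holomorphic, fun γ => ?_, fun a u => ?_⟩
  · funext p
    have e := congrFun (h.modular γ) p
    have e' := congrFun (h'.modular γ) p
    simp only [modularSlash] at e e' ⊢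
    linear_combination e - e'
  · funext p
    have e := congrFun (h.elliptic a u) p
    have e' := congrFun (h'.elliptic a u) p
    simp only [ellipticSlash] at e e' ⊢
    linear_combination e - e'

theorem const_mul {k : ℤ} {m : ℕ} {Φ : ℍ × ℂ → ℂ} (a : ℂ) (h : IsJacobiCovariant k m Φ) :
    IsJacobiCovariant k m fun p => a * Φ p := by
  refine ⟨h.holomorphic.const_mul a, fun γ => ?_, fun b u => ?_⟩
  · funext p
    have e := congrFun (h.modular γ) p
    simp only [modularSlash] at e ⊢
    linear_combination a * e
  · funext p
    have e := congrFun (h.elliptic b u) p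
    simp only [ellipticSlash] at e ⊢
    linear_combination a * e

open Derivative in
-- Neither term is modular: the coefficient of `z²` and the derivative of the constant coefficient
-- each acquire a multiple of `c (cτ+d)^(k+1) Φ(τ, 0)`. The combination is chosen so that these
-- anomalies cancel.
theorem isModularInvariant_taylorCoeff_two {k : ℤ} {m : ℕ} {Φ : ℍ × ℂ → ℂ} (h : IsJacobiCovariant k m Φ)
    (hk : Even k) : IsModularInvariant (k + 2) fun τ => k * taylorCoeff 2 (fun z => Φ (τ, z)) -
      (2 * π * I) ^ 2 * m * normalizedDerivOfComplex (fun τ => Φ (τ, 0)) τ := by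
  intro γ τ
  change k * taylorCoeff 2 (fun z => Φ (γ • τ, z)) -
      (2 * π * I) ^ 2 * m * normalizedDerivOfComplex (fun τ => Φ (τ, 0)) (γ • τ) = _ *
    (k * taylorCoeff 2 (fun z => Φ (τ, z)) -
      (2 * π * I) ^ 2 * m * normalizedDerivOfComplex (fun τ => Φ (τ, 0)) τ)
  rw [h.taylorCoeff_two_smul hk γ τ,
    h.isModularInvariant_zero.normalizedDeriv_smul h.mdifferentiable_zero γ τ]
  have : (2 * π * I) * (2 * π * I : ℂ)⁻¹ = 1 := mul_inv_cancel₀ two_pi_I_ne_zero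
  linear_combination -(k * m * (2 * π * I) * γ 1 0 * ((γ 1 0 : ℂ) * τ + (γ 1 1 : ℂ)) ^ (k + 1) * Φ (τ, 0)) * this

end IsJacobiCovariant

/-! ### Leading Taylor coefficients of the Eisenstein series and of `A` and `B`. -/

theorem tendsto_jacobiEisenstein_zero {k : ℤ} (hk : 4 ≤ k) (he : Even k) :
    Tendsto (fun τ => jacobiEisenstein k 1 (τ, 0)) atImInfty (𝓝 1) := by
  have hcov := isJacobiCovariant_jacobiEisenstein hk
  have := IsJacobiCovariant.tendsto_taylorCoeff (fun τ => (hcov.differentiable τ).continuous)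
    (tendsto_jacobiEisenstein_cuspFilter hk he 1) 0
  simpa only [hcov.taylorCoeff_zero, if_true] using this

theorem tendsto_taylorCoeff_two_jacobiEisenstein {k : ℤ} (hk : 4 ≤ k) (he : Even k) :
    Tendsto (fun τ => taylorCoeff 2 fun z => jacobiEisenstein k 1 (τ, z)) atImInfty (𝓝 0) :=
  IsJacobiCovariant.tendsto_taylorCoeff
    (fun τ => ((isJacobiCovariant_jacobiEisenstein hk).differentiable τ).continuous)
    (tendsto_jacobiEisenstein_cuspFilter hk he 1) 2

/-- Both sides are forms of weight `4 < 12` with limit `1` at the cusp. -/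
theorem jacobiEisenstein_four_zero (τ : ℍ) : jacobiEisenstein 4 1 (τ, 0) = ModularForm.E₄ τ := by
  have hcov := isJacobiCovariant_jacobiEisenstein (k := 4) le_rfl
  exact congrFun (hcov.isModularInvariant_zero.eq_of_tendsto (by norm_num)
    ModularForm.E₄.isModularInvariant hcov.mdifferentiable_zero ModularForm.E₄.mdifferentiable
    (tendsto_jacobiEisenstein_zero le_rfl (by decide)) tendsto_E₄) τ

theorem jacobiEisenstein_six_zero (τ : ℍ) : jacobiEisenstein 6 1 (τ, 0) = ModularForm.E₆ τ := by
  have hcov := isJacobiCovariant_jacobiEisenstein (k := 6) (by norm_num)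
  exact congrFun (hcov.isModularInvariant_zero.eq_of_tendsto (by norm_num)
    ModularForm.E₆.isModularInvariant hcov.mdifferentiable_zero ModularForm.E₆.mdifferentiable
    (tendsto_jacobiEisenstein_zero (by norm_num) (by decide)) tendsto_E₆) τ

open Derivative in
-- The corrected second coefficient is modular of weight `k + 2 < 12` and vanishes at the cusp,
-- hence is zero.
theorem mul_taylorCoeff_two_jacobiEisenstein {k : ℤ} (hk : 4 ≤ k) (he : Even k) (hk' : k < 10) (τ : ℍ) :
    k * taylorCoeff 2 (fun z => jacobiEisenstein k 1 (τ, z)) =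
      (2 * π * I) ^ 2 * normalizedDerivOfComplex (fun τ => jacobiEisenstein k 1 (τ, 0)) τ := by
  have hcov := isJacobiCovariant_jacobiEisenstein hk
  have h1 := hcov.isModularInvariant_taylorCoeff_two he
  have h2 := h1.eq_zero (by linarith) ?_ ?_
  · have := congrFun h2 τ
    simp only [Nat.cast_one, mul_one, Pi.zero_apply] at this
    exact sub_eq_zero.mp this
  · exact (mdifferentiable_const.mul (hcov.mdifferentiable_taylorCoeff 2)).sub
      (mdifferentiable_const.mul (normalizedDerivOfComplex_mdifferentiable hcov.mdifferentiable_zero))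
  · have := ((tendsto_taylorCoeff_two_jacobiEisenstein hk he).const_mul (k : ℂ)).sub
      ((tendsto_normalizedDeriv hcov.mdifferentiable_zero (tendsto_jacobiEisenstein_zero hk he)).const_mul
        ((2 * π * I) ^ 2 * ((1 : ℕ) : ℂ)))
    rw [mul_zero, mul_zero, sub_zero] at this
    exact this

theorem modularDelta_eq (τ : ℍ) : modularDelta τ = ModularForm.discriminant τ := by
  rw [modularDelta]
  rw [ModularForm.discriminant_eq_E₄_cube_sub_E₆_sq]
  ring

theorem modularDelta_ne_zero (τ : ℍ) : modularDelta τ ≠ 0 := by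
  rw [modularDelta_eq]
  exact ModularForm.discriminant_ne_zero τ

theorem isModularInvariant_modularDelta : IsModularInvariant 12 modularDelta := by
  have h4 := isModularInvariant_monomial 3 0
  have h6 := isModularInvariant_monomial 0 2
  have := (h4.sub h6).const_mul (1 / 1728)
  intro γ τ
  simpa [modularDelta] using this γ τ

theorem mdifferentiable_modularDelta : MDiff modularDelta := by
  have h := UpperHalfPlane.mdifferentiable_iff.mp (mdifferentiable_monomial 3 0)
  have h' := UpperHalfPlane.mdifferentiable_iff.mp (mdifferentiable_monomial 0 2)
  rw [UpperHalfPlane.mdifferentiable_iff]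
  refine ((h.sub h').const_mul (1 / 1728)).congr fun w _ => ?_
  simp [modularDelta]

theorem mdifferentiable_modularDelta_inv : MDiff fun τ => (modularDelta τ)⁻¹ := by
  rw [UpperHalfPlane.mdifferentiable_iff]
  exact (UpperHalfPlane.mdifferentiable_iff.mp mdifferentiable_modularDelta).inv
    fun w _ => modularDelta_ne_zero _

theorem isJacobiCovariant_jacobiPhi10 : IsJacobiCovariant 10 1 jacobiPhi10 :=
  (IsJacobiCovariant.sub (k := 10) ((isJacobiCovariant_jacobiEisenstein (k := 4) le_rfl).mul_modular
      ModularForm.E₆.isModularInvariant ModularForm.E₆.mdifferentiable)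
    ((isJacobiCovariant_jacobiEisenstein (k := 6) (by norm_num)).mul_modular
      ModularForm.E₄.isModularInvariant ModularForm.E₄.mdifferentiable)).const_mul (1 / 144)

theorem isJacobiCovariant_jacobiPhi12 : IsJacobiCovariant 12 1 jacobiPhi12 :=
  (IsJacobiCovariant.sub (k := 12) ((isJacobiCovariant_jacobiEisenstein (k := 4) le_rfl).mul_modular
      isModularInvariant_E₄_sq mdifferentiable_E₄_sq)
    ((isJacobiCovariant_jacobiEisenstein (k := 6) (by norm_num)).mul_modular
      ModularForm.E₆.isModularInvariant ModularForm.E₆.mdifferentiable)).const_mul (1 / 144)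

theorem isJacobiCovariant_jacobiA : IsJacobiCovariant (-2) 1 jacobiA := by
  have := isJacobiCovariant_jacobiPhi10.mul_modular isModularInvariant_modularDelta.inv
    mdifferentiable_modularDelta_inv
  simp only [inv_mul_eq_div] at this
  exact this

theorem isJacobiCovariant_jacobiB : IsJacobiCovariant 0 1 jacobiB := by
  have := isJacobiCovariant_jacobiPhi12.mul_modular isModularInvariant_modularDelta.inv
    mdifferentiable_modularDelta_inv
  simp only [inv_mul_eq_div] at this
  exact this

theorem jacobiA_zero (τ : ℍ) : jacobiA (τ, 0) = 0 := by
  simp only [jacobiA, jacobiPhi10, jacobiEisenstein_four_zero, jacobiEisenstein_six_zero]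
  ring

theorem jacobiB_zero (τ : ℍ) : jacobiB (τ, 0) = 12 := by
  have h := modularDelta_ne_zero τ
  simp only [jacobiB, jacobiPhi12, jacobiEisenstein_four_zero, jacobiEisenstein_six_zero]
  rw [div_eq_iff h, modularDelta]
  ring

/-- The coefficients of `z²` in `E_{4,1}` and `E_{6,1}` are `(2πi)² D E₄ / 4` and `(2πi)² D E₆ / 6`.
So that of the numerator of `A` is a multiple of the Rankin-Cohen bracket of `E₄` and `E₆`, that is,
of `Δ`, and the quotient is constant. -/
theorem taylorCoeff_two_jacobiA (τ : ℍ) : taylorCoeff 2 (fun z => jacobiA (τ, z)) = (2 * π * I) ^ 2 := by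
  have hΔ := modularDelta_ne_zero τ
  have c4 := (isJacobiCovariant_jacobiEisenstein (k := 4) le_rfl).differentiable τ |>.continuous
  have c6 := (isJacobiCovariant_jacobiEisenstein (k := 6) (by norm_num)).differentiable τ |>.continuous
  have e : (fun z => jacobiA (τ, z)) = fun z =>
      (144 * modularDelta τ)⁻¹ * (ModularForm.E₆ τ * jacobiEisenstein 4 1 (τ, z) +
        (-ModularForm.E₄ τ) * jacobiEisenstein 6 1 (τ, z)) := by
    funext z
    simp only [jacobiA, jacobiPhi10]
    field_simp
    ring
  rw [e, taylorCoeff_const_mul, taylorCoeff_add (c4.const_mul _) (c6.const_mul _), taylorCoeff_const_mul,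
    taylorCoeff_const_mul]
  have h4 := mul_taylorCoeff_two_jacobiEisenstein (k := 4) le_rfl (by decide) (by norm_num) τ
  have h6 := mul_taylorCoeff_two_jacobiEisenstein (k := 6) (by norm_num) (by decide) (by norm_num) τ
  have hRC := rankinCohenOne_E₄_E₆ τ
  simp only [jacobiEisenstein_four_zero, jacobiEisenstein_six_zero] at h4 h6
  simp only [rankinCohenOne] at hRC
  rw [inv_mul_eq_iff_eq_mul₀ (by simp [hΔ]), modularDelta]
  push_cast at h4 h6 hRC
  linear_combination ModularForm.E₆ τ / 4 * h4 - ModularForm.E₄ τ / 6 * h6 - (2 * π * I) ^ 2 / 24 * hRC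

/-! ### Fourier expansions of theta functions and of products -/

/-- A Fourier expansion of the shape required of weak Jacobi forms of index `m`. -/
def HasJacobiExpansion (m : ℕ) (Φ : ℍ × ℂ → ℂ) : Prop :=
  ∃ c : ℕ → ℤ → ℂ, (∀ (n : ℕ) (r : ℤ), 4 * (n : ℤ) * m + (m : ℤ) ^ 2 < r ^ 2 → c n r = 0) ∧
    ∀ (τ : ℍ) (z : ℂ), HasSum
      (fun i : ℕ × ℤ => c i.1 i.2 * cexp (2 * π * I * (i.1 * (τ : ℂ) + i.2 * z))) (Φ (τ, z))

theorem HasJacobiExpansion.add {m : ℕ} {Φ Ψ : ℍ × ℂ → ℂ} (h : HasJacobiExpansion m Φ)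
    (h' : HasJacobiExpansion m Ψ) : HasJacobiExpansion m (fun p => Φ p + Ψ p) := by
  obtain ⟨c, hc, hs⟩ := h
  obtain ⟨d, hd, hs'⟩ := h'
  refine ⟨fun n r => c n r + d n r, fun n r hnr => ?_, fun τ z => ?_⟩
  · simp [hc n r hnr, hd n r hnr]
  · simpa [add_mul] using (hs τ z).add (hs' τ z)

theorem HasJacobiExpansion.mul {m₁ m₂ : ℕ} {Φ Ψ : ℍ × ℂ → ℂ} (h : HasJacobiExpansion m₁ Φ)
    (h' : HasJacobiExpansion m₂ Ψ) : HasJacobiExpansion (m₁ + m₂) (fun p => Φ p * Ψ p) := by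
  obtain ⟨c, hc, hs⟩ := h
  obtain ⟨d, hd, hs'⟩ := h'
  refine ⟨fourierMul c d, fun n r hnr => ?_, fun τ z => ?_⟩
  · refine (tsum_congr fun x => ?_).trans tsum_zero
    obtain ⟨⟨⟨n₁, r₁⟩, ⟨n₂, r₂⟩⟩, hx⟩ := x
    simp only [Set.mem_preimage, Set.mem_singleton_iff, Prod.mk.injEq] at hx
    obtain ⟨rfl, rfl⟩ := hx
    by_cases hc' : 4 * (n₁ : ℤ) * m₁ + (m₁ : ℤ) ^ 2 < r₁ ^ 2
    · simp [hc _ _ hc']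
    by_cases hd' : 4 * (n₂ : ℤ) * m₂ + (m₂ : ℤ) ^ 2 < r₂ ^ 2
    · simp [hd _ _ hd']
    exact absurd (weakJacobi_index_bound (not_lt.mp hc') (not_lt.mp hd')) (not_le.mpr hnr)
  · refine hasSum_fourier_mul (c := c) (d := d)
      (e := fun n r => cexp (2 * π * I * (n * (τ : ℂ) + r * z))) (fun n₁ n₂ r₁ r₂ => ?_)
      (hs τ z) (hs' τ z)
    rw [← Complex.exp_add]
    congr 1
    push_cast
    ring

theorem hasJacobiExpansion_of_hasSum {f : ℍ → ℂ} {a : ℕ → ℂ}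
    (h : ∀ τ : ℍ, HasSum (fun n : ℕ => a n * cexp (2 * π * I * (n * (τ : ℂ)))) (f τ)) :
    HasJacobiExpansion 0 fun p => f p.1 := by
  refine ⟨fun n r => if r = 0 then a n else 0, fun n r hnr => if_neg ?_, fun τ z => ?_⟩
  · rintro rfl
    simp at hnr
  · have hinj : Function.Injective fun n : ℕ => ((n, 0) : ℕ × ℤ) := fun a b h => by simpa using h
    refine (hinj.hasSum_iff ?_).mp ?_
    · rintro ⟨n, r⟩ hr
      have : r ≠ 0 := by rintro rfl; exact hr ⟨n, rfl⟩
      simp [this]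
    · simpa [Function.comp_def] using h τ

/-- The theta series `∑ q^(l²+sl) ζ^(2l+s)`. -/
noncomputable def thetaComponent (s : ℕ) (τ : ℍ) (z : ℂ) : ℂ :=
  cexp (2 * π * I * (s * z)) * jacobiTheta₂ (2 * z + s * τ) (2 * τ)

theorem hasSum_thetaComponent (s : ℕ) (τ : ℍ) (z : ℂ) : HasSum (fun l : ℤ =>
    cexp (2 * π * I * ((l ^ 2 + s * l : ℤ) * (τ : ℂ) + (s + 2 * l : ℤ) * z))) (thetaComponent s τ z) := by
  have := (hasSum_jacobiTheta₂_term (2 * z + s * τ) (indexOneTheta_two_im_pos τ)).mul_left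
    (cexp (2 * π * I * (s * z)))
  refine this.congr_fun fun l => ?_
  rw [jacobiTheta₂_term, ← Complex.exp_add]
  congr 1
  push_cast
  ring

/-- With `n = l² + sl` and `r = s + 2l` one has `r² = 4n + s² ≤ 4n + 1`. -/
theorem hasJacobiExpansion_thetaComponent {s : ℕ} (hs : s ≤ 1) :
    HasJacobiExpansion 1 fun p => thetaComponent s p.1 p.2 := by
  have hpos : ∀ l : ℤ, 0 ≤ l ^ 2 + s * l := fun l => by
    interval_cases s
    · simpa using sq_nonneg l
    · push_cast
      rcases le_or_gt 0 l with h | h <;> nlinarith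
  set g : ℤ → ℕ × ℤ := fun l => ((l ^ 2 + s * l).toNat, s + 2 * l) with hg
  have hinj : Function.Injective g := fun a b h => by
    have := congrArg Prod.snd h
    simp only [hg] at this
    linarith
  classical
  refine ⟨fun n r => if (n, r) ∈ Set.range g then 1 else 0, fun n r hnr => if_neg ?_, fun τ z => ?_⟩
  · rintro ⟨l, hl⟩
    simp only [hg, Prod.mk.injEq] at hl
    obtain ⟨rfl, rfl⟩ := hl
    rw [Int.toNat_of_nonneg (hpos l)] at hnr
    have : (s : ℤ) ^ 2 ≤ 1 := by interval_cases s <;> norm_num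
    push_cast at hnr
    nlinarith
  · refine (hinj.hasSum_iff ?_).mp ?_
    · intro i hi
      simp [hi]
    · refine (hasSum_thetaComponent s τ z).congr_fun fun l => ?_
      simp only [Function.comp, Set.mem_range_self, Prod.mk.eta, if_true, one_mul]
      have : (((l ^ 2 + s * l).toNat : ℕ) : ℂ) = ((l ^ 2 + s * l : ℤ) : ℂ) := by
        exact_mod_cast congrArg (Int.cast : ℤ → ℂ) (Int.toNat_of_nonneg (hpos l))
      simp only [hg, this]

theorem differentiable_thetaComponent (s : ℕ) (τ : ℍ) : Differentiable ℂ (thetaComponent s τ) := by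
  intro z
  have h1 := differentiableAt_jacobiTheta₂_fst (2 * z + s * τ) (indexOneTheta_two_im_pos τ)
  have h2 : DifferentiableAt ℂ (fun z : ℂ => 2 * z + s * τ) z := by fun_prop
  have h3 := DifferentiableAt.comp (f := fun z : ℂ => 2 * z + s * τ)
    (g := fun w => jacobiTheta₂ w (2 * τ)) z h1 h2
  exact DifferentiableAt.mul (by fun_prop) h3

theorem thetaComponent_add_one (s : ℕ) (τ : ℍ) (z : ℂ) :
    thetaComponent s τ (z + 1) = thetaComponent s τ z := by
  refine (hasSum_thetaComponent s τ (z + 1)).unique ((hasSum_thetaComponent s τ z).congr_fun fun l => ?_)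
  refine Complex.exp_eq_exp_iff_exists_int.mpr ⟨s + 2 * l, ?_⟩
  push_cast
  ring

theorem thetaComponent_add_period (s : ℕ) (τ : ℍ) (z : ℂ) :
    cexp (2 * π * I * ((1 : ℕ) * (τ + 2 * z))) * thetaComponent s τ (z + τ) = thetaComponent s τ z := by
  have h := jacobiTheta₂_add_left' (2 * z + s * τ) (2 * τ)
  rw [thetaComponent, thetaComponent, show 2 * (z + (τ : ℂ)) + s * τ = 2 * z + s * τ + 2 * τ by ring, h,
    ← mul_assoc, ← mul_assoc, ← Complex.exp_add, ← Complex.exp_add]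
  congr 2
  push_cast
  ring

theorem thetaComponent_neg {s : ℕ} (hs : s ≤ 1) (τ : ℍ) (z : ℂ) :
    thetaComponent s τ (-z) = thetaComponent s τ z := by
  refine (hasSum_thetaComponent s τ (-z)).unique ?_
  have h := (Equiv.subLeft (-s : ℤ)).hasSum_iff.mpr (hasSum_thetaComponent s τ z)
  refine h.congr_fun fun l => ?_
  simp only [Function.comp, Equiv.subLeft_apply]
  have : (s : ℂ) * s = s := by interval_cases s <;> norm_num
  congr 1
  push_cast
  ring

theorem integral_cexp_int (n : ℤ) : ∫ x in (0 : ℝ)..1, cexp (2 * π * I * (n * x)) = if n = 0 then 1 else 0 := by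
  split_ifs with h
  · simp [h]
  · have hc : (2 * π * I * n : ℂ) ≠ 0 := mul_ne_zero two_pi_I_ne_zero (by exact_mod_cast h)
    have := integral_exp_mul_complex (a := 0) (b := 1) hc
    simp only [mul_assoc] at this ⊢
    rw [this]
    have e : cexp (2 * (π * (I * (n * ((1 : ℝ) : ℂ))))) = 1 :=
      Complex.exp_eq_one_iff.mpr ⟨n, by push_cast; ring⟩
    rw [e]
    simp

theorem fourierInt_add {f g : ℂ → ℂ} (hf : Continuous f) (hg : Continuous g) (r : ℤ) :
    fourierInt (fun z => f z + g z) r = fourierInt f r + fourierInt g r := by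
  simp only [fourierInt, add_mul]
  exact intervalIntegral.integral_add (Continuous.intervalIntegrable (by fun_prop) _ _)
    (Continuous.intervalIntegrable (by fun_prop) _ _)

theorem fourierInt_const_mul (a : ℂ) (f : ℂ → ℂ) (r : ℤ) :
    fourierInt (fun z => a * f z) r = a * fourierInt f r := by
  simp only [fourierInt, mul_assoc, intervalIntegral.integral_const_mul]

/-- Termwise integration, dominated by the constants `‖c i‖`, and orthogonality of the exponentials.
-/
theorem hasSum_fourierInt {ι : Type*} [Countable ι] {c : ι → ℂ} {r : ι → ℤ} {f : ℂ → ℂ}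
    (hc : Summable fun i => ‖c i‖)
    (h : ∀ x : ℝ, HasSum (fun i => c i * cexp (2 * π * I * (r i * x))) (f x)) (s : ℤ) :
    HasSum (fun i => if r i = s then c i else 0) (fourierInt f s) := by
  have hb : ∀ (n : ℤ) (x : ℝ), ‖cexp (2 * π * I * (n * x))‖ = 1 := fun n x => by
    rw [Complex.norm_exp]
    simp
  have key := intervalIntegral.hasSum_integral_of_dominated_convergence (a := 0) (b := 1)
    (μ := MeasureTheory.volume)
    (F := fun i (x : ℝ) => c i * cexp (2 * π * I * (r i * x)) * cexp (-(2 * π * I * (s * x))))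
    (f := fun x : ℝ => f x * cexp (-(2 * π * I * (s * x)))) (fun i _ => ‖c i‖) ?_ ?_ ?_ ?_ ?_
  · refine key.congr_fun fun i => ?_
    have : ∀ x : ℝ, c i * cexp (2 * π * I * (r i * x)) * cexp (-(2 * π * I * (s * x))) =
        c i * cexp (2 * π * I * ((r i - s : ℤ) * x)) := fun x => by
      rw [mul_assoc, ← Complex.exp_add]
      congr 2
      push_cast
      ring
    simp only [this, intervalIntegral.integral_const_mul, integral_cexp_int, sub_eq_zero]
    split_ifs <;> simp
  · exact fun i => Continuous.aestronglyMeasurable (by fun_prop)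
  · refine fun i => Eventually.of_forall fun x _ => ?_
    have h2 := hb (-s) x
    rw [norm_mul, norm_mul, hb]
    push_cast at h2
    rw [show -(2 * π * I * (s * x)) = 2 * π * I * (-(s : ℂ) * x) by ring, h2]
    simp
  · exact Eventually.of_forall fun x _ => hc
  · exact intervalIntegrable_const
  · exact Eventually.of_forall fun x _ => (h x).mul_right _

/-- The frequencies `s + 2l` have the parity of `s`, so among `0` and `1` only `s` itself occurs,
once, for `l = 0`. -/
theorem fourierInt_thetaComponent (s : ℕ) (τ : ℍ) {t : ℕ} (hs : s ≤ 1) (ht : t ≤ 1) :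
    fourierInt (thetaComponent s τ) t = if s = t then 1 else 0 := by
  have hsum := (hasSum_thetaComponent s τ 0).summable.norm
  have key := hasSum_fourierInt (c := fun l : ℤ => cexp (2 * π * I * ((l ^ 2 + s * l : ℤ) * (τ : ℂ))))
    (r := fun l => s + 2 * l) (f := thetaComponent s τ) (by simpa using hsum) (fun x => by
      refine (hasSum_thetaComponent s τ x).congr_fun fun l => ?_
      rw [← Complex.exp_add]
      congr 1
      ring) t
  refine key.unique ?_
  split_ifs with h
  · subst h
    refine (hasSum_ite_eq (0 : ℤ) (1 : ℂ)).congr_fun fun l => ?_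
    by_cases hl : l = 0
    · simp [hl]
    · simp [hl]
  · refine hasSum_zero.congr_fun fun l => if_neg ?_
    omega

/-! ### Theta decomposition in index one, and membership of `A` and `B`. -/

namespace IsJacobiCovariant

variable {k : ℤ} {m : ℕ} {Φ : ℍ × ℂ → ℂ}

theorem apply_add_one (h : IsJacobiCovariant k m Φ) (τ : ℍ) (z : ℂ) : Φ (τ, z + 1) = Φ (τ, z) := by
  simpa [ellipticSlash] using congrFun (h.elliptic 0 1) (τ, z)

theorem apply_add_period (h : IsJacobiCovariant k m Φ) (τ : ℍ) (z : ℂ) :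
    cexp (2 * π * I * (m * (τ + 2 * z))) * Φ (τ, z + τ) = Φ (τ, z) := by
  simpa [ellipticSlash] using congrFun (h.elliptic 1 0) (τ, z)

/-- The difference of the two sides is an even theta function of degree 1 whose Fourier coefficients
of index `0` and `1` vanish. -/
theorem eq_theta_sum (h : IsJacobiCovariant k 1 Φ) (hk : Even k) (τ : ℍ) (z : ℂ) :
    Φ (τ, z) = fourierInt (fun z => Φ (τ, z)) (0 : ℕ) * thetaComponent 0 τ z +
      fourierInt (fun z => Φ (τ, z)) (1 : ℕ) * thetaComponent 1 τ z := by
  set a := fourierInt (fun z => Φ (τ, z)) (0 : ℕ)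
  set b := fourierInt (fun z => Φ (τ, z)) (1 : ℕ)
  have hd0 := differentiable_thetaComponent 0 τ
  have hd1 := differentiable_thetaComponent 1 τ
  have hd := h.differentiable τ
  have key := eq_zero_of_theta (m := 1) le_rfl (τ := τ)
    (f := fun z => Φ (τ, z) + ((-a) * thetaComponent 0 τ z + (-b) * thetaComponent 1 τ z))
    (hd.add ((hd0.const_mul _).add (hd1.const_mul _))) (fun z => ?_) (fun z => ?_) (fun z => ?_)
    (fun r hr => ?_)
  · have := congrFun key z
    simp only [Pi.zero_apply] at this
    linear_combination this
  · simp only [h.apply_add_one, thetaComponent_add_one]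
  · have e := h.apply_add_period τ z
    have e0 := thetaComponent_add_period 0 τ z
    have e1 := thetaComponent_add_period 1 τ z
    linear_combination e - a * e0 - b * e1
  · simp only [h.even hk, thetaComponent_neg zero_le_one, thetaComponent_neg le_rfl]
  · rw [fourierInt_add (f := fun z => Φ (τ, z))
        (g := fun z => (-a) * thetaComponent 0 τ z + (-b) * thetaComponent 1 τ z) hd.continuous ((hd0.continuous.const_mul _).add (hd1.continuous.const_mul _)),
      fourierInt_add (hd0.continuous.const_mul _) (hd1.continuous.const_mul _), fourierInt_const_mul,
      fourierInt_const_mul, fourierInt_thetaComponent 0 τ zero_le_one hr,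
      fourierInt_thetaComponent 1 τ le_rfl hr]
    interval_cases r
    · simp [a]
    · simp [b]

theorem mdifferentiable_fourierInt (h : IsJacobiCovariant k m Φ) (r : ℤ) :
    MDiff fun τ => fourierInt (fun z => Φ (τ, z)) r := by
  rw [UpperHalfPlane.mdifferentiable_iff]
  refine differentiableOn_intervalIntegral (U := {w : ℂ | 0 < w.im}) (a := 0) (b := 1)
    (G := fun w t => Φ (ofComplex w, t) * cexp (-(2 * π * I * (r * t))))
    (isOpen_lt continuous_const continuous_im) ?_ ?_
  · refine ContinuousOn.mul ?_ (Continuous.continuousOn (by fun_prop))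
    exact h.holomorphic.continuousOn.comp (f := fun p : ℂ × ℝ => (p.1, (p.2 : ℂ)))
      (by fun_prop) fun p hp => hp.1
  · intro t _
    refine DifferentiableOn.mul_const ?_ _
    exact h.holomorphic.comp (f := fun w : ℂ => (w, (t : ℂ))) (by fun_prop) fun w hw => hw

theorem apply_T_smul (h : IsJacobiCovariant k m Φ) (τ : ℍ) (z : ℂ) : Φ ((1 : ℝ) +ᵥ τ, z) = Φ (τ, z) := by
  have e := h.modular_apply ModularGroup.T τ z
  rw [show ModularGroup.T • τ = (1 : ℝ) +ᵥ τ from modular_T_smul τ] at e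
  simpa [ModularGroup.T] using e

end IsJacobiCovariant

theorem norm_fourierInt_le {f : ℂ → ℂ} {C : ℝ} (r : ℤ) (h : ∀ x : ℝ, ‖f x‖ ≤ C) : ‖fourierInt f r‖ ≤ C := by
  have := intervalIntegral.norm_integral_le_of_norm_le_const (a := 0) (b := 1) (C := C)
    (f := fun x : ℝ => f x * cexp (-(2 * π * I * (r * x)))) fun x _ => by
      rw [norm_mul, Complex.norm_exp]
      simpa using h x
  simpa [fourierInt] using this

theorem isZeroAtImInfty_fourierInt {Φ : ℍ × ℂ → ℂ} (h : Tendsto Φ (cuspFilter 1) (𝓝 0)) (r : ℤ) :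
    IsZeroAtImInfty fun τ => fourierInt (fun z => Φ (τ, z)) r := by
  change Tendsto _ atImInfty (𝓝 0)
  rw [Metric.tendsto_nhds] at h ⊢
  intro ε hε
  have := h (ε / 2) (half_pos hε)
  rw [cuspFilter, eventually_inf_principal, eventually_comap] at this
  have h2 : ∀ᶠ τ in atImInfty, ∀ p : ℍ × ℂ, p.1.im = τ.im → p ∈ {p : ℍ × ℂ | |p.2.im| ≤ 1} →
      dist (Φ p) 0 < ε / 2 := tendsto_comap.eventually this
  filter_upwards [h2] with τ hτ
  rw [dist_zero_right]
  refine (norm_fourierInt_le r fun x => ?_).trans_lt (half_lt_self hε)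
  have := hτ (τ, x) rfl (by simp)
  rw [dist_zero_right] at this
  exact this.le

theorem periodic_comp_ofComplex_of_vadd {f : ℍ → ℂ} (h : ∀ τ : ℍ, f ((1 : ℝ) +ᵥ τ) = f τ) :
    Function.Periodic (f ∘ ofComplex) ((1 : ℝ) : ℂ) := by
  intro w
  rcases lt_or_ge 0 w.im with hw | hw
  · have hw' : 0 < (w + (1 : ℝ)).im := by simpa using hw
    rw [Function.comp_apply, Function.comp_apply, ofComplex_apply_of_im_pos hw,
      ofComplex_apply_of_im_pos hw', ← h ⟨w, hw⟩]
    congr 1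
    ext1
    rw [UpperHalfPlane.coe_vadd]
    exact add_comm _ _
  · have hw' : (w + (1 : ℝ)).im ≤ 0 := by simpa using hw
    rw [Function.comp_apply, Function.comp_apply, ofComplex_apply_of_im_nonpos hw,
      ofComplex_apply_of_im_nonpos hw']

/-- An index one function is a weak Jacobi form if its product with `Δ` vanishes at the cusp. -/
theorem IsJacobiCovariant.mem_weakJacobi_of_tendsto {k l : ℤ} {Φ Ψ : ℍ × ℂ → ℂ} (hk : Even k)
    (hΦ : IsJacobiCovariant k 1 Φ) (hΨ : IsJacobiCovariant l 1 Ψ)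
    (he : ∀ p, Ψ p = modularDelta p.1 * Φ p) (h0 : Tendsto Ψ (cuspFilter 1) (𝓝 0)) :
    Φ ∈ weakJacobi k 1 := by
  have hexp : ∀ r : ℤ, HasJacobiExpansion 0 fun p => fourierInt (fun z => Φ (p.1, z)) r := fun r => by
    set f := fun τ => fourierInt (fun z => Φ (τ, z)) r with hf
    set g := fun τ => fourierInt (fun z => Ψ (τ, z)) r with hg
    have hgf : ∀ τ, g τ = modularDelta τ * f τ := fun τ => by
      simp only [hf, hg, he, fourierInt_const_mul]
    have hper : ∀ {k : ℤ} {Φ : ℍ × ℂ → ℂ}, IsJacobiCovariant k 1 Φ → Function.Periodic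
        ((fun τ => fourierInt (fun z => Φ (τ, z)) r) ∘ ofComplex) (1 : ℝ) := fun {k} {Φ} h => by
      refine periodic_comp_ofComplex_of_vadd fun τ => ?_
      simp only [h.apply_T_smul]
    have hz := isZeroAtImInfty_fourierInt h0 r
    -- A function of period 1 that vanishes at the cusp decays like `exp(-2π Im τ)`, which is the
    -- exact size of `Δ`; so division by `Δ` leaves a bounded function with an expansion in
    -- nonnegative powers of `q`.
    have hO : g =O[atImInfty] modularDelta := by
      have h1 := hz.exp_decay_atImInfty one_pos (hper hΨ) (hΨ.mdifferentiable_fourierInt r) hz.isBoundedAtImInfty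
      have h2 := ModularForm.exp_isBigO_discriminant
      rw [funext modularDelta_eq]
      exact h1.trans (by simpa using h2)
    have hbdd : IsBoundedAtImInfty f := by
      change f =O[atImInfty] (1 : ℍ → ℝ)
      have h3 := hO.mul (Asymptotics.isBigO_refl (fun τ => (modularDelta τ)⁻¹) atImInfty)
      have h4 : (fun τ => g τ * (modularDelta τ)⁻¹) = f := funext fun τ => by
        rw [hgf]; field_simp [modularDelta_ne_zero τ]
      have h5 : (fun τ => modularDelta τ * (modularDelta τ)⁻¹) = fun _ => (1 : ℂ) := funext fun τ =>
        mul_inv_cancel₀ (modularDelta_ne_zero τ)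
      rw [h4, h5] at h3
      exact h3.trans (Asymptotics.isBigO_const_const _ one_ne_zero _)
    refine hasJacobiExpansion_of_hasSum (f := f) (a := fun n => (qExpansion 1 f).coeff n) fun τ => ?_
    have := UpperHalfPlane.hasSum_qExpansion one_pos (hper hΦ) (hΦ.mdifferentiable_fourierInt r) hbdd τ
    refine this.congr_fun fun n => ?_
    rw [smul_eq_mul, Function.Periodic.qParam, ← Complex.exp_nat_mul]
    congr 2
    push_cast
    ring
  refine ⟨hΦ.holomorphic, hΦ.modular, hΦ.elliptic, ?_⟩
  -- The theta decomposition multiplies expansions of index `0` and index `1`, which keeps the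
  -- condition on `(n, r)`.
  have h := ((hexp (0 : ℕ)).mul (hasJacobiExpansion_thetaComponent zero_le_one)).add
    ((hexp (1 : ℕ)).mul (hasJacobiExpansion_thetaComponent le_rfl))
  have e : Φ = _ := funext fun p => hΦ.eq_theta_sum hk p.1 p.2
  rw [← e] at h
  exact h

theorem tendsto_modular_cuspFilter {f : ℍ → ℂ} {a : ℂ} (h : Tendsto f atImInfty (𝓝 a)) (D : ℝ) :
    Tendsto (fun p : ℍ × ℂ => f p.1) (cuspFilter D) (𝓝 a) :=
  h.comp (tendsto_comap_iff.mpr (tendsto_im_cuspFilter D))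

/-- All four factors tend to `1` at the cusp, so the constant terms cancel; this is what permits the
division by `Δ`. -/
theorem tendsto_jacobiPhi10 : Tendsto jacobiPhi10 (cuspFilter 1) (𝓝 0) := by
  have h := (((tendsto_modular_cuspFilter tendsto_E₆ 1).mul
    (tendsto_jacobiEisenstein_cuspFilter (k := 4) le_rfl (by decide) 1)).sub
    ((tendsto_modular_cuspFilter tendsto_E₄ 1).mul
    (tendsto_jacobiEisenstein_cuspFilter (k := 6) (by norm_num) (by decide) 1))).const_mul (1 / 144)
  rwa [sub_self, mul_zero] at h

theorem tendsto_jacobiPhi12 : Tendsto jacobiPhi12 (cuspFilter 1) (𝓝 0) := by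
  have h := ((((tendsto_modular_cuspFilter tendsto_E₄ 1).pow 2).mul
    (tendsto_jacobiEisenstein_cuspFilter (k := 4) le_rfl (by decide) 1)).sub
    ((tendsto_modular_cuspFilter tendsto_E₆ 1).mul
    (tendsto_jacobiEisenstein_cuspFilter (k := 6) (by norm_num) (by decide) 1))).const_mul (1 / 144)
  rwa [one_pow, sub_self, mul_zero] at h

theorem jacobiA_mem_weakJacobi : jacobiA ∈ weakJacobi (-2) 1 :=
  isJacobiCovariant_jacobiA.mem_weakJacobi_of_tendsto (by decide) isJacobiCovariant_jacobiPhi10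
    (fun p => (mul_div_cancel₀ _ (modularDelta_ne_zero p.1)).symm) tendsto_jacobiPhi10

theorem jacobiB_mem_weakJacobi : jacobiB ∈ weakJacobi 0 1 :=
  isJacobiCovariant_jacobiB.mem_weakJacobi_of_tendsto (by decide) isJacobiCovariant_jacobiPhi12
    (fun p => (mul_div_cancel₀ _ (modularDelta_ne_zero p.1)).symm) tendsto_jacobiPhi12

/-! ### The structure of the algebra of weak Jacobi forms of even weight -/

theorem taylorCoeff_pow_mul_of_lt {g : ℂ → ℂ} (hg : Differentiable ℂ g) {i n : ℕ} (h : i < n) :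
    taylorCoeff i (fun z => z ^ n * g z) = 0 := by
  have e : (fun z => z ^ n * g z) = fun z => z ^ i * (z ^ (n - i) * g z) := by
    funext z
    rw [← mul_assoc, ← pow_add, Nat.add_sub_cancel' h.le]
  rw [e, taylorCoeff_pow_mul (by fun_prop), zero_pow (Nat.sub_ne_zero_of_lt h), zero_mul]

theorem taylorCoeff_sum {ι : Type*} (s : Finset ι) {f : ι → ℂ → ℂ} (hf : ∀ i, Continuous (f i)) (n : ℕ) :
    taylorCoeff n (fun z => ∑ i ∈ s, f i z) = ∑ i ∈ s, taylorCoeff n (f i) := by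
  classical
  induction s using Finset.induction_on with
  | empty => simpa using taylorCoeff_const 0 n
  | insert a s ha ih =>
    simp only [Finset.sum_insert ha]
    rw [taylorCoeff_add (hf a) (continuous_finsetSum _ fun i _ => hf i), ih]

theorem fourierInt_sum {ι : Type*} (s : Finset ι) {f : ι → ℂ → ℂ} (hf : ∀ i, Continuous (f i)) (r : ℤ) :
    fourierInt (fun z => ∑ i ∈ s, f i z) r = ∑ i ∈ s, fourierInt (f i) r := by
  classical
  induction s using Finset.induction_on with
  | empty => simp [fourierInt]
  | insert a s ha ih =>
    simp only [Finset.sum_insert ha]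
    rw [fourierInt_add (hf a) (continuous_finsetSum _ fun i _ => hf i), ih]

/-- After division by the odd power `z ^ n` the quotient is odd, so it vanishes at `0`. -/
theorem taylorCoeff_eq_zero_of_even {f : ℂ → ℂ} (hf : Differentiable ℂ f) (he : ∀ z, f (-z) = f z)
    {n : ℕ} (hn : Odd n) (h : ∀ i < n, taylorCoeff i f = 0) : taylorCoeff n f = 0 := by
  obtain ⟨g, hg, rfl⟩ := exists_eq_pow_mul hf n h
  rw [taylorCoeff_pow_mul hg]
  have hc : Continuous g := hg.continuous
  have := congrFun (Continuous.ext_on (dense_compl_singleton (0 : ℂ)) (f := fun z => g (-z) + g z)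
    (g := fun _ => 0) (by fun_prop) (by fun_prop) fun z hz => by
      have h1 := he z
      simp only [hn.neg_pow] at h1
      have h2 : z ^ n ≠ 0 := pow_ne_zero n hz
      refine mul_left_cancel₀ h2 ?_
      linear_combination -h1) 0
  simp only [neg_zero] at this
  linear_combination this / 2

theorem jacobiA_pow_mul_jacobiB_pow_mem (i j : ℕ) :
    (fun p => jacobiA p ^ i * jacobiB p ^ j) ∈ weakJacobi (-2 * i) (i + j) := by
  have hA : ∀ i : ℕ, (fun p => jacobiA p ^ i) ∈ weakJacobi (-2 * i) i := fun i => by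
    induction i with
    | zero => simpa using const_mem_weakJacobi 1
    | succ i ih =>
      have := weakJacobi_mul ih jacobiA_mem_weakJacobi
      rw [show (-2 * (i : ℤ) + -2) = -2 * ((i + 1 : ℕ) : ℤ) by push_cast; ring] at this
      exact this
  have hB : ∀ j : ℕ, (fun p => jacobiB p ^ j) ∈ weakJacobi 0 j := fun j => by
    induction j with
    | zero => simpa using const_mem_weakJacobi 1
    | succ j ih => exact weakJacobi_mul ih jacobiB_mem_weakJacobi
  have := weakJacobi_mul (hA i) (hB j)
  rwa [add_zero] at this

/-- Near `z = 0`, the product `A ^ i * B ^ j` is `z ^ (2i)` times a nonvanishing function. -/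
theorem exists_jacobiA_pow_mul_jacobiB_pow_eq (τ : ℍ) (i j : ℕ) : ∃ g : ℂ → ℂ, Differentiable ℂ g ∧
    g 0 = ((2 * π * I) ^ 2) ^ i * 12 ^ j ∧
    (fun z => jacobiA (τ, z) ^ i * jacobiB (τ, z) ^ j) = fun z => z ^ (2 * i) * g z := by
  obtain ⟨a, ha, ha0, ha'⟩ := isJacobiCovariant_jacobiA.exists_eq_add_sq_mul (by decide) τ
  have hb := isJacobiCovariant_jacobiB.differentiable τ
  refine ⟨fun z => a z ^ i * jacobiB (τ, z) ^ j, (ha.pow i).mul (hb.pow j), ?_, funext fun z => ?_⟩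
  · simp only [ha0, taylorCoeff_two_jacobiA, jacobiB_zero]
  · rw [ha' z, jacobiA_zero, zero_add, mul_pow, ← pow_mul, mul_assoc]

/-- The product `A ^ i * B ^ (m - i)` at fixed `τ`. -/
noncomputable def jacobiBasis (m : ℕ) (τ : ℍ) (i : ℕ) (z : ℂ) : ℂ :=
  jacobiA (τ, z) ^ i * jacobiB (τ, z) ^ (m - i)

theorem differentiable_jacobiBasis (m : ℕ) (τ : ℍ) (i : ℕ) : Differentiable ℂ (jacobiBasis m τ i) :=
  ((isJacobiCovariant_jacobiA.differentiable τ).pow i).mul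
    ((isJacobiCovariant_jacobiB.differentiable τ).pow (m - i))

theorem taylorCoeff_jacobiBasis_of_lt (m : ℕ) (τ : ℍ) {i n : ℕ} (h : n < 2 * i) :
    taylorCoeff n (jacobiBasis m τ i) = 0 := by
  obtain ⟨g, hg, -, e⟩ := exists_jacobiA_pow_mul_jacobiB_pow_eq τ i (m - i)
  rw [show jacobiBasis m τ i = _ from e, taylorCoeff_pow_mul_of_lt hg h]

theorem taylorCoeff_jacobiBasis_self (m : ℕ) (τ : ℍ) (i : ℕ) :
    taylorCoeff (2 * i) (jacobiBasis m τ i) = ((2 * π * I) ^ 2) ^ i * 12 ^ (m - i) := by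
  obtain ⟨g, hg, g0, e⟩ := exists_jacobiA_pow_mul_jacobiB_pow_eq τ i (m - i)
  rw [show jacobiBasis m τ i = _ from e, taylorCoeff_pow_mul hg, g0]

theorem jacobiBasis_const_ne_zero (m i : ℕ) : ((2 * π * I : ℂ) ^ 2) ^ i * 12 ^ (m - i) ≠ 0 :=
  mul_ne_zero (pow_ne_zero _ (pow_ne_zero _ two_pi_I_ne_zero)) (pow_ne_zero _ (by norm_num))

/-- The system is triangular: `A^i B^(m-i)` vanishes at `z = 0` to order exactly `2i`. -/
theorem eq_zero_of_sum_jacobiBasis {m : ℕ} {τ : ℍ} {c : Fin (m + 1) → ℂ}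
    (h : ∀ n ≤ 2 * m, taylorCoeff n (fun z => ∑ i, c i * jacobiBasis m τ i z) = 0) : c = 0 := by
  have key : ∀ n : ℕ, ∀ i : Fin (m + 1), (i : ℕ) = n → c i = 0 := by
    intro n
    induction n using Nat.strong_induction_on with
    | _ n ih =>
      intro i hi
      have h1 := h (2 * n) (by have := i.2; omega)
      rw [taylorCoeff_sum (f := fun i z => c i * jacobiBasis m τ i z) _
          fun i => ((differentiable_jacobiBasis m τ i).const_mul (c i)).continuous,
        Finset.sum_eq_single i] at h1
      · rw [taylorCoeff_const_mul, ← hi, taylorCoeff_jacobiBasis_self] at h1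
        exact (mul_eq_zero.mp h1).resolve_right (jacobiBasis_const_ne_zero m i)
      · intro j _ hj
        rw [taylorCoeff_const_mul]
        rcases lt_trichotomy (j : ℕ) n with hlt | heq | hgt
        · rw [ih j hlt j rfl, zero_mul]
        · exact absurd (Fin.ext (heq.trans hi.symm)) hj
        · rw [taylorCoeff_jacobiBasis_of_lt m τ (by omega), mul_zero]
      · simp
  exact funext fun i => key i i rfl

namespace IsJacobiCovariant

variable {k : ℤ} {m : ℕ} {Φ : ℍ × ℂ → ℂ}

theorem eq_sum_jacobiBasis_of_fourierInt (h : IsJacobiCovariant k m Φ) (hk : Even k) (hm : 1 ≤ m) (τ : ℍ)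
    (c : Fin (m + 1) → ℂ) (hc : ∀ r : ℕ, r ≤ m → fourierInt (fun z => Φ (τ, z)) r =
      ∑ i, c i * fourierInt (jacobiBasis m τ i) r) (z : ℂ) :
    Φ (τ, z) = ∑ i, c i * jacobiBasis m τ i z := by
  have hd := h.differentiable τ
  have hdi : ∀ i : Fin (m + 1), Differentiable ℂ fun z => c i * jacobiBasis m τ i z := fun i =>
    (differentiable_jacobiBasis m τ i).const_mul (c i)
  have hds : Differentiable ℂ fun z => ∑ i, c i * jacobiBasis m τ i z := by fun_prop
  have hcov : ∀ i : Fin (m + 1), IsJacobiCovariant (-2 * i) m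
      fun p => jacobiA p ^ (i : ℕ) * jacobiB p ^ (m - i) := fun i => by
    have := (jacobiA_pow_mul_jacobiB_pow_mem i (m - i))
    rw [Nat.add_sub_cancel' (Nat.lt_succ_iff.mp i.2)] at this
    exact IsWeakJacobiForm.isJacobiCovariant this
  have key := eq_zero_of_theta hm (τ := τ) (f := fun z => Φ (τ, z) + (-1) * ∑ i, c i * jacobiBasis m τ i z)
    (hd.add (hds.const_mul _)) (fun z => ?_) (fun z => ?_) (fun z => ?_) (fun r hr => ?_)
  · have := congrFun key z
    simp only [Pi.zero_apply] at this
    linear_combination this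
  · simp only [h.apply_add_one, jacobiBasis, isJacobiCovariant_jacobiA.apply_add_one,
      isJacobiCovariant_jacobiB.apply_add_one]
  · rw [mul_add, h.apply_add_period, mul_left_comm, Finset.mul_sum]
    congr 2
    refine Finset.sum_congr rfl fun i _ => ?_
    have := (hcov i).apply_add_period τ z
    simp only [jacobiBasis]
    rw [← this]
    ring
  · simp only [h.even hk, jacobiBasis, isJacobiCovariant_jacobiA.even (by decide),
      isJacobiCovariant_jacobiB.even (by decide)]
  · rw [fourierInt_add (f := fun z => Φ (τ, z)) (g := fun z => (-1) * ∑ i, c i * jacobiBasis m τ i z)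
      hd.continuous (hds.const_mul _).continuous, fourierInt_const_mul,
      fourierInt_sum _ fun i => (hdi i).continuous, hc r hr]
    simp only [fourierInt_const_mul]
    ring

/-- A dimension count. The map `T` from coefficients of the `m + 1` products `A^i B^(m-i)` to the
Fourier coefficients of index `0, …, m` is injective, hence surjective. So `Φ(τ, ·)` is a
combination of these products, and its Taylor coefficients up to `2m` determine it. -/
theorem eq_zero_of_taylorCoeff (h : IsJacobiCovariant k m Φ) (hk : Even k) (hm : 1 ≤ m) (τ : ℍ)
    (h0 : ∀ n ≤ 2 * m, taylorCoeff n (fun z => Φ (τ, z)) = 0) (z : ℂ) : Φ (τ, z) = 0 := by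
  let T : (Fin (m + 1) → ℂ) →ₗ[ℂ] (Fin (m + 1) → ℂ) := Matrix.mulVecLin
    (Matrix.of fun r i : Fin (m + 1) => fourierInt (jacobiBasis m τ i) (r : ℕ))
  have hT : ∀ c r, T c r = ∑ i, c i * fourierInt (jacobiBasis m τ i) ((r : ℕ) : ℤ) := fun c r => by
    simp [T, Matrix.mulVec, dotProduct, mul_comm]
  have hinj : Function.Injective T := by
    rw [injective_iff_map_eq_zero]
    intro c hc
    refine eq_zero_of_sum_jacobiBasis (m := m) (τ := τ) fun n _ => ?_
    -- A combination in the kernel of `T` has the Fourier coefficients of the zero form, so it is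
    -- identically zero in `z`.
    have hz : IsJacobiCovariant 0 m (fun _ => 0) := (weakJacobi 0 m).zero_mem.isJacobiCovariant
    have := hz.eq_sum_jacobiBasis_of_fourierInt Even.zero hm τ c fun r hr => by
      have := congrFun hc ⟨r, Nat.lt_succ_of_le hr⟩
      rw [hT] at this
      rw [this]
      simp [fourierInt]
    simp only [← this]
    simpa using taylorCoeff_const 0 n
  obtain ⟨c, hc⟩ := (LinearMap.injective_iff_surjective.mp hinj)
    fun r => fourierInt (fun z => Φ (τ, z)) ((r : ℕ) : ℤ)
  have e := h.eq_sum_jacobiBasis_of_fourierInt hk hm τ c fun r hr => by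
    have := congrFun hc ⟨r, Nat.lt_succ_of_le hr⟩
    rw [hT] at this
    exact this.symm
  have hc0 := eq_zero_of_sum_jacobiBasis (m := m) (τ := τ) (c := c) fun n hn => by
    simp only [← e]
    exact h0 n hn
  rw [e, hc0]
  simp

end IsJacobiCovariant

/-- For `Im τ ≥ 1` and `|z| ≤ 1` each term is dominated by its size at `τ = i` and `z = i` or `z =
-i`, according to the sign of `r`. -/
theorem HasJacobiExpansion.exists_bound {m : ℕ} {Φ : ℍ × ℂ → ℂ} (h : HasJacobiExpansion m Φ) :
    ∃ C, ∀ (τ : ℍ) (z : ℂ), 1 ≤ τ.im → ‖z‖ ≤ 1 → ‖Φ (τ, z)‖ ≤ C := by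
  obtain ⟨c, -, hs⟩ := h
  obtain ⟨C, hC⟩ := (hs UpperHalfPlane.I I).summable.norm.add (hs UpperHalfPlane.I (-I)).summable.norm
  refine ⟨C, fun τ z hτ hz => ?_⟩
  rw [← (hs τ z).tsum_eq]
  refine tsum_of_norm_bounded hC fun i => ?_
  obtain ⟨n, r⟩ := i
  have hn : ∀ (w v : ℂ), ‖cexp (2 * π * I * (n * w + r * v))‖ =
      Real.exp (-(2 * π * (n * w.im)) - 2 * π * (r * v.im)) := fun w v => by
    rw [Complex.norm_exp]
    congr 1
    simp [mul_re, mul_im]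
    ring
  simp only [norm_mul, hn, ← mul_add]
  refine mul_le_mul_of_nonneg_left ?_ (norm_nonneg _)
  have hzi : |z.im| ≤ 1 := (abs_im_le_norm z).trans hz
  have hπ := Real.pi_pos
  have a1 : -(2 * π * (n * τ.im)) ≤ -(2 * π * n) := by
    have : (0 : ℝ) ≤ n := n.cast_nonneg
    have : (n : ℝ) * 1 ≤ n * τ.im := by gcongr
    have : 2 * π * (n * 1) ≤ 2 * π * (n * τ.im) := by gcongr
    linarith
  have a2 : -(2 * π * (r * z.im)) ≤ 2 * π * |(r : ℝ)| := by
    have : |(r : ℝ) * z.im| ≤ |(r : ℝ)| * 1 := by rw [abs_mul]; gcongr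
    have : -(r * z.im) ≤ |(r : ℝ)| * 1 := (neg_le_abs _).trans this
    have := mul_le_mul_of_nonneg_left this (by positivity : 0 ≤ 2 * π)
    linarith
  have a3 : Real.exp (-(2 * π * (n * τ.im)) - 2 * π * (r * z.im)) ≤
      Real.exp (-(2 * π * n) + 2 * π * |(r : ℝ)|) := Real.exp_le_exp.mpr (by linarith)
  refine a3.trans ?_
  have e1 := Real.exp_pos (-(2 * π * (n * ((UpperHalfPlane.I : ℍ) : ℂ).im)) - 2 * π * (r * I.im))
  have e2 := Real.exp_pos (-(2 * π * (n * ((UpperHalfPlane.I : ℍ) : ℂ).im)) - 2 * π * (r * (-I).im))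
  rcases abs_cases (r : ℝ) with ⟨hr, -⟩ | ⟨hr, -⟩
  · refine le_trans (le_of_eq ?_) (le_add_of_nonneg_left e1.le)
    rw [hr]
    simp
  · refine le_trans (le_of_eq ?_) (le_add_of_nonneg_right e2.le)
    rw [hr]
    simp
    ring

theorem IsWeakJacobiForm.isBoundedAtImInfty_taylorCoeff {k : ℤ} {m : ℕ} {Φ : ℍ × ℂ → ℂ}
    (h : IsWeakJacobiForm k m Φ) (n : ℕ) :
    IsBoundedAtImInfty fun τ => taylorCoeff n fun z => Φ (τ, z) := by
  obtain ⟨C, hC⟩ := HasJacobiExpansion.exists_bound h.fourier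
  rw [isBoundedAtImInfty_iff]
  exact ⟨C, 1, fun τ hτ => norm_taylorCoeff_le n fun z hz => hC τ z hτ hz.le⟩

theorem IsWeakJacobiForm.eq_apply_zero {k : ℤ} {Φ : ℍ × ℂ → ℂ} (h : IsWeakJacobiForm k 0 Φ) (τ : ℍ)
    (z : ℂ) : Φ (τ, z) = Φ (τ, 0) := by
  obtain ⟨c, hc, hs⟩ := h.fourier
  refine (hs τ z).unique ((hs τ 0).congr_fun fun i => ?_)
  by_cases hr : i.2 = 0
  · simp [hr]
  · rw [hc i.1 i.2 (by simpa using by positivity), zero_mul, zero_mul]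

/-- The monomial `E₄ ^ a * E₆ ^ b * A ^ c * B ^ d`. -/
noncomputable def jacobiMonomial (a b c d : ℕ) : ℍ × ℂ → ℂ := fun p =>
  ModularForm.E₄ p.1 ^ a * ModularForm.E₆ p.1 ^ b * jacobiA p ^ c * jacobiB p ^ d

/-- The span of the monomials of weight `k` and index `m` in the generators. -/
noncomputable def jacobiSpan (k : ℤ) (m : ℕ) : Submodule ℂ (ℍ × ℂ → ℂ) :=
  Submodule.span ℂ {Φ | ∃ a b c d : ℕ, (4 * a + 6 * b - 2 * c : ℤ) = k ∧ c + d = m ∧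
    Φ = jacobiMonomial a b c d}

theorem mul_mem_jacobiSpan {k : ℤ} {m i : ℕ} (hi : i ≤ m) {f : ℍ → ℂ} (hf : f ∈ eisensteinSpan (k + 2 * i)) :
    (fun p => f p.1 * (jacobiA p ^ i * jacobiB p ^ (m - i))) ∈ jacobiSpan k m := by
  induction hf using Submodule.span_induction with
  | mem f hf =>
    obtain ⟨a, b, hab, rfl⟩ := hf
    refine Submodule.subset_span ⟨a, b, i, m - i, by linarith, by omega, funext fun p => ?_⟩
    simp only [jacobiMonomial, Pi.mul_apply, Pi.pow_apply]
    ring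
  | zero =>
    convert (jacobiSpan k m).zero_mem using 1
    funext p
    simp
  | add f g _ _ ihf ihg =>
    convert (jacobiSpan k m).add_mem ihf ihg using 1
    funext p
    simp [add_mul]
  | smul a f _ ih =>
    convert (jacobiSpan k m).smul_mem a ih using 1
    funext p
    simp [mul_assoc]

/-- Induction on `j = 2m + 1 - n`, where `n` bounds the order of vanishing at `z = 0` from below.
For even `n = 2i` the leading coefficient is a modular form `f` of weight `k + n`, and subtracting
`κ⁻¹ f A^i B^(m-i)` raises the order; for odd `n` the coefficient vanishes by evenness. At order `2m
+ 1` the form is zero. -/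
theorem IsWeakJacobiForm.mem_jacobiSpan_of_taylorCoeff {k : ℤ} (hk : Even k) {m : ℕ} (j : ℕ) :
    ∀ {n : ℕ} {Φ : ℍ × ℂ → ℂ}, n + j = 2 * m + 1 → IsWeakJacobiForm k m Φ →
      (∀ τ, ∀ i < n, taylorCoeff i (fun z => Φ (τ, z)) = 0) → Φ ∈ jacobiSpan k m := by
  induction j with
  | zero =>
    intro n Φ hn h h0
    have : Φ = 0 := by
      funext ⟨τ, z⟩
      rcases Nat.eq_zero_or_pos m with rfl | hm
      · rw [h.eq_apply_zero, ← h.isJacobiCovariant.taylorCoeff_zero τ]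
        exact h0 τ 0 (by omega)
      · exact h.isJacobiCovariant.eq_zero_of_taylorCoeff hk hm τ (fun i hi => h0 τ i (by omega)) z
    rw [this]
    exact Submodule.zero_mem _
  | succ j ih =>
    intro n Φ hn h h0
    have hcov := h.isJacobiCovariant
    rcases Nat.even_or_odd n with he | ho
    · obtain ⟨i, hi⟩ := he.exists_two_nsmul
      rw [smul_eq_mul] at hi
      have him : i ≤ m := by omega
      set κ : ℂ := ((2 * π * I) ^ 2) ^ i * 12 ^ (m - i) with hκ
      have hκ0 : κ ≠ 0 := jacobiBasis_const_ne_zero m i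
      set f : ℍ → ℂ := fun τ => taylorCoeff n fun z => Φ (τ, z) with hf
      have hinv := hcov.isModularInvariant_taylorCoeff n h0
      let F := modularFormOfInvariant hinv (hcov.mdifferentiable_taylorCoeff n)
        (h.isBoundedAtImInfty_taylorCoeff n)
      have hF : f ∈ eisensteinSpan (k + 2 * i) := by
        have e : k + 2 * (i : ℤ) = k + n := by rw [hi]; push_cast; ring
        rw [e]
        exact F.mem_eisensteinSpan
      set Ψ : ℍ × ℂ → ℂ := fun p => f p.1 * (jacobiA p ^ i * jacobiB p ^ (m - i)) with hΨ
      have hΨspan : Ψ ∈ jacobiSpan k m := mul_mem_jacobiSpan him hF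
      have hΨweak : Ψ ∈ weakJacobi k m := by
        have := weakJacobi_mul (modularLift_mem_weakJacobi F) (jacobiA_pow_mul_jacobiB_pow_mem i (m - i))
        rw [Nat.add_sub_cancel' him, zero_add, show k + (n : ℤ) + -2 * i = k by rw [hi]; push_cast; ring] at this
        exact this
      have hdiff : Φ - κ⁻¹ • Ψ ∈ weakJacobi k m := (weakJacobi k m).sub_mem h
        ((weakJacobi k m).smul_mem _ hΨweak)
      have hT : ∀ τ l, taylorCoeff l (fun z => (Φ - κ⁻¹ • Ψ) (τ, z)) = taylorCoeff l (fun z => Φ (τ, z)) +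
          (-κ⁻¹ * f τ) * taylorCoeff l (jacobiBasis m τ i) := fun τ l => by
        rw [← taylorCoeff_const_mul, ← taylorCoeff_add (hcov.differentiable τ).continuous
          ((differentiable_jacobiBasis m τ i).const_mul _).continuous]
        congr 1
        funext z
        simp only [Pi.sub_apply, Pi.smul_apply, smul_eq_mul, hΨ, jacobiBasis]
        ring
      have hmem := ih (n := n + 1) (by omega) hdiff fun τ l hl => by
        rw [hT]
        rcases Nat.lt_succ_iff_lt_or_eq.mp hl with hl | rfl
        · rw [h0 τ l hl, taylorCoeff_jacobiBasis_of_lt m τ (by omega)]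
          ring
        · change f τ + _ = 0
          rw [show taylorCoeff l (jacobiBasis m τ i) = κ by rw [hi, taylorCoeff_jacobiBasis_self]]
          field_simp
          ring
      have := (jacobiSpan k m).add_mem hmem ((jacobiSpan k m).smul_mem κ⁻¹ hΨspan)
      rwa [sub_add_cancel] at this
    · refine ih (n := n + 1) (by omega) h fun τ i hi => ?_
      rcases Nat.lt_succ_iff_lt_or_eq.mp hi with hi | rfl
      · exact h0 τ i hi
      · exact taylorCoeff_eq_zero_of_even (hcov.differentiable τ) (hcov.even hk τ) ho (h0 τ)

/-- A weak Jacobi form of even weight is a polynomial in `E₄`, `E₆`, `A`, `B`. -/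
theorem mem_jacobiSpan {k : ℤ} (hk : Even k) {m : ℕ} {Φ : ℍ × ℂ → ℂ} (h : Φ ∈ weakJacobi k m) :
    Φ ∈ jacobiSpan k m :=
  IsWeakJacobiForm.mem_jacobiSpan_of_taylorCoeff hk (2 * m + 1) (n := 0) (by omega) h (by simp)

/-! ### Algebraic independence of the generators -/

/-- A finite set without `c` is closed, so a function that tends to `c` eventually avoids it. -/
theorem Set.infinite_of_tendsto_ne {α : Type*} {l : Filter α} [l.NeBot] {t : α → ℂ} {c : ℂ} {S : Set ℂ}
    (ht : Tendsto t l (𝓝 c)) (hne : ∀ᶠ x in l, t x ≠ c) (hS : ∀ᶠ x in l, t x ∈ S) : S.Infinite := by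
  intro hfin
  have hcl : IsClosed (S \ {c}) := (hfin.subset Set.sdiff_subset).isClosed
  have h1 : ∀ᶠ x in l, t x ∉ S \ {c} :=
    ht.eventually (hcl.isOpen_compl.mem_nhds fun h => h.2 rfl)
  obtain ⟨x, hx1, hx2, hx3⟩ := (h1.and (hne.and hS)).exists
  exact hx1 ⟨hx3, hx2⟩

theorem Set.infinite_of_tendsto_norm {α : Type*} {l : Filter α} [l.NeBot] {t : α → ℂ} {S : Set ℂ}
    (ht : Tendsto (fun x => ‖t x‖) l atTop) (hS : ∀ x, t x ∈ S) : S.Infinite := by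
  intro hfin
  obtain ⟨M, hM⟩ := (hfin.image norm).bddAbove
  obtain ⟨x, hx⟩ := (ht.eventually_gt_atTop M).exists
  exact absurd (hM ⟨t x, hS x, rfl⟩) (not_le.mpr hx)

/-- A polynomial that vanishes at infinitely many points of a parametrized curve vanishes on it. -/
theorem MvPolynomial.eval_eq_zero_of_infinite {σ : Type*} (F : MvPolynomial σ ℂ) (p : σ → Polynomial ℂ)
    {S : Set ℂ} (hS : S.Infinite) (h : ∀ w ∈ S, MvPolynomial.eval (fun i => (p i).eval w) F = 0) (w : ℂ) :
    MvPolynomial.eval (fun i => (p i).eval w) F = 0 := by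
  have he : ∀ w, (MvPolynomial.aeval p F).eval w = MvPolynomial.eval (fun i => (p i).eval w) F := fun w => by
    have h1 : (Polynomial.evalRingHom w).comp (MvPolynomial.aeval p).toRingHom =
        MvPolynomial.eval fun i => (p i).eval w := by
      refine MvPolynomial.ringHom_ext (fun a => ?_) fun i => ?_ <;> simp
    exact congrArg (fun φ => φ F) h1
  have h0 : MvPolynomial.aeval p F = 0 :=
    Polynomial.eq_zero_of_infinite_isRoot _ (hS.mono fun w hw => by
      rw [Set.mem_ofPred_eq, Polynomial.IsRoot, he]
      exact h w hw)
  rw [← he, h0, Polynomial.eval_zero]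

section

variable {F : MvPolynomial (Fin 4) ℂ}

/-- Replacing `z` by `z + lτ` multiplies `A` and `B` by the same factor `t l`. These factors are
unbounded in `l`, so the relation, polynomial in the factor, holds for every `w`. -/
theorem eval_smul_eq_zero (hF : ∀ τ z, MvPolynomial.eval
    ![ModularForm.E₄ τ, ModularForm.E₆ τ, jacobiA (τ, z), jacobiB (τ, z)] F = 0) (τ : ℍ) (z w : ℂ) :
    MvPolynomial.eval
      ![ModularForm.E₄ τ, ModularForm.E₆ τ, w * jacobiA (τ, z), w * jacobiB (τ, z)] F = 0 := by
  set p : Fin 4 → Polynomial ℂ := ![Polynomial.C (ModularForm.E₄ τ), Polynomial.C (ModularForm.E₆ τ),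
    Polynomial.X * Polynomial.C (jacobiA (τ, z)), Polynomial.X * Polynomial.C (jacobiB (τ, z))] with hp
  have hev : ∀ w, (fun i => (p i).eval w) =
      ![ModularForm.E₄ τ, ModularForm.E₆ τ, w * jacobiA (τ, z), w * jacobiB (τ, z)] := fun w => by
    funext i
    fin_cases i <;> simp [hp] <;> ring
  set t : ℕ → ℂ := fun l => cexp (-(2 * π * I * (l ^ 2 * τ + 2 * l * z))) with ht
  have hinf : (Set.range t).Infinite := by
    refine Set.infinite_of_tendsto_norm (l := atTop) (t := t) ?_ fun l => ⟨l, rfl⟩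
    have hn : ∀ l : ℕ, ‖t l‖ = Real.exp (2 * π * (l * (l * τ.im + 2 * z.im))) := fun l => by
      rw [ht, Complex.norm_exp]
      congr 1
      simp [mul_re, mul_im, pow_two]
      ring
    simp only [hn]
    refine Real.tendsto_exp_atTop.comp (Tendsto.const_mul_atTop Real.two_pi_pos ?_)
    have h1 : Tendsto (fun l : ℕ => (l : ℝ)) atTop atTop := tendsto_natCast_atTop_atTop
    exact h1.atTop_mul_atTop₀ (tendsto_atTop_add_const_right _ _ (h1.atTop_mul_const τ.im_pos))
  have key := MvPolynomial.eval_eq_zero_of_infinite F p hinf ?_ w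
  · rwa [hev] at key
  · rintro _ ⟨l, rfl⟩
    rw [hev]
    have e : ∀ {k : ℤ} {Φ : ℍ × ℂ → ℂ}, IsJacobiCovariant k 1 Φ →
        t l * Φ (τ, z) = Φ (τ, z + l * τ) := fun {k Φ} h => by
      have := congrFun (h.elliptic l 0) (τ, z)
      simp only [ellipticSlash] at this
      rw [← this, ht, ← mul_assoc, ← Complex.exp_add]
      simp
    rw [e isJacobiCovariant_jacobiA, e isJacobiCovariant_jacobiB]
    exact hF τ _

/-- The matrices with bottom row `(1, d)` have the infinitely many automorphy factors `τ + d`, so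
the relation holds for every factor `j`. The weights of `A` and `B` are `-2` and `0`; the common
scale `w` absorbs `j ^ 2`, which leaves `A` fixed and gives `B` the factor `j ^ 2`. -/
theorem eval_weight_eq_zero (hF : ∀ τ z, MvPolynomial.eval
    ![ModularForm.E₄ τ, ModularForm.E₆ τ, jacobiA (τ, z), jacobiB (τ, z)] F = 0) (τ : ℍ) (z w j : ℂ) :
    MvPolynomial.eval ![j ^ 4 * ModularForm.E₄ τ, j ^ 6 * ModularForm.E₆ τ, w * jacobiA (τ, z),
      w * (j ^ 2 * jacobiB (τ, z))] F = 0 := by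
  set p : Fin 4 → Polynomial ℂ := ![Polynomial.X ^ 4 * Polynomial.C (ModularForm.E₄ τ),
    Polynomial.X ^ 6 * Polynomial.C (ModularForm.E₆ τ), Polynomial.C (w * jacobiA (τ, z)),
    Polynomial.X ^ 2 * Polynomial.C (w * jacobiB (τ, z))] with hp
  have hev : ∀ j, (fun i => (p i).eval j) = ![j ^ 4 * ModularForm.E₄ τ, j ^ 6 * ModularForm.E₆ τ,
      w * jacobiA (τ, z), w * (j ^ 2 * jacobiB (τ, z))] := fun j => by
    funext i
    fin_cases i <;> simp [hp] <;> ring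
  have hinf : (Set.range fun d : ℤ => (τ : ℂ) + d).Infinite :=
    Set.infinite_range_of_injective fun a b h => by simpa using h
  have key := MvPolynomial.eval_eq_zero_of_infinite F p hinf ?_ j
  · rwa [hev] at key
  · rintro _ ⟨d, rfl⟩
    rw [hev]
    set γ := bottomRowMatrix ⟨(1, d), isCoprime_one_left⟩
    have hJ := modular_denom_ne_zero γ τ
    have h4 := ModularForm.E₄.isModularInvariant γ τ
    have h6 := ModularForm.E₆.isModularInvariant γ τ
    have hA := isJacobiCovariant_jacobiA.modular_apply γ τ z
    have hB := isJacobiCovariant_jacobiB.modular_apply γ τ z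
    have hj : ((γ 1 0 : ℤ) : ℂ) * τ + (γ 1 1 : ℤ) = τ + d := by
      simp only [γ, bottomRowMatrix_one_zero, bottomRowMatrix_one_one]
      push_cast
      ring
    rw [hj] at h4 h6 hA hB hJ
    set J : ℂ := τ + d
    set u := cexp (-(2 * π * I * (((1 : ℕ) : ℂ) * (γ 1 0 : ℂ) * z ^ 2 / J)))
    have := eval_smul_eq_zero hF (γ • τ) (z / J) (w * J ^ 2 * u)
    have e1 : w * J ^ 2 * u * jacobiA (γ • τ, z / J) = w * jacobiA (τ, z) := by
      rw [← hA, show (-(-2 : ℤ)) = ((2 : ℕ) : ℤ) by norm_num, zpow_natCast]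
      ring
    have e2 : w * J ^ 2 * u * jacobiB (γ • τ, z / J) = w * (J ^ 2 * jacobiB (τ, z)) := by
      rw [← hB, neg_zero, zpow_zero]
      ring
    rw [e1, e2, h4, h6] at this
    exact_mod_cast this

/-- Near `z = 0` the quotient `A/B` tends to `0` without taking the value `0`, since `A` has a zero
of order exactly 2 and `B` is `12` there. -/
theorem infinite_jacobi_ratio (τ : ℍ) :
    {t : ℂ | ∃ z, jacobiB (τ, z) ≠ 0 ∧ jacobiA (τ, z) = t * jacobiB (τ, z)}.Infinite := by
  obtain ⟨g, hg, hg0, hg'⟩ := isJacobiCovariant_jacobiA.exists_eq_add_sq_mul (by decide) τ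
  have hcB := (isJacobiCovariant_jacobiB.differentiable τ).continuous
  have hcA := (isJacobiCovariant_jacobiA.differentiable τ).continuous
  have hB0 : jacobiB (τ, 0) ≠ 0 := by rw [jacobiB_zero]; norm_num
  have hB : ∀ᶠ z in 𝓝[≠] (0 : ℂ), jacobiB (τ, z) ≠ 0 :=
    (hcB.continuousAt.eventually_ne hB0).filter_mono nhdsWithin_le_nhds
  have hgne : ∀ᶠ z in 𝓝[≠] (0 : ℂ), g z ≠ 0 := by
    refine (hg.continuous.continuousAt.eventually_ne ?_).filter_mono nhdsWithin_le_nhds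
    rw [hg0, taylorCoeff_two_jacobiA]
    exact pow_ne_zero 2 two_pi_I_ne_zero
  refine Set.infinite_of_tendsto_ne (l := 𝓝[≠] (0 : ℂ)) (c := 0)
    (t := fun z => jacobiA (τ, z) / jacobiB (τ, z)) ?_ ?_ ?_
  · have := (hcA.continuousAt.div hcB.continuousAt hB0).tendsto
    rw [Pi.div_apply, jacobiA_zero, zero_div] at this
    exact this.mono_left nhdsWithin_le_nhds
  · filter_upwards [hB, hgne, self_mem_nhdsWithin] with z h1 h2 h3
    refine div_ne_zero ?_ h1
    rw [hg' z, jacobiA_zero, zero_add]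
    exact mul_ne_zero (pow_ne_zero 2 h3) h2
  · filter_upwards [hB] with z hz
    exact ⟨z, hz, (div_mul_cancel₀ _ hz).symm⟩

/-- The quotient `E₄³/E₆²` tends to `1` at the cusp but never equals `1`, because `Δ` has no zero.
-/
theorem infinite_eisenstein_ratio :
    {u : ℂ | ∃ τ, ModularForm.E₄ τ ≠ 0 ∧ ModularForm.E₆ τ ≠ 0 ∧
      ModularForm.E₄ τ ^ 3 = u * ModularForm.E₆ τ ^ 2}.Infinite := by
  have h4 := tendsto_E₄.eventually_ne (one_ne_zero (α := ℂ))
  have h6 := tendsto_E₆.eventually_ne (one_ne_zero (α := ℂ))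
  refine Set.infinite_of_tendsto_ne (l := atImInfty) (c := 1)
    (t := fun τ => ModularForm.E₄ τ ^ 3 / ModularForm.E₆ τ ^ 2) ?_ ?_ ?_
  · have := (tendsto_E₄.pow 3).div (tendsto_E₆.pow 2) (by norm_num)
    rw [one_pow, one_pow, div_one] at this
    exact this
  · filter_upwards [h6] with τ h6 h
    rw [div_eq_one_iff_eq (pow_ne_zero 2 h6)] at h
    refine modularDelta_ne_zero τ ?_
    rw [modularDelta, h, sub_self, mul_zero]
  · filter_upwards [h4, h6] with τ h4 h6
    exact ⟨τ, h4, h6, (div_mul_cancel₀ _ (pow_ne_zero 2 h6)).symm⟩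

/-- The functions `E₄`, `E₆`, `A`, `B` are algebraically independent. -/
theorem eq_zero_of_eval_generators (hF : ∀ τ z, MvPolynomial.eval
    ![ModularForm.E₄ τ, ModularForm.E₆ τ, jacobiA (τ, z), jacobiB (τ, z)] F = 0) : F = 0 := by
  have h1 : ∀ (τ : ℍ) (j w s : ℂ), j ≠ 0 → MvPolynomial.eval
      ![j ^ 4 * ModularForm.E₄ τ, j ^ 6 * ModularForm.E₆ τ, w * s, w * j ^ 2] F = 0 := by
    intro τ j w s hj
    set p : Fin 4 → Polynomial ℂ := ![Polynomial.C (j ^ 4 * ModularForm.E₄ τ),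
      Polynomial.C (j ^ 6 * ModularForm.E₆ τ), Polynomial.C w * Polynomial.X,
      Polynomial.C (w * j ^ 2)] with hp
    have hev : ∀ s, (fun i => (p i).eval s) = ![j ^ 4 * ModularForm.E₄ τ, j ^ 6 * ModularForm.E₆ τ,
        w * s, w * j ^ 2] := fun s => by
      funext i
      fin_cases i <;> simp [hp]
    rw [← hev]
    refine MvPolynomial.eval_eq_zero_of_infinite F p (infinite_jacobi_ratio τ) ?_ s
    rintro t ⟨z, hz, ht⟩
    rw [hev]
    have := eval_weight_eq_zero hF τ z (w / jacobiB (τ, z)) j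
    rw [ht] at this
    have e1 : w / jacobiB (τ, z) * (t * jacobiB (τ, z)) = w * t := by field_simp
    have e2 : w / jacobiB (τ, z) * (j ^ 2 * jacobiB (τ, z)) = w * j ^ 2 := by field_simp
    rwa [e1, e2] at this
  -- In these coordinates `u` is the ratio `E₄³/E₆²` and `v` the ratio of the second argument to the
  -- first; scaling by `j` with `j² = v E₄/E₆` realizes a prescribed `v`.
  have h2 : ∀ v : ℂ, v ≠ 0 → ∀ u w s : ℂ, w ≠ 0 →
      MvPolynomial.eval ![v ^ 2 * u, v ^ 3 * u, s, w] F = 0 := by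
    intro v hv u w s hw
    set p : Fin 4 → Polynomial ℂ := ![Polynomial.C (v ^ 2) * Polynomial.X,
      Polynomial.C (v ^ 3) * Polynomial.X, Polynomial.C s, Polynomial.C w] with hp
    have hev : ∀ u, (fun i => (p i).eval u) = ![v ^ 2 * u, v ^ 3 * u, s, w] := fun u => by
      funext i
      fin_cases i <;> simp [hp]
    rw [← hev]
    refine MvPolynomial.eval_eq_zero_of_infinite F p infinite_eisenstein_ratio ?_ u
    rintro u ⟨τ, h4, h6, hu⟩
    rw [hev]
    obtain ⟨j, hj⟩ := IsAlgClosed.exists_pow_nat_eq (v * ModularForm.E₄ τ / ModularForm.E₆ τ) two_pos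
    have hj0 : j ≠ 0 := by
      rintro rfl
      rw [zero_pow two_ne_zero, eq_comm, div_eq_zero_iff, mul_eq_zero] at hj
      tauto
    have hu' : u = ModularForm.E₄ τ ^ 3 / ModularForm.E₆ τ ^ 2 := by rw [hu]; field_simp
    have e1 : j ^ 4 * ModularForm.E₄ τ = v ^ 2 * u := by
      rw [show j ^ 4 = (j ^ 2) ^ 2 by ring, hj, hu']
      field_simp
    have e2 : j ^ 6 * ModularForm.E₆ τ = v ^ 3 * u := by
      rw [show j ^ 6 = (j ^ 2) ^ 3 by ring, hj, hu']
      field_simp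
    have := h1 τ j (w / j ^ 2) (s * j ^ 2 / w) hj0
    rwa [e1, e2, show w / j ^ 2 * (s * j ^ 2 / w) = s by field_simp,
      show w / j ^ 2 * j ^ 2 = w by field_simp] at this
  have h3 : ∀ x ∈ Set.pi Set.univ fun _ : Fin 4 => ({0}ᶜ : Set ℂ), MvPolynomial.eval x F = MvPolynomial.eval x 0 := by
    intro x hx
    have hx : ∀ i, x i ≠ 0 := fun i => hx i trivial
    -- Every point with nonzero coordinates has the form covered by `h2`, with `v = x₁/x₀` and `u =
    -- x₀³/x₁²`.
    have := h2 (x 1 / x 0) (div_ne_zero (hx 1) (hx 0)) (x 0 ^ 3 / x 1 ^ 2) (x 3) (x 2) (hx 3)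
    have e : ![(x 1 / x 0) ^ 2 * (x 0 ^ 3 / x 1 ^ 2), (x 1 / x 0) ^ 3 * (x 0 ^ 3 / x 1 ^ 2), x 2, x 3] = x := by
      have := hx 0
      have := hx 1
      funext i
      fin_cases i <;> simp <;> field_simp
    rw [e] at this
    rw [map_zero, this]
  exact MvPolynomial.funext_set _ (fun _ => (Set.finite_singleton (0 : ℂ)).infinite_compl) h3

end

/-! ### Poisson brackets on finitely generated algebras -/

/-- A skew-symmetric biderivation. -/
structure IsSkewBiderivation {R : Type*} [CommRing R] [Algebra ℂ R] (P : R →ₗ[ℂ] R →ₗ[ℂ] R) : Prop where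
  skew : ∀ f g, P f g = -P g f
  leibniz : ∀ f g h, P f (g * h) = P f g * h + g * P f h

theorem IsPoissonBracket.isSkewBiderivation {R : Type*} [CommRing R] [Algebra ℂ R]
    {P : R →ₗ[ℂ] R →ₗ[ℂ] R} (h : IsPoissonBracket P) : IsSkewBiderivation P :=
  ⟨h.skew, h.leibniz⟩

/-- The cyclic sum whose vanishing is the Jacobi identity. -/
def jacobiator {R : Type*} [CommRing R] [Algebra ℂ R] (P : R →ₗ[ℂ] R →ₗ[ℂ] R) (f g h : R) : R :=
  P f (P g h) + P g (P h f) + P h (P f g)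

namespace IsSkewBiderivation

section

variable {R : Type*} [CommRing R] [Algebra ℂ R] {P : R →ₗ[ℂ] R →ₗ[ℂ] R} (hP : IsSkewBiderivation P)
include hP

theorem apply_self (f : R) : P f f = 0 := by
  have h : (2 : ℂ) • P f f = 0 := by
    rw [two_smul]
    nth_rewrite 1 [hP.skew f f]
    exact neg_add_cancel _
  exact (smul_eq_zero_iff_right two_ne_zero).mp h

theorem apply_one (f : R) : P f 1 = 0 := by
  have h := hP.leibniz f 1 1
  simp only [mul_one, one_mul] at h
  exact left_eq_add.mp h

theorem apply_algebraMap (f : R) (a : ℂ) : P f (algebraMap ℂ R a) = 0 := by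
  rw [Algebra.algebraMap_eq_smul_one, map_smul, hP.apply_one, smul_zero]

theorem apply_sq (f g : R) : P f (g ^ 2) = 2 * g * P f g := by
  rw [pow_two, hP.leibniz]
  ring

theorem apply_cube (f g : R) : P f (g ^ 3) = 3 * g ^ 2 * P f g := by
  rw [pow_succ, hP.leibniz, hP.apply_sq]
  ring

theorem jacobiator_eq (f g h : R) : jacobiator P f g h = P f (P g h) - P g (P f h) - P (P f g) h := by
  rw [jacobiator, hP.skew h f, hP.skew h (P f g), map_neg]
  ring

theorem jacobiator_swap (f g h : R) : jacobiator P f g h = -jacobiator P g f h := by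
  rw [hP.jacobiator_eq, hP.jacobiator_eq, hP.skew g f, map_neg, LinearMap.neg_apply]
  ring

omit hP in
theorem jacobiator_cyclic (f g h : R) : jacobiator P f g h = jacobiator P g h f := by
  rw [jacobiator, jacobiator]
  ring

theorem jacobiator_self (f h : R) : jacobiator P f f h = 0 := by
  rw [hP.jacobiator_eq, hP.apply_self, map_zero, LinearMap.zero_apply]
  ring

/-- The jacobiator compares the commutator of the derivations `P f` and `P g` with the derivation `P
(P f g)`, so it is itself a derivation in the last argument. This reduces the Jacobi identity to
generators. -/
theorem jacobiator_mul (f g h h' : R) :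
    jacobiator P f g (h * h') = jacobiator P f g h * h' + h * jacobiator P f g h' := by
  simp only [hP.jacobiator_eq, hP.leibniz, map_add]
  ring

theorem jacobiator_eq_zero_right {s : Set R} (hs : Algebra.adjoin ℂ s = ⊤) {f g : R}
    (h : ∀ a ∈ s, jacobiator P f g a = 0) (k : R) : jacobiator P f g k = 0 := by
  have hk : k ∈ Algebra.adjoin ℂ s := hs ▸ Algebra.mem_top
  induction hk using Algebra.adjoin_induction with
  | mem a ha => exact h a ha
  | algebraMap a => simp only [hP.jacobiator_eq, hP.apply_algebraMap, map_zero, sub_zero]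
  | add a b _ _ iha ihb =>
    have : jacobiator P f g (a + b) = jacobiator P f g a + jacobiator P f g b := by
      simp only [hP.jacobiator_eq, map_add]
      ring
    rw [this, iha, ihb, add_zero]
  | mul a b _ _ iha ihb => rw [hP.jacobiator_mul, iha, ihb, zero_mul, mul_zero, add_zero]

/-- The Jacobi identity holds if it holds on generators. -/
theorem isPoissonBracket_of_adjoin {s : Set R} (hs : Algebra.adjoin ℂ s = ⊤)
    (h : ∀ a ∈ s, ∀ b ∈ s, ∀ c ∈ s, jacobiator P a b c = 0) : IsPoissonBracket P := by
  refine ⟨hP.skew, hP.leibniz, fun f g k => ?_⟩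
  change jacobiator P f g k = 0
  refine hP.jacobiator_eq_zero_right hs (fun a ha => ?_) k
  rw [← jacobiator_cyclic]
  refine hP.jacobiator_eq_zero_right hs (fun b hb => ?_) g
  rw [← jacobiator_cyclic]
  exact hP.jacobiator_eq_zero_right hs (fun c hc => h b hb a ha c hc) f

/-- The jacobiator is alternating, so triples with repetitions vanish and the others can be sorted.
-/
theorem jacobiator_eq_zero_of_lt {ι : Type*} [LinearOrder ι] {e : ι → R}
    (h : ∀ i j k, i < j → j < k → jacobiator P (e i) (e j) (e k) = 0) (i j k : ι) :
    jacobiator P (e i) (e j) (e k) = 0 := by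
  have h1 : ∀ i j k, i < j → jacobiator P (e i) (e j) (e k) = 0 := fun i j k hij => by
    rcases lt_trichotomy j k with hjk | rfl | hjk
    · exact h i j k hij hjk
    · rw [jacobiator_cyclic]
      exact hP.jacobiator_self _ _
    · rcases lt_trichotomy i k with hik | rfl | hik
      · rw [hP.jacobiator_swap, jacobiator_cyclic, h i k j hik hjk, neg_zero]
      · rw [jacobiator_cyclic, jacobiator_cyclic, hP.jacobiator_self]
      · rw [jacobiator_cyclic, jacobiator_cyclic, h k i j hik hij]
  rcases lt_trichotomy i j with hij | rfl | hij
  · exact h1 i j k hij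
  · exact hP.jacobiator_self _ _
  · rw [hP.jacobiator_swap, h1 j i k hij, neg_zero]

/-- A skew-symmetric biderivation is determined by its values on generators. -/
theorem eq_of_adjoin {Q : R →ₗ[ℂ] R →ₗ[ℂ] R} (hQ : IsSkewBiderivation Q) {s : Set R}
    (hs : Algebra.adjoin ℂ s = ⊤) (h : ∀ a ∈ s, ∀ b ∈ s, P a b = Q a b) : P = Q := by
  have key : ∀ f, (∀ a ∈ s, P f a = Q f a) → ∀ g, P f g = Q f g := by
    intro f hf g
    have hg : g ∈ Algebra.adjoin ℂ s := hs ▸ Algebra.mem_top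
    induction hg using Algebra.adjoin_induction with
    | mem a ha => exact hf a ha
    | algebraMap a => rw [hP.apply_algebraMap, hQ.apply_algebraMap]
    | add a b _ _ iha ihb => rw [map_add, map_add, iha, ihb]
    | mul a b _ _ iha ihb => rw [hP.leibniz, hQ.leibniz, iha, ihb]
  refine LinearMap.ext fun f => LinearMap.ext fun g => key f (fun a ha => ?_) g
  rw [hP.skew, hQ.skew, key a (fun b hb => h a ha b hb) f]

end

/-- The biderivation of a polynomial algebra with prescribed values on the generators. -/
theorem exists_of_algEquiv {R : Type*} [CommRing R] [Algebra ℂ R] {n : ℕ}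
    (φ : MvPolynomial (Fin n) ℂ ≃ₐ[ℂ] R) (c : Fin n → Fin n → R) (hc : ∀ i j, c i j = -c j i) :
    ∃ P : R →ₗ[ℂ] R →ₗ[ℂ] R, IsSkewBiderivation P ∧
      ∀ i j, P (φ (MvPolynomial.X i)) (φ (MvPolynomial.X j)) = c i j := by
  -- The partial derivatives carried over by `φ`; the bracket is the bivector field `∑ c i j ∂ᵢ ⊗
  -- ∂ⱼ`.
  let D : Fin n → R →ₗ[ℂ] R := fun i =>
    φ.toLinearMap ∘ₗ (MvPolynomial.pderiv i).toLinearMap ∘ₗ φ.symm.toLinearMap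
  have hD : ∀ i f g, D i (f * g) = D i f * g + f * D i g := fun i f g => by
    simp [D, map_mul, map_add]
    ring
  have hDX : ∀ i j, D i (φ (MvPolynomial.X j)) = if i = j then 1 else 0 := fun i j => by
    have : D i (φ (MvPolynomial.X j)) = φ (MvPolynomial.pderiv i (MvPolynomial.X j)) := by simp [D]
    rw [this, MvPolynomial.pderiv_X, Pi.single_apply]
    split_ifs with h1 h2 h2
    · exact map_one φ
    · exact absurd h1.symm h2
    · exact absurd h2.symm h1
    · exact map_zero φ
  let P : R →ₗ[ℂ] R →ₗ[ℂ] R := LinearMap.mk₂ ℂ (fun f g => ∑ i, ∑ j, c i j * D i f * D j g)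
    (fun f f' g => by simp only [map_add, mul_add, add_mul, Finset.sum_add_distrib])
    (fun a f g => by simp only [map_smul, mul_smul_comm, smul_mul_assoc, Finset.smul_sum])
    (fun f g g' => by simp only [map_add, mul_add, Finset.sum_add_distrib])
    (fun a f g => by simp only [map_smul, mul_smul_comm, Finset.smul_sum])
  have hPd : ∀ f g, P f g = ∑ i, ∑ j, c i j * D i f * D j g := fun f g => rfl
  refine ⟨P, ⟨fun f g => ?_, fun f g h => ?_⟩, fun i j => ?_⟩
  · rw [hPd, hPd, Finset.sum_comm, ← Finset.sum_neg_distrib]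
    refine Finset.sum_congr rfl fun i _ => ?_
    rw [← Finset.sum_neg_distrib]
    refine Finset.sum_congr rfl fun j _ => ?_
    rw [hc j i]
    ring
  · simp only [hPd, hD, Finset.sum_mul, Finset.mul_sum, ← Finset.sum_add_distrib]
    refine Finset.sum_congr rfl fun i _ => Finset.sum_congr rfl fun j _ => ?_
    ring
  · simp only [hPd, hDX]
    simp

end IsSkewBiderivation

/-! ### The Jacobi identity on the four triples of generators. -/

section

variable {R : Type*} [CommRing R] [Algebra ℂ R] {P : R →ₗ[ℂ] R →ₗ[ℂ] R} {x y a b : R} {t : BracketParams}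

/-- Direct expansion by the Leibniz rule, valid in any commutative algebra. The coefficients of the
monomials in this and the next three lemmas are the left-hand sides of `e1` to `e13` in
`BracketParams.IsConsistent`. -/
theorem jacobiator_x_y_a (hP : IsSkewBiderivation P)
    (hxy : P x y = (-2 : ℂ) • x ^ 3 + (2 : ℂ) • y ^ 2)
    (hax : P a x = t.α • (y * a) + t.γ • (x * b)) (hay : P a y = t.β • (x ^ 2 * a) + t.δ • (y * b))
    (hbx : P b x = t.lam • (x ^ 2 * a) + t.ε • (y * b))
    (hby : P b y = t.μ • (x * y * a) + t.θ • (x ^ 2 * b)) :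
    jacobiator P x y a = (2 * t.δ + t.δ * t.ε - 2 * t.γ - t.α * t.δ) • (y ^ 2 * b) +
      (t.δ * t.lam - t.γ * t.μ + 4 * t.β - 6 * t.α) • (x ^ 2 * y * a) +
      (2 * t.δ - 4 * t.γ - t.γ * t.θ + t.β * t.γ) • (x ^ 3 * b) := by
  have hyx := hP.skew y x
  have hxa := hP.skew x a
  have hya := hP.skew y a
  have hxb := hP.skew x b
  have hyb := hP.skew y b
  have hxx := hP.apply_self x
  have hyy := hP.apply_self y
  rw [hxy] at hyx
  rw [hax] at hxa
  rw [hay] at hya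
  rw [hbx] at hxb
  rw [hby] at hyb
  simp only [jacobiator, hxy, hya, hax, map_add, map_neg, map_smul, hP.leibniz, hP.apply_sq, hP.apply_cube,
    hay, hyx, hxa, hxb, hyb, hxx, hyy]
  simp only [Algebra.smul_def, map_add, map_sub, map_mul, map_ofNat, map_neg]
  ring

theorem jacobiator_x_y_b (hP : IsSkewBiderivation P)
    (hxy : P x y = (-2 : ℂ) • x ^ 3 + (2 : ℂ) • y ^ 2)
    (hax : P a x = t.α • (y * a) + t.γ • (x * b)) (hay : P a y = t.β • (x ^ 2 * a) + t.δ • (y * b))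
    (hbx : P b x = t.lam • (x ^ 2 * a) + t.ε • (y * b))
    (hby : P b y = t.μ • (x * y * a) + t.θ • (x ^ 2 * b)) :
    jacobiator P x y b = (2 * t.μ - t.μ * t.ε - 4 * t.lam + t.α * t.μ) • (x * y ^ 2 * a) +
      (-6 * t.ε + 4 * t.θ - t.δ * t.lam + t.γ * t.μ) • (x ^ 2 * y * b) +
      (2 * t.μ - 2 * t.lam + t.lam * t.θ - t.β * t.lam) • (x ^ 4 * a) := by
  have hyx := hP.skew y x
  have hxa := hP.skew x a
  have hya := hP.skew y a
  have hxb := hP.skew x b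
  have hyb := hP.skew y b
  have hxx := hP.apply_self x
  have hyy := hP.apply_self y
  rw [hxy] at hyx
  rw [hax] at hxa
  rw [hay] at hya
  rw [hbx] at hxb
  rw [hby] at hyb
  simp only [jacobiator, hxy, hyb, hbx, map_add, map_neg, map_smul, hP.leibniz, hP.apply_sq, hP.apply_cube,
    hby, hyx, hxa, hya, hxb, hxx, hyy]
  simp only [Algebra.smul_def, map_add, map_sub, map_mul, map_ofNat, map_neg]
  ring

theorem jacobiator_x_a_b (hP : IsSkewBiderivation P)
    (hax : P a x = t.α • (y * a) + t.γ • (x * b)) (hay : P a y = t.β • (x ^ 2 * a) + t.δ • (y * b))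
    (hbx : P b x = t.lam • (x ^ 2 * a) + t.ε • (y * b))
    (hby : P b y = t.μ • (x * y * a) + t.θ • (x ^ 2 * b))
    (hab : P a b = t.ξ • (x * a ^ 2) + t.η • b ^ 2) :
    jacobiator P x a b = (-t.ε * t.η + t.δ * t.ε - t.γ * t.ε + t.α * t.η) • (y * b ^ 2) +
      (t.ε * t.ξ - t.α * t.ξ - t.α * t.μ + 2 * t.α * t.lam) • (x * y * a ^ 2) +
      (-2 * t.lam * t.η - 2 * t.γ * t.ξ + t.γ * t.lam + t.β * t.ε - t.α * t.θ) • (x ^ 2 * a * b) := by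
  have hxa := hP.skew x a
  have hxb := hP.skew x b
  have hba := hP.skew b a
  have hxx := hP.apply_self x
  have haa := hP.apply_self a
  have hbb := hP.apply_self b
  rw [hax] at hxa
  rw [hbx] at hxb
  rw [hab] at hba
  simp only [jacobiator, hxa, hxb, hba, hab, hax, hay, hbx, hby, hxx, haa, hbb, map_add, map_neg,
    map_smul, hP.leibniz, hP.apply_sq]
  simp only [Algebra.smul_def, map_add, map_sub, map_mul, map_ofNat, map_neg]
  ring

theorem jacobiator_y_a_b (hP : IsSkewBiderivation P)
    (hxy : P x y = (-2 : ℂ) • x ^ 3 + (2 : ℂ) • y ^ 2)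
    (hax : P a x = t.α • (y * a) + t.γ • (x * b)) (hay : P a y = t.β • (x ^ 2 * a) + t.δ • (y * b))
    (hbx : P b x = t.lam • (x ^ 2 * a) + t.ε • (y * b))
    (hby : P b y = t.μ • (x * y * a) + t.θ • (x ^ 2 * b))
    (hab : P a b = t.ξ • (x * a ^ 2) + t.η • b ^ 2) :
    jacobiator P y a b = (-2 * t.ξ + t.α * t.μ) • (y ^ 2 * a ^ 2) +
      (-2 * t.μ * t.η - 2 * t.δ * t.ξ + t.γ * t.μ - 2 * t.β * t.ε + 2 * t.α * t.θ) • (x * y * a * b) +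
      (-t.θ * t.η - t.δ * t.θ + 2 * t.γ * t.θ + t.β * t.η) • (x ^ 2 * b ^ 2) +
      (2 * t.ξ + t.θ * t.ξ - t.β * t.ξ + t.β * t.μ - 2 * t.β * t.lam) • (x ^ 3 * a ^ 2) := by
  have hyx := hP.skew y x
  have hya := hP.skew y a
  have hyb := hP.skew y b
  have hba := hP.skew b a
  have haa := hP.apply_self a
  have hbb := hP.apply_self b
  rw [hxy] at hyx
  rw [hay] at hya
  rw [hby] at hyb
  rw [hab] at hba
  simp only [jacobiator, hyx, hya, hyb, hba, hab, hax, hay, hbx, hby, haa, hbb, map_add, map_neg,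
    map_smul, hP.leibniz, hP.apply_sq]
  simp only [Algebra.smul_def, map_add, map_sub, map_mul, map_ofNat, map_neg]
  ring

end

/-- The equations on the parameters equivalent to the Jacobi identity. -/
structure BracketParams.IsConsistent (t : BracketParams) : Prop where
  e1 : 2 * t.δ + t.δ * t.ε - 2 * t.γ - t.α * t.δ = 0
  e2 : t.δ * t.lam - t.γ * t.μ + 4 * t.β - 6 * t.α = 0
  e3 : 2 * t.δ - 4 * t.γ - t.γ * t.θ + t.β * t.γ = 0
  e4 : 2 * t.μ - t.μ * t.ε - 4 * t.lam + t.α * t.μ = 0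
  e5 : -6 * t.ε + 4 * t.θ - t.δ * t.lam + t.γ * t.μ = 0
  e6 : 2 * t.μ - 2 * t.lam + t.lam * t.θ - t.β * t.lam = 0
  e7 : -t.ε * t.η + t.δ * t.ε - t.γ * t.ε + t.α * t.η = 0
  e8 : t.ε * t.ξ - t.α * t.ξ - t.α * t.μ + 2 * t.α * t.lam = 0
  e9 : -2 * t.lam * t.η - 2 * t.γ * t.ξ + t.γ * t.lam + t.β * t.ε - t.α * t.θ = 0
  e10 : -2 * t.ξ + t.α * t.μ = 0
  e11 : -2 * t.μ * t.η - 2 * t.δ * t.ξ + t.γ * t.μ - 2 * t.β * t.ε + 2 * t.α * t.θ = 0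
  e12 : -t.θ * t.η - t.δ * t.θ + 2 * t.γ * t.θ + t.β * t.η = 0
  e13 : 2 * t.ξ + t.θ * t.ξ - t.β * t.ξ + t.β * t.μ - 2 * t.β * t.lam = 0

theorem BracketParams.InTable.isConsistent {t : BracketParams} (h : t.InTable) : t.IsConsistent := by
  obtain ⟨al, be, ga, de, lam, mu, th, ep, xi, et⟩ := t
  rcases h with ⟨h0, h⟩ | h | ⟨h0, h⟩ | ⟨h0, h⟩ | h | ⟨h0, h⟩
  · obtain ⟨h1, h2, h3, h4, h5, h6, h7, h8⟩ := h
    dsimp only at *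
    subst h1 h2 h3 h4 h5 h6 h7 h8
    constructor <;> dsimp only <;> field_simp <;> ring
  · obtain ⟨h1, h2, h3, h4, h5, h6, h7⟩ := h
    dsimp only at *
    subst h1 h2 h3 h4 h5 h6 h7
    constructor <;> dsimp only <;> ring
  · obtain ⟨h1, h2, h3, h4, h5, h6, h7, h8, h9⟩ := h
    dsimp only at *
    subst h1 h2 h3 h4 h5 h6 h7 h8 h9
    constructor <;> dsimp only <;> ring
  · obtain ⟨h1, h2, h3, h4, h5, h6, h7, h8, h9⟩ := h
    dsimp only at *
    subst h1 h2 h3 h4 h5 h6 h7 h8 h9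
    constructor <;> dsimp only <;> ring
  · obtain ⟨h1, h2, h3, h4, h5, h6, h7, h8⟩ := h
    dsimp only at *
    subst h1 h2 h3 h4 h5 h6 h7 h8
    constructor <;> dsimp only <;> ring
  · obtain ⟨h1, h2, h3, h4, h5, h6, h7, h8⟩ := h
    dsimp only at *
    subst h1 h2 h3 h4 h5 h6 h7 h8
    constructor <;> dsimp only <;> ring

/-! ### Classification of the parameters -/

/-- Put `u = α - ε` and `v = β - θ`. Then `e3` and `e6` read `2δ = γ(4 - v)` and `2μ = λ(2 + v)`,
while `e1` and `e4` give `(4 - v)(2 - u) = 4` if `γ ≠ 0` and `(2 + v)(2 + u) = 8` if `λ ≠ 0`. If `γ`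
or `λ` vanishes, `e2` and `e5` give `v = 3u/2`. The cases are split by the vanishing of `γ` and `λ`,
and in each the remaining equation in `u` is quadratic or absent. -/
theorem BracketParams.IsConsistent.inTable {t : BracketParams} (h : t.IsConsistent) : t.InTable := by
  obtain ⟨al, be, ga, de, lam, mu, th, ep, xi, et⟩ := t
  obtain ⟨e1, e2, e3, e4, e5, e6, e7, e8, e9, e10, e11, e12, e13⟩ := h
  dsimp only at *
  have hxi : xi = al * mu / 2 := by linear_combination (-1 / 2 : ℂ) * e10
  have hde : de = ga * (4 - (be - th)) / 2 := by linear_combination (1 / 2 : ℂ) * e3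
  have hmu : mu = lam * (2 + (be - th)) / 2 := by linear_combination (1 / 2 : ℂ) * e6
  by_cases hga : ga = 0
  · subst hga
    have hde0 : de = 0 := by rw [hde]; ring
    subst hde0
    have hbe : be = 3 / 2 * al := by linear_combination (1 / 4 : ℂ) * e2
    have hth : th = 3 / 2 * ep := by linear_combination (1 / 4 : ℂ) * e5
    by_cases hlam : lam = 0
    · subst hlam
      have hmu0 : mu = 0 := by rw [hmu]; ring
      subst hmu0
      have hxi0 : xi = 0 := by rw [hxi]; ring
      subst hxi0
      by_cases hu : al = ep
      · exact Or.inr (Or.inr (Or.inr (Or.inr (Or.inl ⟨hu, by rw [hbe, hu], rfl, rfl, rfl, rfl, hth, rfl⟩))))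
      · have het : et = 0 := by
          have : (al - ep) * et = 0 := by
            linear_combination (2 / 3 : ℂ) * e12 - 2 / 3 * et * hbe + 2 / 3 * et * hth
          exact (mul_eq_zero.mp this).resolve_left (sub_ne_zero.mpr hu)
        by_cases hu2 : al = ep + 2 / 3
        · refine Or.inr (Or.inl ⟨hu2, ?_, ?_, ?_, hth, ?_, ?_⟩)
          · rw [hbe, hu2]; ring
          · ring
          · ring
          · ring
          · rw [het]; ring
        · exact Or.inr (Or.inr (Or.inr (Or.inr (Or.inr
            ⟨hu2, hbe, rfl, rfl, rfl, rfl, hth, rfl, het⟩))))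
    -- Here `v = 3u/2` in `(2 + v)(2 + u) = 8`. The root `2/3` leads to family `ℬ`, the root `-4` to
    -- `𝒞₂`.
    · have hq : (al - ep - 2 / 3) * (al - ep + 4) = 0 := by
        refine mul_left_cancel₀ hlam ?_
        rw [hmu, hbe, hth] at e4
        linear_combination (4 / 3 : ℂ) * e4
      rcases mul_eq_zero.mp hq with hu | hu
      · have hal : al = ep + 2 / 3 := by linear_combination hu
        refine Or.inr (Or.inl ⟨hal, ?_, ?_, ?_, hth, ?_, ?_⟩)
        · rw [hbe, hal]; ring
        · ring
        · rw [hmu, hbe, hth, hal]; ring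
        · rw [hxi, hmu, hbe, hth, hal]; ring
        · rw [hbe, hth, hal] at e12
          linear_combination e12
      · have hal : al = ep - 4 := by linear_combination hu
        have hmu' : mu = -2 * lam := by rw [hmu, hbe, hth, hal]; ring
        have hal0 : al = 0 := by
          rw [hxi, hmu', hbe, hth] at e13
          have : lam * al = 0 := by
            linear_combination (-1 / 14 : ℂ) * e13 + 3 / 28 * lam * al * hu
          exact (mul_eq_zero.mp this).resolve_left hlam
        subst hal0
        have hep : ep = 4 := by linear_combination -hal
        subst hep
        refine Or.inr (Or.inr (Or.inr (Or.inl ⟨hlam, rfl, ?_, rfl, rfl, hmu', ?_, rfl, ?_, ?_⟩)))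
        · rw [hbe]; ring
        · rw [hth]; ring
        · rw [hxi]; ring
        · rw [hbe, hth] at e12
          linear_combination (-1 / 6 : ℂ) * e12
  · have h1 : (4 - (be - th)) * (2 - (al - ep)) = 4 := by
      refine mul_left_cancel₀ hga ?_
      rw [hde] at e1
      linear_combination 2 * e1
    by_cases hlam : lam = 0
    · subst hlam
      have hmu0 : mu = 0 := by rw [hmu]; ring
      subst hmu0
      have hxi0 : xi = 0 := by rw [hxi]; ring
      subst hxi0
      have hbe : be = 3 / 2 * al := by linear_combination (1 / 4 : ℂ) * e2
      have hth : th = 3 / 2 * ep := by linear_combination (1 / 4 : ℂ) * e5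
      -- Here `v = 3u/2` in `(4 - v)(2 - u) = 4`. The root `2/3` leads to family `ℬ`, the root `4`
      -- to `𝒞₁`.
      have hq : (al - ep - 2 / 3) * (al - ep - 4) = 0 := by
        rw [hbe, hth] at h1
        linear_combination (2 / 3 : ℂ) * h1
      rcases mul_eq_zero.mp hq with hu | hu
      · have hal : al = ep + 2 / 3 := by linear_combination hu
        refine Or.inr (Or.inl ⟨hal, ?_, ?_, ?_, hth, ?_, ?_⟩)
        · rw [hbe, hal]; ring
        · rw [hde, hbe, hth, hal]; ring
        · ring
        · ring
        · rw [hde, hbe, hth, hal] at e12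
          linear_combination e12
      · have hal : al = ep + 4 := by linear_combination hu
        have hde' : de = -ga := by rw [hde, hbe, hth, hal]; ring
        have hep : ep = 0 := by
          rw [hde', hbe, hth, hal] at e12
          rw [hde', hal] at e7
          have : ga * ep = 0 := by linear_combination (2 / 15 : ℂ) * e12 - 1 / 5 * e7
          exact (mul_eq_zero.mp this).resolve_left hga
        subst hep
        refine Or.inr (Or.inr (Or.inl ⟨hga, ?_, ?_, hde', rfl, rfl, ?_, rfl, rfl, ?_⟩))
        · rw [hal]; ring
        · rw [hbe, hal]; ring
        · rw [hth]; ring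
        · rw [hde', hal] at e7
          linear_combination (1 / 4 : ℂ) * e7
    · have h2 : (2 + (be - th)) * (2 + (al - ep)) = 8 := by
        refine mul_left_cancel₀ hlam ?_
        rw [hmu] at e4
        linear_combination 2 * e4
      -- Subtracting the two product equations eliminates `uv`; the roots `u = 0` and `u = 2/3` that
      -- remain give families `𝒜` and `ℬ`.
      have hv : be - th = 2 - 3 / 2 * (al - ep) := by linear_combination (1 / 4 : ℂ) * h2 - (1 / 4 : ℂ) * h1
      have hq : (al - ep) * (al - ep - 2 / 3) = 0 := by
        rw [hv] at h1
        linear_combination (-2 / 3 : ℂ) * h1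
      rw [hv] at hde hmu
      rcases mul_eq_zero.mp hq with hu | hu
      · rw [hu] at hde hmu hv
        have hal : al = ep := sub_eq_zero.mp hu
        have hde' : de = ga := by rw [hde]; ring
        have hmu' : mu = 2 * lam := by rw [hmu]; ring
        rw [hde', hmu'] at e2 e5
        -- With `δ = γ` and `μ = 2λ`, the difference of `e2` and `e5` is `4v - 6u = 2γλ`, and here
        -- `u = 0`, `v = 2`.
        have hgl : ga * lam = 4 := by linear_combination 2 * hv + (1 / 2 : ℂ) * (- e2 - e5) + e5 - 3 * hal
        have hl : lam = 4 / ga := by rw [eq_div_iff hga]; linear_combination hgl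
        have hbe : be = 3 / 2 * ep + 1 := by
          linear_combination (1 / 4 : ℂ) * e2 + 3 / 2 * hal + (1 / 4 : ℂ) * hgl
        have hth : th = 3 / 2 * ep - 1 := by linear_combination (1 / 4 : ℂ) * e5 - (1 / 4 : ℂ) * hgl
        refine Or.inl ⟨hga, hal, hbe, hde', hl, ?_, hth, ?_, ?_⟩
        · rw [hmu', hl]; ring
        · rw [hxi, hmu', hl, hal]; ring
        · rw [hde', hbe, hth] at e12
          linear_combination (1 / 2 : ℂ) * e12
      · have hal : al = ep + 2 / 3 := by linear_combination hu
        rw [hal] at hde hmu hv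
        have hde' : de = 3 / 2 * ga := by rw [hde]; ring
        have hmu' : mu = 3 / 2 * lam := by rw [hmu]; ring
        rw [hde', hmu'] at e2 e5
        have hbe : be = 3 / 2 * ep + 1 := by linear_combination (1 / 4 : ℂ) * e2 + 3 / 2 * hal
        have hth : th = 3 / 2 * ep := by linear_combination (1 / 4 : ℂ) * e5
        refine Or.inr (Or.inl ⟨hal, hbe, hde', hmu', hth, ?_, ?_⟩)
        · rw [hxi, hmu', hal]; ring
        · rw [hde', hbe, hth] at e12
          linear_combination e12

/-! ### The algebra as a polynomial algebra -/

/-- The generator `A` as an element of the algebra of weak Jacobi forms. -/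
noncomputable def genA : evenWeakJacobi :=
  ⟨jacobiA, weakJacobi_le_evenWeakJacobi (by decide) jacobiA_mem_weakJacobi⟩

/-- The generator `B` as an element of the algebra of weak Jacobi forms. -/
noncomputable def genB : evenWeakJacobi :=
  ⟨jacobiB, weakJacobi_le_evenWeakJacobi (by decide) jacobiB_mem_weakJacobi⟩

/-- The four generators of the algebra of weak Jacobi forms of even weight. -/
noncomputable def jacobiGen : Fin 4 → evenWeakJacobi := ![genE4, genE6, genA, genB]

theorem coe_aeval_jacobiGen (F : MvPolynomial (Fin 4) ℂ) (τ : ℍ) (z : ℂ) :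
    (MvPolynomial.aeval jacobiGen F : ℍ × ℂ → ℂ) (τ, z) = MvPolynomial.eval
      ![ModularForm.E₄ τ, ModularForm.E₆ τ, jacobiA (τ, z), jacobiB (τ, z)] F := by
  have h : ((Pi.evalAlgHom ℂ (fun _ : ℍ × ℂ => ℂ) (τ, z)).comp evenWeakJacobi.val).comp
      (MvPolynomial.aeval jacobiGen) = MvPolynomial.aeval
        ![ModularForm.E₄ τ, ModularForm.E₆ τ, jacobiA (τ, z), jacobiB (τ, z)] := by
    refine MvPolynomial.algHom_ext fun i => ?_
    simp only [AlgHom.comp_apply, MvPolynomial.aeval_X]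
    fin_cases i <;> rfl
  rw [← MvPolynomial.coe_aeval_eq_eval, ← h]
  rfl

theorem coe_genMonomial (a b c d : ℕ) : ((genE4 ^ a * genE6 ^ b * genA ^ c * genB ^ d : evenWeakJacobi) :
    ℍ × ℂ → ℂ) = jacobiMonomial a b c d := rfl

/-- Injectivity is the algebraic independence of the generators; surjectivity is the expression of
each homogeneous form as a combination of monomials. -/
theorem aeval_jacobiGen_bijective : Function.Bijective
    (MvPolynomial.aeval jacobiGen : MvPolynomial (Fin 4) ℂ →ₐ[ℂ] evenWeakJacobi) := by
  refine ⟨(injective_iff_map_eq_zero _).mpr fun F hF => eq_zero_of_eval_generators fun τ z => ?_, ?_⟩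
  · rw [← coe_aeval_jacobiGen, hF]
    rfl
  · rintro ⟨f, hf⟩
    have hle : (⨆ i : {k : ℤ // Even k} × ℕ, weakJacobi i.1 i.2) ≤ Subalgebra.toSubmodule
        (evenWeakJacobi.val.comp (MvPolynomial.aeval jacobiGen)).range := by
      refine iSup_le fun i Φ hΦ => ?_
      have := mem_jacobiSpan i.1.2 hΦ
      refine (Submodule.span_le.mpr ?_) this
      rintro _ ⟨a, b, c, d, -, -, rfl⟩
      refine ⟨MvPolynomial.X 0 ^ a * MvPolynomial.X 1 ^ b * MvPolynomial.X 2 ^ c * MvPolynomial.X 3 ^ d, ?_⟩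
      rw [← coe_genMonomial]
      simp [jacobiGen]
    obtain ⟨F, hF⟩ := hle hf
    exact ⟨F, Subtype.ext hF⟩

/-- The algebra of weak Jacobi forms of even weight is a polynomial algebra in `E₄`, `E₆`, `A`, `B`. -/
noncomputable def jacobiEquiv : MvPolynomial (Fin 4) ℂ ≃ₐ[ℂ] evenWeakJacobi :=
  AlgEquiv.ofBijective (MvPolynomial.aeval jacobiGen) aeval_jacobiGen_bijective

theorem jacobiEquiv_X (i : Fin 4) : jacobiEquiv (MvPolynomial.X i) = jacobiGen i := by
  simp [jacobiEquiv]

theorem adjoin_jacobiGen : Algebra.adjoin ℂ (Set.range jacobiGen) = ⊤ := by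
  rw [Algebra.adjoin_range_eq_range_aeval, AlgHom.range_eq_top]
  exact aeval_jacobiGen_bijective.2

/-- The point of the spectrum with the given coordinates. -/
noncomputable def jacobiPoint (v : Fin 4 → ℂ) : evenWeakJacobi →ₐ[ℂ] ℂ :=
  (MvPolynomial.aeval v).comp jacobiEquiv.symm.toAlgHom

theorem jacobiPoint_gen (v : Fin 4 → ℂ) (i : Fin 4) : jacobiPoint v (jacobiGen i) = v i := by
  have : jacobiEquiv.symm (jacobiGen i) = MvPolynomial.X i := by
    rw [← jacobiEquiv_X, AlgEquiv.symm_apply_apply]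
  change MvPolynomial.aeval v (jacobiEquiv.symm (jacobiGen i)) = v i
  rw [this, MvPolynomial.aeval_X]

theorem jacobiPoint_genE4 (v : Fin 4 → ℂ) : jacobiPoint v genE4 = v 0 := jacobiPoint_gen v 0

theorem jacobiPoint_genE6 (v : Fin 4 → ℂ) : jacobiPoint v genE6 = v 1 := jacobiPoint_gen v 1

theorem jacobiPoint_genA (v : Fin 4 → ℂ) : jacobiPoint v genA = v 2 := jacobiPoint_gen v 2

theorem jacobiPoint_genB (v : Fin 4 → ℂ) : jacobiPoint v genB = v 3 := jacobiPoint_gen v 3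

section

variable {P : evenWeakJacobi →ₗ[ℂ] evenWeakJacobi →ₗ[ℂ] evenWeakJacobi} {t : BracketParams}

theorem HasGeneratorValues.isConsistent (h : HasGeneratorValues P genA genB t) (hP : IsPoissonBracket P) :
    t.IsConsistent := by
  have hs := hP.isSkewBiderivation
  have j1 := (jacobiator_x_y_a hs h.e4_e6 h.a_e4 h.a_e6 h.b_e4 h.b_e6).symm.trans (hP.jacobi _ _ _)
  have j2 := (jacobiator_x_y_b hs h.e4_e6 h.a_e4 h.a_e6 h.b_e4 h.b_e6).symm.trans (hP.jacobi _ _ _)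
  have j3 := (jacobiator_x_a_b hs h.a_e4 h.a_e6 h.b_e4 h.b_e6 h.a_b).symm.trans (hP.jacobi _ _ _)
  have j4 := (jacobiator_y_a_b hs h.e4_e6 h.a_e4 h.a_e6 h.b_e4 h.b_e6 h.a_b).symm.trans (hP.jacobi _ _ _)
  have p1 := fun v => congrArg (jacobiPoint v) j1
  have p2 := fun v => congrArg (jacobiPoint v) j2
  have p3 := fun v => congrArg (jacobiPoint v) j3
  have p4 := fun v => congrArg (jacobiPoint v) j4
  simp only [map_add, map_smul, map_mul, map_pow, map_zero, jacobiPoint_genE4, jacobiPoint_genE6,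
    jacobiPoint_genA, jacobiPoint_genB, smul_eq_mul] at p1 p2 p3 p4
  -- Points with coordinates `0` and `1` chosen to isolate the coefficient of each monomial; where
  -- several monomials survive, the values at other points are subtracted below.
  have a1 := p1 ![0, 1, 0, 1]
  have a2 := p1 ![1, 1, 1, 0]
  have a3 := p1 ![1, 0, 0, 1]
  have b1 := p2 ![1, 1, 1, 0]
  have b2 := p2 ![1, 1, 0, 1]
  have b3 := p2 ![1, 0, 1, 0]
  have c1 := p3 ![0, 1, 0, 1]
  have c2 := p3 ![1, 1, 1, 0]
  have c3 := p3 ![1, 0, 1, 1]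
  have d1 := p4 ![0, 1, 1, 0]
  have d2 := p4 ![1, 1, 1, 1]
  have d3 := p4 ![1, 0, 0, 1]
  have d4 := p4 ![1, 0, 1, 0]
  simp only [Matrix.cons_val_zero, Matrix.cons_val_one, Matrix.cons_val] at a1 a2 a3 b1 b2 b3 c1 c2 c3 d1 d2 d3 d4
  constructor
  · linear_combination a1
  · linear_combination a2
  · linear_combination a3
  · linear_combination b1 - b3
  · linear_combination b2
  · linear_combination b3
  · linear_combination c1
  · linear_combination c2
  · linear_combination c3
  · linear_combination d1
  · linear_combination d2 - d1 - d3 - d4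
  · linear_combination d3
  · linear_combination d4

theorem HasGeneratorValues.isPoissonBracket (h : HasGeneratorValues P genA genB t) (hs : IsSkewBiderivation P)
    (ht : t.IsConsistent) : IsPoissonBracket P := by
  refine hs.isPoissonBracket_of_adjoin adjoin_jacobiGen ?_
  rintro _ ⟨i, rfl⟩ _ ⟨j, rfl⟩ _ ⟨k, rfl⟩
  refine hs.jacobiator_eq_zero_of_lt (e := jacobiGen) (fun i j k hij hjk => ?_) i j k
  have j1 := jacobiator_x_y_a hs h.e4_e6 h.a_e4 h.a_e6 h.b_e4 h.b_e6
  have j2 := jacobiator_x_y_b hs h.e4_e6 h.a_e4 h.a_e6 h.b_e4 h.b_e6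
  have j3 := jacobiator_x_a_b hs h.a_e4 h.a_e6 h.b_e4 h.b_e6 h.a_b
  have j4 := jacobiator_y_a_b hs h.e4_e6 h.a_e4 h.a_e6 h.b_e4 h.b_e6 h.a_b
  simp only [ht.e1, ht.e2, ht.e3, ht.e4, ht.e5, ht.e6, ht.e7, ht.e8, ht.e9, ht.e10, ht.e11, ht.e12, ht.e13,
    zero_smul, add_zero] at j1 j2 j3 j4
  have hcases : (i = 0 ∧ j = 1 ∧ k = 2) ∨ (i = 0 ∧ j = 1 ∧ k = 3) ∨ (i = 0 ∧ j = 2 ∧ k = 3) ∨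
      (i = 1 ∧ j = 2 ∧ k = 3) := by omega
  rcases hcases with ⟨rfl, rfl, rfl⟩ | ⟨rfl, rfl, rfl⟩ | ⟨rfl, rfl, rfl⟩ | ⟨rfl, rfl, rfl⟩
  · exact j1
  · exact j2
  · exact j3
  · exact j4

theorem HasGeneratorValues.unique {Q : evenWeakJacobi →ₗ[ℂ] evenWeakJacobi →ₗ[ℂ] evenWeakJacobi}
    (h : HasGeneratorValues P genA genB t) (hs : IsSkewBiderivation P)
    (h' : HasGeneratorValues Q genA genB t) (hs' : IsSkewBiderivation Q) : P = Q := by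
  refine hs.eq_of_adjoin hs' adjoin_jacobiGen ?_
  rintro _ ⟨i, rfl⟩ _ ⟨j, rfl⟩
  have key : ∀ i j : Fin 4, i < j → P (jacobiGen i) (jacobiGen j) = Q (jacobiGen i) (jacobiGen j) := by
    intro i j hij
    have hcases : (i = 0 ∧ j = 1) ∨ (i = 0 ∧ j = 2) ∨ (i = 0 ∧ j = 3) ∨ (i = 1 ∧ j = 2) ∨
        (i = 1 ∧ j = 3) ∨ (i = 2 ∧ j = 3) := by omega
    rcases hcases with ⟨rfl, rfl⟩ | ⟨rfl, rfl⟩ | ⟨rfl, rfl⟩ | ⟨rfl, rfl⟩ | ⟨rfl, rfl⟩ | ⟨rfl, rfl⟩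
    · exact h.e4_e6.trans h'.e4_e6.symm
    · rw [hs.skew, hs'.skew]
      exact congrArg Neg.neg (h.a_e4.trans h'.a_e4.symm)
    · rw [hs.skew, hs'.skew]
      exact congrArg Neg.neg (h.b_e4.trans h'.b_e4.symm)
    · rw [hs.skew, hs'.skew]
      exact congrArg Neg.neg (h.a_e6.trans h'.a_e6.symm)
    · rw [hs.skew, hs'.skew]
      exact congrArg Neg.neg (h.b_e6.trans h'.b_e6.symm)
    · exact h.a_b.trans h'.a_b.symm
  rcases lt_trichotomy i j with hij | rfl | hij
  · exact key i j hij
  · rw [hs.apply_self, hs'.apply_self]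
  · rw [hs.skew, hs'.skew, key j i hij]

end

theorem exists_hasGeneratorValues (t : BracketParams) :
    ∃ P : evenWeakJacobi →ₗ[ℂ] evenWeakJacobi →ₗ[ℂ] evenWeakJacobi,
      IsSkewBiderivation P ∧ HasGeneratorValues P genA genB t := by
  set c01 := (-2 : ℂ) • genE4 ^ 3 + (2 : ℂ) • genE6 ^ 2
  set c20 := t.α • (genE6 * genA) + t.γ • (genE4 * genB)
  set c21 := t.β • (genE4 ^ 2 * genA) + t.δ • (genE6 * genB)
  set c30 := t.lam • (genE4 ^ 2 * genA) + t.ε • (genE6 * genB)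
  set c31 := t.μ • (genE4 * genE6 * genA) + t.θ • (genE4 ^ 2 * genB)
  set c23 := t.ξ • (genE4 * genA ^ 2) + t.η • genB ^ 2
  -- The rows and columns are ordered `E₄`, `E₆`, `A`, `B`.
  obtain ⟨P, hP, hc⟩ := IsSkewBiderivation.exists_of_algEquiv jacobiEquiv
    ![![0, c01, -c20, -c30], ![-c01, 0, -c21, -c31], ![c20, c21, 0, c23], ![c30, c31, -c23, 0]]
    (fun i j => by fin_cases i <;> fin_cases j <;> simp)
  simp only [jacobiEquiv_X] at hc
  exact ⟨P, hP, ⟨hc 0 1, hc 2 0, hc 2 1, hc 3 0, hc 3 1, hc 2 3⟩⟩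

/-! ### Admissible brackets in terms of their values on the generators -/

theorem genE4_mem_weakJacobi : (genE4 : ℍ × ℂ → ℂ) ∈ weakJacobi 4 0 := modularLift_mem_weakJacobi _

theorem genE6_mem_weakJacobi : (genE6 : ℍ × ℂ → ℂ) ∈ weakJacobi 6 0 := modularLift_mem_weakJacobi _

/-- A form lies in the span of the monomials of its weight and index. It is applied to weights and
indices with just two such monomials, which is where each pair of parameters comes from. -/
theorem exists_eq_smul_add_smul {k : ℤ} {m : ℕ} (hk : Even k) {f u v : evenWeakJacobi}
    (hf : (f : ℍ × ℂ → ℂ) ∈ weakJacobi k m)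
    (h : ∀ a b c d : ℕ, (4 * a + 6 * b - 2 * c : ℤ) = k → c + d = m →
      genE4 ^ a * genE6 ^ b * genA ^ c * genB ^ d = u ∨ genE4 ^ a * genE6 ^ b * genA ^ c * genB ^ d = v) :
    ∃ s t : ℂ, f = s • u + t • v := by
  have hle : jacobiSpan k m ≤ Submodule.span ℂ {(u : ℍ × ℂ → ℂ), (v : ℍ × ℂ → ℂ)} := by
    refine Submodule.span_mono ?_
    rintro _ ⟨a, b, c, d, h1, h2, rfl⟩
    rw [← coe_genMonomial]
    rcases h a b c d h1 h2 with h | h <;> rw [h]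
    · exact Set.mem_insert _ _
    · exact Set.mem_insert_of_mem _ rfl
  obtain ⟨s, t, hst⟩ := Submodule.mem_span_pair.mp (hle (mem_jacobiSpan hk hf))
  exact ⟨s, t, Subtype.ext hst.symm⟩

theorem IsAdmissible.exists_hasGeneratorValues {P : evenWeakJacobi →ₗ[ℂ] evenWeakJacobi →ₗ[ℂ] evenWeakJacobi}
    (hP : IsAdmissible P) : ∃ t, HasGeneratorValues P genA genB t := by
  obtain ⟨al, ga, h1⟩ : ∃ s t : ℂ, P genA genE4 = s • (genE6 * genA) + t • (genE4 * genB) := by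
    refine exists_eq_smul_add_smul (by decide) (hP.homogeneous (-2) 4 1 0 (by decide) (by decide) _ _
      jacobiA_mem_weakJacobi genE4_mem_weakJacobi) fun a b c d hk hm => ?_
    have hb : b ≤ 1 := by omega
    have : (a = 0 ∧ b = 1 ∧ c = 1 ∧ d = 0) ∨ (a = 1 ∧ b = 0 ∧ c = 0 ∧ d = 1) := by
      interval_cases b <;> omega
    rcases this with ⟨rfl, rfl, rfl, rfl⟩ | ⟨rfl, rfl, rfl, rfl⟩
    · left; ring
    · right; ring
  have h46 : ∀ a b c d : ℕ, (4 * a + 6 * b - 2 * c : ℤ) = 6 → c + d = 1 →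
      genE4 ^ a * genE6 ^ b * genA ^ c * genB ^ d = genE4 ^ 2 * genA ∨
      genE4 ^ a * genE6 ^ b * genA ^ c * genB ^ d = genE6 * genB := fun a b c d hk hm => by
    have hb : b ≤ 1 := by omega
    have : (a = 2 ∧ b = 0 ∧ c = 1 ∧ d = 0) ∨ (a = 0 ∧ b = 1 ∧ c = 0 ∧ d = 1) := by
      interval_cases b <;> omega
    rcases this with ⟨rfl, rfl, rfl, rfl⟩ | ⟨rfl, rfl, rfl, rfl⟩
    · left; ring
    · right; ring
  obtain ⟨be, de, h2⟩ : ∃ s t : ℂ, P genA genE6 = s • (genE4 ^ 2 * genA) + t • (genE6 * genB) :=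
    exists_eq_smul_add_smul (by decide) (hP.homogeneous (-2) 6 1 0 (by decide) (by decide) _ _
      jacobiA_mem_weakJacobi genE6_mem_weakJacobi) h46
  obtain ⟨lam, ep, h3⟩ : ∃ s t : ℂ, P genB genE4 = s • (genE4 ^ 2 * genA) + t • (genE6 * genB) :=
    exists_eq_smul_add_smul (by decide) (hP.homogeneous 0 4 1 0 (by decide) (by decide) _ _
      jacobiB_mem_weakJacobi genE4_mem_weakJacobi) h46
  obtain ⟨mu, th, h4⟩ : ∃ s t : ℂ, P genB genE6 = s • (genE4 * genE6 * genA) + t • (genE4 ^ 2 * genB) := by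
    refine exists_eq_smul_add_smul (by decide) (hP.homogeneous 0 6 1 0 (by decide) (by decide) _ _
      jacobiB_mem_weakJacobi genE6_mem_weakJacobi) fun a b c d hk hm => ?_
    have hb : b ≤ 1 := by omega
    have : (a = 1 ∧ b = 1 ∧ c = 1 ∧ d = 0) ∨ (a = 2 ∧ b = 0 ∧ c = 0 ∧ d = 1) := by
      interval_cases b <;> omega
    rcases this with ⟨rfl, rfl, rfl, rfl⟩ | ⟨rfl, rfl, rfl, rfl⟩
    · left; ring
    · right; ring
  obtain ⟨xi, et, h5⟩ : ∃ s t : ℂ, P genA genB = s • (genE4 * genA ^ 2) + t • genB ^ 2 := by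
    refine exists_eq_smul_add_smul (by decide) (hP.homogeneous (-2) 0 1 1 (by decide) (by decide) _ _
      jacobiA_mem_weakJacobi jacobiB_mem_weakJacobi) fun a b c d hk hm => ?_
    have hb : b ≤ 1 := by omega
    have : (a = 1 ∧ b = 0 ∧ c = 2 ∧ d = 0) ∨ (a = 0 ∧ b = 0 ∧ c = 0 ∧ d = 2) := by
      interval_cases b <;> omega
    rcases this with ⟨rfl, rfl, rfl, rfl⟩ | ⟨rfl, rfl, rfl, rfl⟩
    · left; ring
    · right; ring
  refine ⟨⟨al, be, ga, de, lam, mu, th, ep, xi, et⟩, ⟨Subtype.ext ?_, h1, h2, h3, h4, h5⟩⟩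
  refine (hP.extends_rankinCohen 4 6 (by decide) (by decide) _ _).trans (funext fun p => ?_)
  exact rankinCohenOne_E₄_E₆ p.1

/-! ### Homogeneity of a bracket from its values on generators. -/

section Homogeneous

variable {P : evenWeakJacobi →ₗ[ℂ] evenWeakJacobi →ₗ[ℂ] evenWeakJacobi}

/-- `f` has weight `k` and index `m`, and bracketing it with `g` adds `w` to the weight and `q` to
the index. -/
structure IsHomogeneousAt (P : evenWeakJacobi →ₗ[ℂ] evenWeakJacobi →ₗ[ℂ] evenWeakJacobi)
    (g : evenWeakJacobi) (w : ℤ) (q : ℕ) (k : ℤ) (m : ℕ) (f : evenWeakJacobi) : Prop where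
  mem : (f : ℍ × ℂ → ℂ) ∈ weakJacobi k m
  bracket_mem : (P g f : ℍ × ℂ → ℂ) ∈ weakJacobi (k + w) (m + q)

variable {g : evenWeakJacobi} {w : ℤ} {q : ℕ}

theorem IsHomogeneousAt.mul (hP : IsSkewBiderivation P) {k k' : ℤ} {m m' : ℕ} {f f' : evenWeakJacobi}
    (h : IsHomogeneousAt P g w q k m f) (h' : IsHomogeneousAt P g w q k' m' f') :
    IsHomogeneousAt P g w q (k + k') (m + m') (f * f') := by
  refine ⟨weakJacobi_mul h.mem h'.mem, ?_⟩
  rw [hP.leibniz]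
  refine Submodule.add_mem _ ?_ ?_
  · have := weakJacobi_mul h.bracket_mem h'.mem
    rwa [show k + w + k' = k + k' + w by ring, show m + q + m' = m + m' + q by ring] at this
  · have := weakJacobi_mul h.mem h'.bracket_mem
    rwa [← add_assoc, ← add_assoc] at this

theorem IsHomogeneousAt.one (hP : IsSkewBiderivation P) : IsHomogeneousAt P g w q 0 0 1 := by
  refine ⟨const_mem_weakJacobi 1, ?_⟩
  rw [hP.apply_one]
  exact Submodule.zero_mem _

theorem IsHomogeneousAt.pow (hP : IsSkewBiderivation P) {k : ℤ} {m : ℕ} {f : evenWeakJacobi}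
    (h : IsHomogeneousAt P g w q k m f) (n : ℕ) : IsHomogeneousAt P g w q (n * k) (n * m) (f ^ n) := by
  induction n with
  | zero => simpa using IsHomogeneousAt.one hP
  | succ n ih =>
    have := ih.mul hP h
    rwa [← pow_succ, show (n : ℤ) * k + k = (n + 1 : ℕ) * k by push_cast; ring,
      show n * m + m = (n + 1) * m by ring] at this

/-- Bracketing with `g` is a derivation, so the shift of weight and index by `(w, q)` passes from
the generators to monomials and then to their combinations. -/
theorem bracket_mem_of_generators (hP : IsSkewBiderivation P)
    (h1 : IsHomogeneousAt P g w q 4 0 genE4) (h2 : IsHomogeneousAt P g w q 6 0 genE6)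
    (h3 : IsHomogeneousAt P g w q (-2) 1 genA) (h4 : IsHomogeneousAt P g w q 0 1 genB)
    {k : ℤ} (hk : Even k) {m : ℕ} {f : evenWeakJacobi} (hf : (f : ℍ × ℂ → ℂ) ∈ weakJacobi k m) :
    (P g f : ℍ × ℂ → ℂ) ∈ weakJacobi (k + w) (m + q) := by
  suffices ∃ F : evenWeakJacobi, (F : ℍ × ℂ → ℂ) = f ∧ (P g F : ℍ × ℂ → ℂ) ∈ weakJacobi (k + w) (m + q) by
    obtain ⟨F, hF, h⟩ := this
    rwa [Subtype.ext hF] at h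
  have hspan := mem_jacobiSpan hk hf
  generalize (f : ℍ × ℂ → ℂ) = Φ at hspan
  clear hf
  induction hspan using Submodule.span_induction with
  | mem Φ h =>
    obtain ⟨a, b, c, d, rfl, rfl, rfl⟩ := h
    refine ⟨_, coe_genMonomial a b c d, ?_⟩
    have := ((((h1.pow hP a).mul hP (h2.pow hP b)).mul hP (h3.pow hP c)).mul hP (h4.pow hP d)).bracket_mem
    rwa [show (a : ℤ) * 4 + b * 6 + c * (-2) + d * 0 = 4 * a + 6 * b - 2 * c by ring,
      show a * 0 + b * 0 + c * 1 + d * 1 = c + d by ring] at this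
  | zero => exact ⟨0, rfl, by rw [map_zero]; exact Submodule.zero_mem _⟩
  | add Φ Ψ _ _ h h' =>
    obtain ⟨F, rfl, hF⟩ := h
    obtain ⟨F', rfl, hF'⟩ := h'
    exact ⟨F + F', rfl, by rw [map_add]; exact Submodule.add_mem _ hF hF'⟩
  | smul a Φ _ h =>
    obtain ⟨F, rfl, hF⟩ := h
    exact ⟨a • F, rfl, by rw [map_smul]; exact Submodule.smul_mem _ a hF⟩

theorem genMonomial_mem_weakJacobi (a b c d : ℕ) {k : ℤ} {m : ℕ} (hk : (4 * a + 6 * b - 2 * c : ℤ) = k)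
    (hm : c + d = m) :
    ((genE4 ^ a * genE6 ^ b * genA ^ c * genB ^ d : evenWeakJacobi) : ℍ × ℂ → ℂ) ∈ weakJacobi k m := by
  -- The zero bracket makes the multiplicativity of `IsHomogeneousAt` a statement about weights and
  -- indices alone.
  have hP : IsSkewBiderivation (0 : evenWeakJacobi →ₗ[ℂ] evenWeakJacobi →ₗ[ℂ] evenWeakJacobi) :=
    ⟨fun _ _ => by simp, fun _ _ _ => by simp⟩
  have h {k : ℤ} {m : ℕ} {f : evenWeakJacobi} (hf : (f : ℍ × ℂ → ℂ) ∈ weakJacobi k m) :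
      IsHomogeneousAt 0 0 0 0 k m f := ⟨hf, Submodule.zero_mem _⟩
  have := (((((h genE4_mem_weakJacobi).pow hP a).mul hP ((h genE6_mem_weakJacobi).pow hP b)).mul hP
    ((h (f := genA) jacobiA_mem_weakJacobi).pow hP c)).mul hP
    ((h (f := genB) jacobiB_mem_weakJacobi).pow hP d)).mem
  rwa [show (a : ℤ) * 4 + b * 6 + c * (-2) + d * 0 = k by rw [← hk]; ring,
    show a * 0 + b * 0 + c * 1 + d * 1 = m by rw [← hm]; ring] at this

variable {t : BracketParams}

theorem HasGeneratorValues.gen_bracket_mem (h : HasGeneratorValues P genA genB t) (hP : IsSkewBiderivation P)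
    (i j : Fin 4) : (P (jacobiGen i) (jacobiGen j) : ℍ × ℂ → ℂ) ∈
      weakJacobi (![4, 6, -2, 0] j + (![4, 6, -2, 0] i + 2)) (![0, 0, 1, 1] j + ![0, 0, 1, 1] i) := by
  have c01 : (P genE4 genE6 : ℍ × ℂ → ℂ) ∈ weakJacobi 12 0 := by
    rw [h.e4_e6]
    refine Submodule.add_mem _ (Submodule.smul_mem _ _ ?_) (Submodule.smul_mem _ _ ?_)
    · simpa using genMonomial_mem_weakJacobi 3 0 0 0 (k := 12) (m := 0) rfl rfl
    · simpa using genMonomial_mem_weakJacobi 0 2 0 0 (k := 12) (m := 0) rfl rfl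
  have c20 : (P genA genE4 : ℍ × ℂ → ℂ) ∈ weakJacobi 4 1 := by
    rw [h.a_e4]
    refine Submodule.add_mem _ (Submodule.smul_mem _ _ ?_) (Submodule.smul_mem _ _ ?_)
    · simpa using genMonomial_mem_weakJacobi 0 1 1 0 (k := 4) (m := 1) rfl rfl
    · simpa using genMonomial_mem_weakJacobi 1 0 0 1 (k := 4) (m := 1) rfl rfl
  have c21 : (P genA genE6 : ℍ × ℂ → ℂ) ∈ weakJacobi 6 1 := by
    rw [h.a_e6]
    refine Submodule.add_mem _ (Submodule.smul_mem _ _ ?_) (Submodule.smul_mem _ _ ?_)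
    · simpa using genMonomial_mem_weakJacobi 2 0 1 0 (k := 6) (m := 1) rfl rfl
    · simpa using genMonomial_mem_weakJacobi 0 1 0 1 (k := 6) (m := 1) rfl rfl
  have c30 : (P genB genE4 : ℍ × ℂ → ℂ) ∈ weakJacobi 6 1 := by
    rw [h.b_e4]
    refine Submodule.add_mem _ (Submodule.smul_mem _ _ ?_) (Submodule.smul_mem _ _ ?_)
    · simpa using genMonomial_mem_weakJacobi 2 0 1 0 (k := 6) (m := 1) rfl rfl
    · simpa using genMonomial_mem_weakJacobi 0 1 0 1 (k := 6) (m := 1) rfl rfl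
  have c31 : (P genB genE6 : ℍ × ℂ → ℂ) ∈ weakJacobi 8 1 := by
    rw [h.b_e6]
    refine Submodule.add_mem _ (Submodule.smul_mem _ _ ?_) (Submodule.smul_mem _ _ ?_)
    · simpa using genMonomial_mem_weakJacobi 1 1 1 0 (k := 8) (m := 1) rfl rfl
    · simpa using genMonomial_mem_weakJacobi 2 0 0 1 (k := 8) (m := 1) rfl rfl
  have c23 : (P genA genB : ℍ × ℂ → ℂ) ∈ weakJacobi 0 2 := by
    rw [h.a_b]
    refine Submodule.add_mem _ (Submodule.smul_mem _ _ ?_) (Submodule.smul_mem _ _ ?_)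
    · simpa using genMonomial_mem_weakJacobi 1 0 2 0 (k := 0) (m := 2) rfl rfl
    · simpa using genMonomial_mem_weakJacobi 0 0 0 2 (k := 0) (m := 2) rfl rfl
  have hself {k : ℤ} {m : ℕ} (f : evenWeakJacobi) : (P f f : ℍ × ℂ → ℂ) ∈ weakJacobi k m := by
    rw [hP.apply_self]
    exact Submodule.zero_mem _
  have hswap {k : ℤ} {m : ℕ} {f g : evenWeakJacobi} (hfg : (P f g : ℍ × ℂ → ℂ) ∈ weakJacobi k m) :
      (P g f : ℍ × ℂ → ℂ) ∈ weakJacobi k m := by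
    rw [hP.skew]
    exact Submodule.neg_mem _ hfg
  fin_cases i <;> fin_cases j
  exacts [hself _, c01, hswap c20, hswap c30, hswap c01, hself _, hswap c21, hswap c31, c20, c21, hself _,
    c23, c30, c31, hswap c23, hself _]

/-- The passage from generators to forms is made twice, once in each argument, with skew-symmetry in
between. -/
theorem HasGeneratorValues.homogeneous (h : HasGeneratorValues P genA genB t) (hP : IsSkewBiderivation P)
    {k l : ℤ} {p q : ℕ} (hk : Even k) (hl : Even l) {f g : evenWeakJacobi}
    (hf : (f : ℍ × ℂ → ℂ) ∈ weakJacobi k p) (hg : (g : ℍ × ℂ → ℂ) ∈ weakJacobi l q) :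
    (P f g : ℍ × ℂ → ℂ) ∈ weakJacobi (k + l + 2) (p + q) := by
  have hgen (j : Fin 4) : (P f (jacobiGen j) : ℍ × ℂ → ℂ) ∈
      weakJacobi (![4, 6, -2, 0] j + (k + 2)) (![0, 0, 1, 1] j + p) := by
    have := bracket_mem_of_generators hP ⟨genE4_mem_weakJacobi, h.gen_bracket_mem hP j 0⟩
      ⟨genE6_mem_weakJacobi, h.gen_bracket_mem hP j 1⟩ ⟨jacobiA_mem_weakJacobi, h.gen_bracket_mem hP j 2⟩
      ⟨jacobiB_mem_weakJacobi, h.gen_bracket_mem hP j 3⟩ hk hf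
    rw [hP.skew]
    refine Submodule.neg_mem _ ?_
    rwa [add_comm _ p, show ![4, 6, -2, 0] j + (k + 2) = k + (![4, 6, -2, 0] j + 2) by ring]
  have := bracket_mem_of_generators hP ⟨genE4_mem_weakJacobi, hgen 0⟩
      ⟨genE6_mem_weakJacobi, hgen 1⟩ ⟨jacobiA_mem_weakJacobi, hgen 2⟩
      ⟨jacobiB_mem_weakJacobi, hgen 3⟩ hl hg
  rwa [add_comm q p, show l + (k + 2) = k + l + 2 by ring] at this

end Homogeneous

/-! ### The bracket on modular forms is the Rankin-Cohen bracket. -/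

section RankinCohen

open Derivative

variable {P : evenWeakJacobi →ₗ[ℂ] evenWeakJacobi →ₗ[ℂ] evenWeakJacobi}

/-- `F` is the lift of a holomorphic function `h`, and its bracket with `G` is the first
Rankin-Cohen bracket of `g` in weight `l` and `h` in weight `k`. -/
structure IsRankinCohenAt (P : evenWeakJacobi →ₗ[ℂ] evenWeakJacobi →ₗ[ℂ] evenWeakJacobi)
    (G : evenWeakJacobi) (g : ℍ → ℂ) (l k : ℤ) (F : evenWeakJacobi) (h : ℍ → ℂ) : Prop where
  coe : (F : ℍ × ℂ → ℂ) = fun p => h p.1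
  mdiff : MDiff h
  bracket : ∀ p : ℍ × ℂ, (P G F : ℍ × ℂ → ℂ) p = l * g p.1 * D h p.1 - k * D g p.1 * h p.1

variable {G : evenWeakJacobi} {g : ℍ → ℂ} {l : ℤ}

/-- For fixed `g` the expression `l g D h - k (D g) h` is a derivation in `h`, because `D` is one
and the weight `k` is additive under products. -/
theorem IsRankinCohenAt.mul (hP : IsSkewBiderivation P) {k k' : ℤ} {F F' : evenWeakJacobi} {h h' : ℍ → ℂ}
    (hF : IsRankinCohenAt P G g l k F h) (hF' : IsRankinCohenAt P G g l k' F' h') :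
    IsRankinCohenAt P G g l (k + k') (F * F') (h * h') := by
  refine ⟨?_, hF.mdiff.mul hF'.mdiff, fun p => ?_⟩
  · rw [MulMemClass.coe_mul, hF.coe, hF'.coe]
    rfl
  · have e : (P G (F * F') : ℍ × ℂ → ℂ) p = (P G F : ℍ × ℂ → ℂ) p * (F' : ℍ × ℂ → ℂ) p +
        (F : ℍ × ℂ → ℂ) p * (P G F' : ℍ × ℂ → ℂ) p := by
      rw [hP.leibniz]
      rfl
    rw [e, hF.bracket, hF'.bracket, hF.coe, hF'.coe, normalizedDerivOfComplex_mul _ _ hF.mdiff hF'.mdiff]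
    simp only [Pi.add_apply, Pi.mul_apply]
    push_cast
    ring

theorem IsRankinCohenAt.one (hP : IsSkewBiderivation P) : IsRankinCohenAt P G g l 0 1 1 := by
  refine ⟨rfl, mdifferentiable_const, fun p => ?_⟩
  rw [hP.apply_one, show (1 : ℍ → ℂ) = fun _ => 1 from rfl, normalizedDerivOfComplex_const]
  simp

theorem IsRankinCohenAt.pow (hP : IsSkewBiderivation P) {k : ℤ} {F : evenWeakJacobi} {h : ℍ → ℂ}
    (hF : IsRankinCohenAt P G g l k F h) (n : ℕ) : IsRankinCohenAt P G g l (n * k) (F ^ n) (h ^ n) := by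
  induction n with
  | zero => simpa using IsRankinCohenAt.one hP
  | succ n ih =>
    have := ih.mul hP hF
    rwa [← pow_succ, ← pow_succ, show (n : ℤ) * k + k = (n + 1 : ℕ) * k by push_cast; ring] at this

/-- Both sides are derivations in the second argument, so agreement on `E₄` and `E₆` suffices, every
modular form being a polynomial in them. -/
theorem bracket_eq_of_eisenstein (hP : IsSkewBiderivation P)
    (h4 : IsRankinCohenAt P G g l 4 genE4 ModularForm.E₄)
    (h6 : IsRankinCohenAt P G g l 6 genE6 ModularForm.E₆) {k : ℤ} (hk : Even k) (f : ModularForm 𝒮ℒ k) :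
    IsRankinCohenAt P G g l k (modularToJacobi hk f) f := by
  suffices ∃ F : evenWeakJacobi, IsRankinCohenAt P G g l k F f by
    obtain ⟨F, hF⟩ := this
    rwa [show modularToJacobi hk f = F from Subtype.ext hF.coe.symm]
  have hspan := f.mem_eisensteinSpan
  generalize (f : ℍ → ℂ) = φ at hspan
  induction hspan using Submodule.span_induction with
  | mem h hh =>
    obtain ⟨a, b, rfl, rfl⟩ := hh
    have := (h4.pow hP a).mul hP (h6.pow hP b)
    rw [show (a : ℤ) * 4 + b * 6 = 4 * a + 6 * b by ring] at this
    exact ⟨_, this⟩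
  | zero =>
    refine ⟨0, rfl, mdifferentiable_const, fun p => ?_⟩
    rw [map_zero, show (0 : ℍ → ℂ) = fun _ => 0 from rfl, normalizedDerivOfComplex_const]
    simp
  | add h h' _ _ hF hF' =>
    obtain ⟨F, hF⟩ := hF
    obtain ⟨F', hF'⟩ := hF'
    refine ⟨F + F', ?_, hF.mdiff.add hF'.mdiff, fun p => ?_⟩
    · rw [AddMemClass.coe_add, hF.coe, hF'.coe]
      rfl
    · rw [map_add, AddMemClass.coe_add, Pi.add_apply, hF.bracket, hF'.bracket,
        normalizedDerivOfComplex_add _ _ hF.mdiff hF'.mdiff]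
      simp only [Pi.add_apply]
      ring
  | smul a h _ hF =>
    obtain ⟨F, hF⟩ := hF
    refine ⟨a • F, ?_, mdifferentiable_const.mul hF.mdiff, fun p => ?_⟩
    · rw [SetLike.val_smul, hF.coe]
      rfl
    · rw [map_smul, SetLike.val_smul, Pi.smul_apply, hF.bracket, normalizedDerivOfComplex_smul _ _ hF.mdiff]
      simp only [Pi.smul_apply, smul_eq_mul]
      ring

theorem IsRankinCohenAt.swap (hP : IsSkewBiderivation P) {k : ℤ} {F : evenWeakJacobi} {h : ℍ → ℂ}
    (hF : IsRankinCohenAt P G g l k F h) (hG : (G : ℍ × ℂ → ℂ) = fun p => g p.1) (hg : MDiff g) :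
    IsRankinCohenAt P F h k l G g := by
  refine ⟨hG, hg, fun p => ?_⟩
  rw [hP.skew, NegMemClass.coe_neg, Pi.neg_apply, hF.bracket]
  ring

/-- The only nontrivial input is the pair `E₄`, `E₆`. It is extended to an arbitrary form in one
argument, swapped by skew-symmetry, and extended in the other. -/
theorem HasGeneratorValues.rankinCohen {t : BracketParams} (h : HasGeneratorValues P genA genB t)
    (hP : IsSkewBiderivation P) {k l : ℤ} (hk : Even k) (hl : Even l) (f : ModularForm 𝒮ℒ k)
    (g : ModularForm 𝒮ℒ l) :
    (P (modularToJacobi hk f) (modularToJacobi hl g) : ℍ × ℂ → ℂ) = fun p => rankinCohenOne f g p.1 := by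
  have h46 : IsRankinCohenAt P genE4 ModularForm.E₄ 4 6 genE6 ModularForm.E₆ := by
    refine ⟨rfl, ModularForm.mdifferentiable _, fun p => ?_⟩
    rw [h.e4_e6]
    exact (rankinCohenOne_E₄_E₆ p.1).symm
  have hself (G : evenWeakJacobi) (g : ℍ → ℂ) (l : ℤ) (hG : (G : ℍ × ℂ → ℂ) = fun p => g p.1) (hg : MDiff g) :
      IsRankinCohenAt P G g l l G g := by
    refine ⟨hG, hg, fun p => ?_⟩
    rw [hP.apply_self, ZeroMemClass.coe_zero, Pi.zero_apply]
    ring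
  have h4 := hself genE4 ModularForm.E₄ 4 rfl (ModularForm.mdifferentiable _)
  have h6 := hself genE6 ModularForm.E₆ 6 rfl (ModularForm.mdifferentiable _)
  have h64 := h46.swap hP rfl (ModularForm.mdifferentiable _)
  have f4 := (bracket_eq_of_eisenstein hP h4 h46 hk f).swap hP rfl (ModularForm.mdifferentiable _)
  have f6 := (bracket_eq_of_eisenstein hP h64 h6 hk f).swap hP rfl (ModularForm.mdifferentiable _)
  exact funext (bracket_eq_of_eisenstein hP f4 f6 hl g).bracket

end RankinCohen

/-! ### The classification of admissible brackets. -/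

theorem mainTheorem5 :
    ∃ (hA : jacobiA ∈ weakJacobi (-2) 1) (hB : jacobiB ∈ weakJacobi 0 1),
      let A : evenWeakJacobi := ⟨jacobiA, weakJacobi_le_evenWeakJacobi (by decide) hA⟩
      let B : evenWeakJacobi := ⟨jacobiB, weakJacobi_le_evenWeakJacobi (by decide) hB⟩
      (∀ P : evenWeakJacobi →ₗ[ℂ] evenWeakJacobi →ₗ[ℂ] evenWeakJacobi,
        IsAdmissible P ↔
          IsPoissonBracket P ∧ ∃ t : BracketParams, t.InTable ∧ HasGeneratorValues P A B t) ∧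
      (∀ t : BracketParams, t.InTable →
        ∃! P : evenWeakJacobi →ₗ[ℂ] evenWeakJacobi →ₗ[ℂ] evenWeakJacobi,
          IsPoissonBracket P ∧ HasGeneratorValues P A B t) := by
  refine ⟨jacobiA_mem_weakJacobi, jacobiB_mem_weakJacobi, fun P => ⟨fun hP => ?_, ?_⟩, fun t ht => ?_⟩
  · obtain ⟨t, ht⟩ := hP.exists_hasGeneratorValues
    exact ⟨hP.poisson, t, (ht.isConsistent hP.poisson).inTable, ht⟩
  · rintro ⟨hP, t, -, ht⟩
    have ht : HasGeneratorValues P genA genB t := ht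
    have hs := hP.isSkewBiderivation
    exact ⟨hP, fun _ _ hk hl f g => ht.rankinCohen hs hk hl f g,
      fun _ _ _ _ hk hl _ _ hf hg => ht.homogeneous hs hk hl hf hg⟩
  · obtain ⟨P, hs, hP⟩ := exists_hasGeneratorValues t
    exact ⟨P, ⟨hP.isPoissonBracket hs ht.isConsistent, hP⟩, fun Q hQ =>
      HasGeneratorValues.unique hQ.2 hQ.1.isSkewBiderivation hP hs⟩
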